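/- Let $(M,J,g)$ be an almost Hermitian manifold, that is, a smooth manifold (without boundary) with a smooth almost complex structure $J$ ($J^2=-1$) and a smooth Riemannian metric $g$ such that $g(JX,JY)=g(X,Y)$. Let $\dim M=2n$, let $\omega(X,Y)=g(JX,Y)$ be the fundamental $2$-form, and let $\mathcal A$ be the algebra of smooth real differential forms on $M$ with wedge product $\wedge$, graded by degree, and exterior derivative $d$. Extend $J$ to forms by $(J\alpha)(X_1,\dots,X_k)=\alpha(JX_1,\dots,JX_k)$. Let $\langle-,-\rangle$ be the pointwise metric on forms induced by $g$, write $\varphi^*$ for the pointwise metric adjoint of a $C^\infty(M)$-linear operator $\varphi$ on forms, and let $\star$ be the Hodge star, $\alpha\wedge\star\beta=\langle\alpha,\beta\rangle\,\omega^n/n!$. Put \[ L=\omega\wedge-,\quad \Lambda=L^*,\quad d_c=J^{-1}dJ,\quad d_c^*=-\star d_c\star,\quad T=[\Lambda,d\omega\wedge-],\quad T_c=J^{-1}TJ,\quad d\omega_c=J^{-1}(d\omega\wedge-)J . \] A linear operator $f$ of degree $k$ on a graded-commutative algebra has order $\le 0$ if $[L_a,f]=0$ for all homogeneous $a$, and order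 $\le r+1$ if $[L_a,f]$ has order $\le r$ for all homogeneous $a$, where $L_a$ is left multiplication by $a$ and $[-,-]$ is the graded commutator. A commutative $\mathrm{BV}_\infty$-algebra is a unital commutative dg-algebra $(A,\wedge,d)$ with linear operators $\Delta_0=d,\Delta_1,\Delta_2,\dots$ such that $\Delta_i$ has degree $1-2i$ and order $\le i+1$, and $\sum_{i=0}^{m}\Delta_i\Delta_{m-i}=0$ for all $m\ge 0$. Then the tuple \[ \bigl(\mathcal A,\ \wedge,\ d,\ \Delta_1=-(d_c^*+T_c^*),\ \Delta_2=(d\omega_c)^*\bigr) \] (with $\Delta_i=0$ for $i\ge3$) is a commutative $\mathrm{BV}_\infty$-algebra, and its total differential satisfies \[ d+\Delta_1\xi+\Delta_2\xi^2=e^{\Lambda\xi}\,d\,e^{-\Lambda\xi}\qquad\text{in } \mathrm{End}(\mathcal A)[[\xi]]. \] Moreover, in the almost Kähler case $d\omega=0$, one has $\Delta_2=0$ and $\Delta_1=-d_c^*=[i_\pi,d]$, where $i_\pi$ is contraction of forms with the Poisson bivector field $\pi$ of $\omega$ (normalized so that $\omega=\sum_a dx_a\wedge dy_a$ at a point gives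 $\pi=\sum_a\partial_{x_a}\wedge\partial_{y_a}$ there, with $i_{X\wedge Y}\alpha=\alpha(X,Y,\dots)$); that is, the structure is then Koszul's $\mathrm{BV}$-algebra. -/

import Mathlib

open scoped Manifold ContDiff

noncomputable section

/-! ### Graded algebra: operators of finite order and commutative BV-infinity algebras -/

namespace BV

variable {K A : Type*} [Field K] [AddCommGroup A] [Module K A]

/-- `f` is homogeneous of degree `k` for the grading `gr`. -/
def HasDegree (gr : ℤ → Submodule K A) (k : ℤ) (f : Module.End K A) : Prop :=
  ∀ (j : ℤ), ∀ a ∈ gr j, f a ∈ gr (j + k)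

/-- The graded commutator `[f₁, f₂] = f₁ f₂ - (-1)^{|f₁| |f₂|} f₂ f₁` of operators of degrees
`k₁` and `k₂`. -/
def gradedComm (k₁ k₂ : ℤ) (f₁ f₂ : Module.End K A) : Module.End K A :=
  f₁ * f₂ - Int.negOnePow (k₁ * k₂) • (f₂ * f₁)

/-- `HasOrderLE gr mul r k f`: the operator `f` has degree `k` and algebraic order `≤ r`
(Grothendieck). Order `≤ 0` means (graded) linearity over the algebra, that is `[L_a, f] = 0` for
every homogeneous `a`; order `≤ r + 1` means that `[L_a, f]` has order `≤ r` for every homogeneous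
`a`. Here `L_a = mul a` is left multiplication by `a`. -/
def HasOrderLE (gr : ℤ → Submodule K A) (mul : A →ₗ[K] A →ₗ[K] A) :
    ℕ → ℤ → Module.End K A → Prop
  | 0, k, f => HasDegree gr k f ∧ ∀ (j : ℤ), ∀ a ∈ gr j, gradedComm j k (mul a) f = 0
  | r + 1, k, f => HasDegree gr k f ∧
      ∀ (j : ℤ), ∀ a ∈ gr j, HasOrderLE gr mul r (j + k) (gradedComm j k (mul a) f)

/-- `(A, mul, one)` with the `ℤ`-grading `gr` is a unital graded-commutative algebra. -/
structure IsGradedCommAlgebra (gr : ℤ → Submodule K A) (mul : A →ₗ[K] A →ₗ[K] A) (one : A) :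
    Prop where
  isInternal : DirectSum.IsInternal gr
  one_mem : one ∈ gr 0
  mul_mem : ∀ (i j : ℤ), ∀ a ∈ gr i, ∀ b ∈ gr j, mul a b ∈ gr (i + j)
  one_mul : ∀ a, mul one a = a
  mul_one : ∀ a, mul a one = a
  mul_assoc : ∀ a b c, mul (mul a b) c = mul a (mul b c)
  mul_comm : ∀ (i j : ℤ), ∀ a ∈ gr i, ∀ b ∈ gr j, mul a b = Int.negOnePow (i * j) • mul b a

/-- `(A, mul, d)` is a commutative dg-algebra. -/
structure IsCDGA (gr : ℤ → Submodule K A) (mul : A →ₗ[K] A →ₗ[K] A) (one : A)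
    (d : Module.End K A) : Prop extends IsGradedCommAlgebra gr mul one where
  d_degree : HasDegree gr 1 d
  d_sq : d * d = 0
  leibniz : ∀ (i : ℤ), ∀ a ∈ gr i, ∀ b,
    d (mul a b) = mul (d a) b + Int.negOnePow i • mul a (d b)

/-- `(A, Δ 0, Δ 1, …)` is a multicomplex: `Δ i` has degree `1 - 2 i` and
`∑_{i + j = n} Δ i Δ j = 0` for all `n`. -/
structure IsMulticomplex (gr : ℤ → Submodule K A) (Δ : ℕ → Module.End K A) : Prop where
  isInternal : DirectSum.IsInternal gr
  degree : ∀ i : ℕ, HasDegree gr (1 - 2 * (i : ℤ)) (Δ i)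
  relation : ∀ n : ℕ, ∑ p ∈ Finset.HasAntidiagonal.antidiagonal n, Δ p.1 * Δ p.2 = 0

/-- `(A, mul, Δ 0, Δ 1, Δ 2, …)` is a commutative BV-infinity algebra with differential `Δ 0`. -/
structure IsCommBVInfinity (gr : ℤ → Submodule K A) (mul : A →ₗ[K] A →ₗ[K] A) (one : A)
    (Δ : ℕ → Module.End K A) : Prop where
  cdga : IsCDGA gr mul one (Δ 0)
  multicomplex : IsMulticomplex gr Δ
  order : ∀ n : ℕ, HasOrderLE gr mul (n + 1) (1 - 2 * (n : ℤ)) (Δ n)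

/-- The sequence of operators `d, Δ₁, Δ₂, 0, 0, …`. -/
def operators (d Δ₁ Δ₂ : Module.End K A) : ℕ → Module.End K A
  | 0 => d
  | 1 => Δ₁
  | 2 => Δ₂
  | _ => 0

/-- The formal power series `e^{Φ ξ} = ∑ Φ^n ξ^n / n!` in `End(A)[[ξ]]`. -/
def expSeries (Φ : Module.End K A) : PowerSeries (Module.End K A) :=
  PowerSeries.mk fun n => ((n.factorial : K)⁻¹) • Φ ^ n

end BV

/-! ### Exterior forms on a Hermitian vector space -/

/-- Real exterior forms of mixed degree on `V`: the family of the components of each degree.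
(For finite-dimensional `V` the components of degree `> dim V` vanish, so this is the exterior
algebra of the dual of `V`.) -/
abbrev ExtForm (V : Type*) [AddCommGroup V] [Module ℝ V] : Type _ :=
  ∀ k : ℕ, V [⋀^Fin k]→ₗ[ℝ] ℝ

namespace ExtForm

variable {V : Type*} [AddCommGroup V] [Module ℝ V]

/-- The wedge product of a `k`-form and an `l`-form, as a form of degree `m = k + l`:
`(a ∧ b)(v) = ∑ sign(σ) a(v_{σ 1}, …, v_{σ k}) b(v_{σ (k+1)}, …, v_{σ m})` over `(k, l)`-shuffles. -/
def wedgeHom {k l m : ℕ} (h : k + l = m) (a : V [⋀^Fin k]→ₗ[ℝ] ℝ) (b : V [⋀^Fin l]→ₗ[ℝ] ℝ) :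
    V [⋀^Fin m]→ₗ[ℝ] ℝ :=
  ((LinearMap.mul' ℝ ℝ).compAlternatingMap (AlternatingMap.domCoprod' (a ⊗ₜ[ℝ] b))).domDomCongr
    (finSumFinEquiv.trans (finCongr h))

theorem wedgeHom_add_left {k l m : ℕ} (h : k + l = m) (a a' : V [⋀^Fin k]→ₗ[ℝ] ℝ)
    (b : V [⋀^Fin l]→ₗ[ℝ] ℝ) : wedgeHom h (a + a') b = wedgeHom h a b + wedgeHom h a' b := by
  simp only [wedgeHom, TensorProduct.add_tmul, map_add]
  ext v
  simp

theorem wedgeHom_add_right {k l m : ℕ} (h : k + l = m) (a : V [⋀^Fin k]→ₗ[ℝ] ℝ)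
    (b b' : V [⋀^Fin l]→ₗ[ℝ] ℝ) : wedgeHom h a (b + b') = wedgeHom h a b + wedgeHom h a b' := by
  simp only [wedgeHom, TensorProduct.tmul_add, map_add]
  ext v
  simp

theorem wedgeHom_smul_left {k l m : ℕ} (h : k + l = m) (c : ℝ) (a : V [⋀^Fin k]→ₗ[ℝ] ℝ)
    (b : V [⋀^Fin l]→ₗ[ℝ] ℝ) : wedgeHom h (c • a) b = c • wedgeHom h a b := by
  simp only [wedgeHom, ← TensorProduct.smul_tmul', map_smul]
  ext v
  simp

theorem wedgeHom_smul_right {k l m : ℕ} (h : k + l = m) (c : ℝ) (a : V [⋀^Fin k]→ₗ[ℝ] ℝ)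
    (b : V [⋀^Fin l]→ₗ[ℝ] ℝ) : wedgeHom h a (c • b) = c • wedgeHom h a b := by
  simp only [wedgeHom, TensorProduct.tmul_smul, map_smul]
  ext v
  simp

/-- The wedge product of forms of mixed degree. -/
def wedge : ExtForm V →ₗ[ℝ] ExtForm V →ₗ[ℝ] ExtForm V :=
  LinearMap.mk₂ ℝ
    (fun α β m => ∑ p : {p : ℕ × ℕ // p ∈ Finset.HasAntidiagonal.antidiagonal m},
      wedgeHom (Finset.HasAntidiagonal.mem_antidiagonal.1 p.2) (α p.1.1) (β p.1.2))
    (fun α α' β => by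
      funext m
      simp only [Pi.add_apply, wedgeHom_add_left, Finset.sum_add_distrib])
    (fun c α β => by
      funext m
      simp only [Pi.smul_apply, wedgeHom_smul_left, Finset.smul_sum])
    (fun α β β' => by
      funext m
      simp only [Pi.add_apply, wedgeHom_add_right, Finset.sum_add_distrib])
    (fun c α β => by
      funext m
      simp only [Pi.smul_apply, wedgeHom_smul_right, Finset.smul_sum])

/-- The unit `1`, a form of degree `0`. -/
def one : ExtForm V := Pi.single 0 (AlternatingMap.constOfIsEmpty ℝ V (Fin 0) 1)

/-- Pullback of forms along a linear endomorphism: `(f^* α)(v₁, …, v_k) = α(f v₁, …, f v_k)`. -/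
def pull (f : V →ₗ[ℝ] V) : ExtForm V →ₗ[ℝ] ExtForm V where
  toFun α k := (α k).compLinearMap f
  map_add' _ _ := rfl
  map_smul' _ _ := rfl

end ExtForm

/-- A Hermitian structure on a real vector space: a Euclidean metric `g` and a compatible
complex structure `J`. -/
structure HermitianSpace (V : Type*) [AddCommGroup V] [Module ℝ V] where
  g : V →ₗ[ℝ] V →ₗ[ℝ] ℝ
  g_symm : ∀ v w, g v w = g w v
  g_pos : ∀ v, v ≠ 0 → 0 < g v v
  J : V →ₗ[ℝ] V
  J_sq : ∀ v, J (J v) = -v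
  g_J : ∀ v w, g (J v) (J w) = g v w

namespace HermitianSpace

open Module ExtForm

variable {V : Type*} [AddCommGroup V] [Module ℝ V] (h : HermitianSpace V)

/-- The fundamental `2`-form `ω(X, Y) = g(J X, Y)`. -/
def fundamentalForm : V [⋀^Fin 2]→ₗ[ℝ] ℝ where
  toFun v := h.g (h.J (v 0)) (v 1)
  map_update_add' v i x y := by
    fin_cases i <;> simp [Function.update]
  map_update_smul' v i c x := by
    fin_cases i <;> simp [Function.update]
  map_eq_zero_of_eq' v i j hv hij := by
    have key : ∀ w, h.g (h.J w) w = 0 := by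
      intro w
      have h1 := h.g_J (h.J w) w
      rw [h.J_sq, map_neg, LinearMap.neg_apply, h.g_symm w] at h1
      linarith
    have h01 : v 0 = v 1 := by
      fin_cases i <;> fin_cases j <;> simp_all
    rw [h01]
    exact key _

/-- `ω` as a form of mixed degree, concentrated in degree `2`. -/
def omega : ExtForm V := Pi.single 2 h.fundamentalForm

/-- The Lefschetz operator `L = ω ∧ -`. -/
def L : Module.End ℝ (ExtForm V) := wedge h.omega

/-- The action of `J` on forms as an algebra automorphism, `(J α)(v₁, …) = α(J v₁, …)`. -/
def Jform : Module.End ℝ (ExtForm V) := pull h.J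

/-- The inverse of the action of `J` on forms (recall `J⁻¹ = -J` on vectors). -/
def JformInv : Module.End ℝ (ExtForm V) := pull (-h.J)

/-- The volume form `ω^n / n!` where `dim V = 2 n`. -/
def vol : V [⋀^Fin (finrank ℝ V)]→ₗ[ℝ] ℝ :=
  (((finrank ℝ V / 2).factorial : ℝ)⁻¹) • ((h.L ^ (finrank ℝ V / 2)) one) (finrank ℝ V)

variable [FiniteDimensional ℝ V]

theorem exists_orthonormal_basis : ∃ b : Basis (Fin (finrank ℝ V)) ℝ V,
    ∀ i j, h.g (b i) (b j) = if i = j then 1 else 0 := by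
  let core : InnerProductSpace.Core ℝ V :=
    { inner := fun v w => h.g v w
      conj_inner_symm := fun v w => by simpa using h.g_symm w v
      re_inner_nonneg := fun v => by
        by_cases hv : v = 0
        · simp [hv]
        · simpa using (h.g_pos v hv).le
      add_left := fun _ _ _ => by simp
      smul_left := fun _ _ _ => by simp
      definite := fun v hv => by
        by_contra hne
        exact (h.g_pos v hne).ne' hv }
  let _ : NormedAddCommGroup V := core.toNormedAddCommGroup
  let _ : InnerProductSpace ℝ V := InnerProductSpace.ofCore core.toCore
  refine ⟨(stdOrthonormalBasis ℝ V).toBasis, fun i j => ?_⟩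
  have := orthonormal_iff_ite.1 (stdOrthonormalBasis ℝ V).orthonormal i j
  rw [OrthonormalBasis.coe_toBasis]
  exact this

/-- A `g`-orthonormal basis of `V`. -/
def onb : Basis (Fin (finrank ℝ V)) ℝ V := h.exists_orthonormal_basis.choose

/-- The metric induced by `g` on forms: for `k`-forms,
`⟨α, β⟩ = (1/k!) ∑_{i₁, …, i_k} α(e_{i₁}, …, e_{i_k}) β(e_{i₁}, …, e_{i_k})` for an orthonormal basis
(so that `⟨a₁ ∧ ⋯ ∧ a_k, b₁ ∧ ⋯ ∧ b_k⟩ = det ⟨a_i, b_j⟩`), forms of different degrees being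
orthogonal. It does not depend on the orthonormal basis. -/
def formInner : LinearMap.BilinForm ℝ (ExtForm V) :=
  LinearMap.mk₂ ℝ
    (fun α β => ∑ k ∈ Finset.range (finrank ℝ V + 1), ((k.factorial : ℝ)⁻¹) *
      ∑ i : Fin k → Fin (finrank ℝ V), α k (h.onb ∘ i) * β k (h.onb ∘ i))
    (by intro α α' β; simp [add_mul, Finset.sum_add_distrib, mul_add])
    (by
      intro c α β
      simp only [Pi.smul_apply, AlternatingMap.smul_apply, smul_eq_mul, Finset.mul_sum]
      exact Finset.sum_congr rfl fun _ _ => Finset.sum_congr rfl fun _ _ => by ring)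
    (by intro α β β'; simp [Finset.sum_add_distrib, mul_add])
    (by
      intro c α β
      simp only [Pi.smul_apply, AlternatingMap.smul_apply, smul_eq_mul, Finset.mul_sum]
      exact Finset.sum_congr rfl fun _ _ => Finset.sum_congr rfl fun _ _ => by ring)

theorem formInner_apply (α β : ExtForm V) : h.formInner α β =
    ∑ k ∈ Finset.range (finrank ℝ V + 1), ((k.factorial : ℝ)⁻¹) *
      ∑ i : Fin k → Fin (finrank ℝ V), α k (h.onb ∘ i) * β k (h.onb ∘ i) := rfl

theorem formInner_self_eq_zero {α : ExtForm V} (hα : h.formInner α α = 0) : α = 0 := by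
  have hnn : ∀ k ∈ Finset.range (finrank ℝ V + 1), 0 ≤ ((k.factorial : ℝ)⁻¹) *
      ∑ i : Fin k → Fin (finrank ℝ V), α k (h.onb ∘ i) * α k (h.onb ∘ i) := fun k _ =>
    mul_nonneg (by positivity) (Finset.sum_nonneg fun i _ => mul_self_nonneg _)
  have h0 := (Finset.sum_eq_zero_iff_of_nonneg hnn).1 hα
  funext k
  refine Basis.ext_alternating h.onb fun v hv => ?_
  have hk : k ∈ Finset.range (finrank ℝ V + 1) := by
    have := Fintype.card_le_of_injective v hv
    simp only [Fintype.card_fin] at this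
    exact Finset.mem_range.2 (by lia)
  have h1 := (mul_eq_zero.1 (h0 k hk)).resolve_left (by positivity)
  have h2 := (Finset.sum_eq_zero_iff_of_nonneg fun i _ => mul_self_nonneg _).1 h1 v
    (Finset.mem_univ _)
  exact mul_self_eq_zero.1 h2

theorem finiteDimensional_extForm (h : HermitianSpace V) : FiniteDimensional ℝ (ExtForm V) := by
  let f : ExtForm V →ₗ[ℝ] (∀ k : Fin (finrank ℝ V + 1), (Fin k → Fin (finrank ℝ V)) → ℝ) :=
    { toFun := fun α k i => α k (h.onb ∘ i)
      map_add' := fun _ _ => rfl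
      map_smul' := fun _ _ => rfl }
  refine FiniteDimensional.of_injective f ((injective_iff_map_eq_zero f).2 fun α hα => ?_)
  refine h.formInner_self_eq_zero ?_
  rw [formInner_apply]
  refine Finset.sum_eq_zero fun k hk => ?_
  have hz : ∀ i, α k (h.onb ∘ i) = 0 := fun i =>
    congrFun (congrFun hα ⟨k, Finset.mem_range.1 hk⟩) i
  simp [hz]

theorem exists_adjoint (φ : Module.End ℝ (ExtForm V)) :
    ∃ ψ : Module.End ℝ (ExtForm V), ∀ α β, h.formInner (φ α) β = h.formInner α (ψ β) := by
  have := h.finiteDimensional_extForm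
  have hinj : Function.Injective h.formInner.flip :=
    (injective_iff_map_eq_zero _).2 fun β hβ =>
      h.formInner_self_eq_zero (LinearMap.congr_fun hβ β)
  let e : ExtForm V ≃ₗ[ℝ] Module.Dual ℝ (ExtForm V) :=
    LinearEquiv.ofInjectiveOfFinrankEq h.formInner.flip hinj
      Subspace.dual_finrank_eq.symm
  refine ⟨e.symm.toLinearMap ∘ₗ φ.dualMap ∘ₗ e.toLinearMap, fun α β => ?_⟩
  have := LinearMap.congr_fun (e.apply_symm_apply (φ.dualMap (e β))) α
  exact this.symm

/-- The metric adjoint of an operator on forms, `⟨φ α, β⟩ = ⟨α, φ^* β⟩`. -/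
def adjoint (φ : Module.End ℝ (ExtForm V)) : Module.End ℝ (ExtForm V) :=
  (h.exists_adjoint φ).choose

/-- `Λ = L^*`, the metric adjoint of the Lefschetz operator. -/
def Lam : Module.End ℝ (ExtForm V) := h.adjoint h.L

/-- `S` is the Hodge star operator: the part of top degree of `α ∧ S β` is `⟨α, β⟩ vol`. For `α` and
`β` of the same degree this is the usual `α ∧ ⋆ β = ⟨α, β⟩ vol`; using all `α` of mixed degree also
says that `S` maps `k`-forms to `(dim V - k)`-forms. -/
def IsHodgeStar (S : Module.End ℝ (ExtForm V)) : Prop :=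
  ∀ α β, wedge α (S β) (finrank ℝ V) = h.formInner α β • h.vol

open Classical in
/-- The Hodge star operator. -/
def star : Module.End ℝ (ExtForm V) :=
  if H : ∃ S, h.IsHodgeStar S then H.choose else 0

end HermitianSpace

/-- Contraction of forms with the Poisson bivector `π` of a nondegenerate `2`-form `w`, depending on
`w` only. In a basis `b`, with `w_{ij} = w(b_i, b_j)`, the bivector is
`π = (1/2) ∑ π^{ij} b_i ∧ b_j` where the matrix `(π^{ij})` is the transpose of the inverse of
`(w_{ij})`, and `(i_π α)(v₁, …) = (1/2) ∑ π^{ij} α(b_i, b_j, v₁, …)`. For `w = ∑ dx_a ∧ dy_a` this is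
`π = ∑ ∂/∂x_a ∧ ∂/∂y_a`. -/
def poissonContraction {V : Type*} [AddCommGroup V] [Module ℝ V] [FiniteDimensional ℝ V]
    (w : V [⋀^Fin 2]→ₗ[ℝ] ℝ) (α : ExtForm V) : ExtForm V :=
  let b := Module.finBasis ℝ V
  let W : Matrix (Fin (Module.finrank ℝ V)) (Fin (Module.finrank ℝ V)) ℝ :=
    Matrix.of fun i j => w ![b i, b j]
  fun k => (1 / 2 : ℝ) • ∑ i, ∑ j, (W⁻¹ j i) • ((α (k + 2)).curryLeft (b i)).curryLeft (b j)

/-! ### Differential forms on a manifold -/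

section Manifold

open Bundle

variable (E : Type*) [NormedAddCommGroup E] [NormedSpace ℝ E] [FiniteDimensional ℝ E]
variable (M : Type*) [TopologicalSpace M] [ChartedSpace E M]

instance tangentSpace_finiteDimensional (x : M) :
    FiniteDimensional ℝ (TangentSpace 𝓘(ℝ, E) x) :=
  inferInstanceAs (FiniteDimensional ℝ E)

/-- Not necessarily smooth real differential forms of mixed degree on `M`. -/
abbrev RoughForm : Type _ := ∀ x : M, ExtForm (TangentSpace 𝓘(ℝ, E) x)

variable {E}

/-- On a finite-dimensional normed space every alternating map is continuous. -/
def toContinuousAlternating {k : ℕ} (a : E [⋀^Fin k]→ₗ[ℝ] ℝ) : E [⋀^Fin k]→L[ℝ] ℝ :=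
  { a with
    cont := by
      let b := Module.finBasis ℝ E
      have : (a : (Fin k → E) → ℝ) = fun v => ∑ r : Fin k → Fin (Module.finrank ℝ E),
          (∏ i, b.repr (v i) (r i)) • a (fun i => b (r i)) := by
        funext v
        conv_lhs => rw [show v = fun i => ∑ j, b.repr (v i) j • b j from
          funext fun i => (b.sum_repr (v i)).symm]
        have h1 := a.toMultilinearMap.map_sum (fun i j => b.repr (v i) j • b j)
        refine h1.trans (Finset.sum_congr rfl fun r _ => ?_)
        exact a.toMultilinearMap.map_smul_univ _ _
      change Continuous (a : (Fin k → E) → ℝ)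
      rw [this]
      simp only [smul_eq_mul]
      refine continuous_finsetSum _ fun r _ => Continuous.mul ?_ continuous_const
      refine continuous_finsetProd _ fun i _ => ?_
      exact ((b.coord (r i)).continuous_of_finiteDimensional).comp (continuous_apply i) }

variable {M}

/-- The expression of a `k`-form on `M` in the chart around `x₀`: the pullback to (the target of
the chart in) `E` by the inverse of the chart. -/
def localExpr {k : ℕ} (a : ∀ x : M, TangentSpace 𝓘(ℝ, E) x [⋀^Fin k]→ₗ[ℝ] ℝ) (x₀ : M) (y : E) :
    E [⋀^Fin k]→L[ℝ] ℝ :=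
  toContinuousAlternating ((a ((extChartAt 𝓘(ℝ, E) x₀).symm y)).compLinearMap
    (mfderiv 𝓘(ℝ, E) 𝓘(ℝ, E) (extChartAt 𝓘(ℝ, E) x₀).symm y).toLinearMap)

variable (E M)

/-- The subspace of smooth real differential forms on `M`: those whose components of each degree
have smooth expressions in the charts. -/
def SmoothForms : Submodule ℝ (RoughForm E M) where
  carrier := {α | ∀ (k : ℕ) (x₀ : M),
    ContDiffOn ℝ ∞ (localExpr (fun x => α x k) x₀) (extChartAt 𝓘(ℝ, E) x₀).target}
  add_mem' hα hβ k x₀ := (hα k x₀).add (hβ k x₀)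
  zero_mem' k _ := contDiffOn_const (c := (0 : E [⋀^Fin k]→L[ℝ] ℝ))
  smul_mem' c _ hα k x₀ := (hα k x₀).const_smul c

/-- The real de Rham space `𝒜` of `M`: the smooth real differential forms. -/
def DeRham : Type _ := SmoothForms E M

instance : AddCommGroup (DeRham E M) := inferInstanceAs (AddCommGroup (SmoothForms E M))

instance : Module ℝ (DeRham E M) := inferInstanceAs (Module ℝ (SmoothForms E M))

variable {E M} in
/-- The form underlying an element of `𝒜`. -/
def DeRham.form (a : DeRham E M) : RoughForm E M := Subtype.val a

/-- The grading of `𝒜` by the degree of forms, indexed by `ℤ`. -/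
def formGrading (k : ℤ) : Submodule ℝ (DeRham E M) where
  carrier := {a | ∀ (x : M) (j : ℕ), (j : ℤ) ≠ k → a.form x j = 0}
  add_mem' {a b} ha hb x j hj := by
    change a.form x j + b.form x j = 0
    rw [ha x j hj, hb x j hj, add_zero]
  zero_mem' _ _ _ := rfl
  smul_mem' c a ha x j hj := by
    change c • a.form x j = 0
    rw [ha x j hj, smul_zero]

variable {E M}

/-- The exterior derivative, computed at `x` in the chart around `x` (for smooth forms the result
does not depend on the chart). -/
def extd (α : RoughForm E M) : RoughForm E M := fun x k =>
  match k with
  | 0 => 0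
  | k + 1 => (extDeriv (localExpr (fun z => α z k) x)
      (extChartAt 𝓘(ℝ, E) x x)).toAlternatingMap.compLinearMap
        (mfderiv 𝓘(ℝ, E) 𝓘(ℝ, E) (extChartAt 𝓘(ℝ, E) x) x).toLinearMap

/-- The linear operator `F` on `𝒜` is the restriction to smooth forms of `f` (in particular `f`
preserves smoothness and is linear on smooth forms). -/
def Induces (f : RoughForm E M → RoughForm E M) (F : Module.End ℝ (DeRham E M)) : Prop :=
  ∀ a : DeRham E M, (F a).form = f a.form

variable (E M)

/-- An almost Hermitian structure on `M`: a smooth Riemannian metric `g` and a smooth almost complex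
structure `J` with `g(J X, J Y) = g(X, Y)`. -/
structure AlmostHermitianStructure [IsManifold 𝓘(ℝ, E) ∞ M] where
  metric : ContMDiffRiemannianMetric 𝓘(ℝ, E) ∞ E (fun x : M => TangentSpace 𝓘(ℝ, E) x)
  J : ∀ x : M, TangentSpace 𝓘(ℝ, E) x →L[ℝ] TangentSpace 𝓘(ℝ, E) x
  J_smooth : ContMDiff 𝓘(ℝ, E) (𝓘(ℝ, E).prod 𝓘(ℝ, E →L[ℝ] E)) ∞
    (fun x : M => TotalSpace.mk' (E →L[ℝ] E)
      (E := fun x : M => TangentSpace 𝓘(ℝ, E) x →L[ℝ] TangentSpace 𝓘(ℝ, E) x) x (J x))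
  J_sq : ∀ (x : M) (v : TangentSpace 𝓘(ℝ, E) x), J x (J x v) = -v
  metric_J : ∀ (x : M) (v w : TangentSpace 𝓘(ℝ, E) x),
    metric.inner x (J x v) (J x w) = metric.inner x v w

variable {E M}

namespace AlmostHermitianStructure

variable [IsManifold 𝓘(ℝ, E) ∞ M] (S : AlmostHermitianStructure E M)

/-- The Hermitian structure on the tangent space at `x`. -/
def herm (x : M) : HermitianSpace (TangentSpace 𝓘(ℝ, E) x) where
  g := LinearMap.mk₂ ℝ (fun v w => S.metric.inner x v w) (by simp) (by simp) (by simp) (by simp)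
  g_symm := S.metric.symm x
  g_pos := S.metric.pos x
  J := (S.J x).toLinearMap
  J_sq := S.J_sq x
  g_J := S.metric_J x

/-- The fundamental form `ω(X, Y) = g(J X, Y)`. -/
def omega : RoughForm E M := fun x => (S.herm x).omega

/-- `Λ`, the adjoint of the Lefschetz operator `L = ω ∧ -`. -/
def Lam (α : RoughForm E M) : RoughForm E M := fun x => (S.herm x).Lam (α x)

/-- The Hodge star operator. -/
def star (α : RoughForm E M) : RoughForm E M := fun x => (S.herm x).star (α x)

/-- `d_c = J⁻¹ d J`. -/
def dc (α : RoughForm E M) : RoughForm E M := fun x =>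
  (S.herm x).JformInv (extd (fun z => (S.herm z).Jform (α z)) x)

/-- `d_c^* = - ⋆ d_c ⋆`, the formal adjoint of `d_c`. -/
def dcStar (α : RoughForm E M) : RoughForm E M := -S.star (S.dc (S.star α))

/-- The operator `dω ∧ -` on forms at `x`. -/
def domega (x : M) : Module.End ℝ (ExtForm (TangentSpace 𝓘(ℝ, E) x)) :=
  ExtForm.wedge (extd S.omega x)

/-- `T = [Λ, dω ∧ -]` at `x`. -/
def T (x : M) : Module.End ℝ (ExtForm (TangentSpace 𝓘(ℝ, E) x)) :=
  (S.herm x).Lam * S.domega x - S.domega x * (S.herm x).Lam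

/-- `T_c = J⁻¹ T J` at `x`. -/
def Tc (x : M) : Module.End ℝ (ExtForm (TangentSpace 𝓘(ℝ, E) x)) :=
  (S.herm x).JformInv * S.T x * (S.herm x).Jform

/-- `T_c^*`, the adjoint of `T_c`. -/
def TcStar (α : RoughForm E M) : RoughForm E M := fun x => (S.herm x).adjoint (S.Tc x) (α x)

/-- `dω_c = J⁻¹ (dω ∧ -) J` at `x`. -/
def domegac (x : M) : Module.End ℝ (ExtForm (TangentSpace 𝓘(ℝ, E) x)) :=
  (S.herm x).JformInv * S.domega x * (S.herm x).Jform

/-- `(dω_c)^*`, the adjoint of `dω_c`. -/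
def domegacStar (α : RoughForm E M) : RoughForm E M := fun x =>
  (S.herm x).adjoint (S.domegac x) (α x)

/-- Contraction `i_π` with the Poisson bivector of `ω`. -/
def iPi (α : RoughForm E M) : RoughForm E M := fun x =>
  poissonContraction (S.herm x).fundamentalForm (α x)

/-- Koszul's operator `[i_π, d] = i_π d - d i_π`. -/
def koszul (α : RoughForm E M) : RoughForm E M := S.iPi (extd α) - extd (S.iPi α)

end AlmostHermitianStructure

end Manifold

end

open scoped Manifold ContDiff

noncomputable section

-- Brackets below are commutators in associative rings. Put Δ₁ = [Λ, d] and Δ₂ = ½[Λ, [Λ, d]].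
-- Formally e^{Λξ} d e^{-Λξ} = ∑ ad_Λⁿ(d) ξⁿ / n!, so the formula for the total differential amounts
-- to ad_Λ³(d) = 0, and the quadratic relations are the coefficients of the square of this series,
-- which vanishes with d². The order bounds hold because Λ is a sum of products of two contractions,
-- hence of order ≤ 2, because d has order ≤ 1, and because a graded commutator of operators of
-- orders p and q has order ≤ p + q - 1 (`BV.HasOrderLE.gradedComm`).
--
-- The vanishing of ad_Λ³(d) is representation theory of sl₂. With H = k - n on k-forms, (L, Λ, H)
-- is an sl₂-triple, and it acts on operators by commutators. Let η = dω ∧ -. The Leibniz rule gives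
-- [L, d] = -η, and [H, d] = d. Since η commutes with L and has weight 3, it generates a quadruplet.
-- Then d' = d + ⅓[Λ, η] commutes with L and has weight 1, so it is the top of a doublet and
-- ad_Λ²(d') = 0. Therefore ½ ad_Λ²(d) = -⅙ ad_Λ³(η) and ad_Λ³(d) = 0 (`lie_differential`).
--
-- To recognise these operators metrically, let w = e^{-Λ} e^{L} e^{-Λ} be the Weyl element and σ
-- the sign (-1)^{k(k+1)/2} on k-forms. Then ⋆ = J w σ (`starOp_isHodgeStar`): it suffices to know
-- how this operator commutes with multiplication by covectors, and its value at 1. Conjugation by w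
-- is explicit on doublets and quadruplets, which yields d_c^* = -Δ₁ - ½ ad_Λ²(η) (`conj_d_eq`),
-- (dω_c)^* = -⅙ ad_Λ³(η) and T_c^* = ½ ad_Λ²(η). Comparing, Δ₁ = -(d_c^* + T_c^*) and Δ₂ =
-- (dω_c)^*. If dω = 0 the terms in η drop out, and Λ = i_π because ∑ J eᵢ ⊗ eᵢ inverts the matrix
-- of ω.
--
-- Two devices carry the rest. Forms are generated from 1 by multiplication with covectors
-- (`eps_induction`), which reduces identities between operators on forms to the relations between
-- covectors and contractions. Pointwise linear algebra passes to smooth forms through operators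
-- acting fibrewise (`Acts`); calculus enters only through local expressions in charts.

attribute [local instance] LieRing.ofAssociativeRing

/-! ### The exterior algebra of forms: associativity, contraction, commutativity -/

namespace MultilinearMap

/-- The product of multilinear forms on `Fin k` and `Fin l`, indexed by `Fin m` with `m = k + l`. -/
def finProd {V : Type*} [AddCommGroup V] [Module ℝ V] {k l m : ℕ} (h : k + l = m)
    (a : MultilinearMap ℝ (fun _ : Fin k => V) ℝ) (b : MultilinearMap ℝ (fun _ : Fin l => V) ℝ) :
    MultilinearMap ℝ (fun _ : Fin m => V) ℝ :=
  ((LinearMap.mul' ℝ ℝ).compMultilinearMap (a.domCoprod b)).domDomCongr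
    (finSumFinEquiv.trans (finCongr h))

theorem finProd_apply {V : Type*} [AddCommGroup V] [Module ℝ V] {k l m : ℕ} (h : k + l = m)
    (a : MultilinearMap ℝ (fun _ : Fin k => V) ℝ) (b : MultilinearMap ℝ (fun _ : Fin l => V) ℝ)
    (v : Fin m → V) :
    finProd h a b v = a (fun i => v (Fin.cast h (Fin.castAdd l i))) *
      b (fun i => v (Fin.cast h (Fin.natAdd k i))) := by
  simp [finProd]

theorem alternatization_domDomCongr {V ι κ : Type*} [AddCommGroup V] [Module ℝ V]
    [Fintype ι] [DecidableEq ι] [Fintype κ] [DecidableEq κ] (e : ι ≃ κ)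
    (f : MultilinearMap ℝ (fun _ : ι => V) ℝ) :
    alternatization (f.domDomCongr e) = (alternatization f).domDomCongr e := by
  ext v
  simp only [alternatization_apply, AlternatingMap.domDomCongr_apply]
  refine Fintype.sum_equiv e.symm.permCongr _ _ fun σ => ?_
  have hs : Equiv.Perm.sign (e.symm.permCongr σ) = Equiv.Perm.sign σ := by
    rw [Equiv.Perm.sign_permCongr]
  rw [hs]
  congr 1
  simp [Function.comp_def]

end MultilinearMap

namespace ExtForm

open MultilinearMap

variable {V : Type*} [AddCommGroup V] [Module ℝ V]

/-- Replaces shuffle sums by full antisymmetrizations, which compose without bookkeeping of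
shuffles. -/
theorem wedgeHom_alternatization {k l m : ℕ} (h : k + l = m)
    (a : MultilinearMap ℝ (fun _ : Fin k => V) ℝ) (b : MultilinearMap ℝ (fun _ : Fin l => V) ℝ) :
    wedgeHom h (alternatization a) (alternatization b) = alternatization (finProd h a b) := by
  rw [finProd, alternatization_domDomCongr, LinearMap.compMultilinearMap_alternatization,
    domCoprod_alternization]
  rfl

theorem alternatization_coe_fin {k : ℕ} (a : V [⋀^Fin k]→ₗ[ℝ] ℝ) :
    alternatization (a : MultilinearMap ℝ (fun _ : Fin k => V) ℝ) = (k.factorial : ℝ) • a := by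
  rw [AlternatingMap.coe_alternatization, Fintype.card_fin, Nat.cast_smul_eq_nsmul]

theorem factorial_smul_wedgeHom {k l m : ℕ} (h : k + l = m) (a : V [⋀^Fin k]→ₗ[ℝ] ℝ)
    (b : V [⋀^Fin l]→ₗ[ℝ] ℝ) :
    ((k.factorial : ℝ) * l.factorial) • wedgeHom h a b =
      alternatization (finProd h a.toMultilinearMap b.toMultilinearMap) := by
  rw [← wedgeHom_alternatization]
  have ha := alternatization_coe_fin a
  have hb := alternatization_coe_fin b
  rw [ha, hb, wedgeHom_smul_left, wedgeHom_smul_right, smul_smul]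

/-- After multiplication by k! l! p!, both sides are the antisymmetrization of the same tensor
product a ⊗ b ⊗ c; over ℝ the factor can be cancelled. -/
theorem wedgeHom_assoc {k l p kl lp m : ℕ} (h₁ : k + l = kl) (h₂ : kl + p = m) (h₃ : l + p = lp)
    (h₄ : k + lp = m) (a : V [⋀^Fin k]→ₗ[ℝ] ℝ) (b : V [⋀^Fin l]→ₗ[ℝ] ℝ)
    (c : V [⋀^Fin p]→ₗ[ℝ] ℝ) :
    wedgeHom h₂ (wedgeHom h₁ a b) c = wedgeHom h₄ a (wedgeHom h₃ b c) := by
  have e₁ := factorial_smul_wedgeHom h₁ a b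
  have e₃ := factorial_smul_wedgeHom h₃ b c
  have ha := alternatization_coe_fin a
  have hc := alternatization_coe_fin c
  have key : finProd h₂ (finProd h₁ a.toMultilinearMap b.toMultilinearMap) c.toMultilinearMap =
      finProd h₄ a.toMultilinearMap (finProd h₃ b.toMultilinearMap c.toMultilinearMap) := by
    subst h₁ h₃ h₂
    ext v
    simp only [finProd_apply, mul_assoc]
    congr 1
    congr 2
    funext i
    congr 1
    ext
    simp [add_assoc]
  have l₁ := wedgeHom_alternatization h₂ (finProd h₁ a.toMultilinearMap b.toMultilinearMap)
    c.toMultilinearMap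
  have l₂ := wedgeHom_alternatization h₄ a.toMultilinearMap
    (finProd h₃ b.toMultilinearMap c.toMultilinearMap)
  rw [← e₁, hc, wedgeHom_smul_left, wedgeHom_smul_right, smul_smul, key] at l₁
  rw [← e₃, ha, wedgeHom_smul_left, wedgeHom_smul_right, smul_smul, ← l₁] at l₂
  have hne : (k.factorial : ℝ) * l.factorial * p.factorial ≠ 0 := by positivity
  have l₃ : ((k.factorial : ℝ) * l.factorial * p.factorial) •
      wedgeHom h₂ (wedgeHom h₁ a b) c =
      ((k.factorial : ℝ) * l.factorial * p.factorial) • wedgeHom h₄ a (wedgeHom h₃ b c) := by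
    rw [← l₂, mul_assoc]
  exact smul_right_injective _ hne l₃

/-- Splitting off the cycle that brings σ 0 to the front leaves a permutation fixing 0. This turns a
sum over permutations into an expansion along the first slot. -/
theorem _root_.Equiv.Perm.eq_cycleRange_symm_mul {l : ℕ} (σ : Equiv.Perm (Fin (l + 1))) :
    ∃ e : Equiv.Perm (Fin l), Equiv.Perm.sign σ = (-1) ^ (σ 0 : ℕ) * Equiv.Perm.sign e ∧
      ∀ i : Fin l, σ i.succ = (σ 0).succAbove (e i) := by
  set τ := (σ 0).cycleRange * σ with hτ
  have hτ0 : τ 0 = 0 := by simp [hτ]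
  obtain ⟨⟨q, e⟩, hqe⟩ := Equiv.Perm.decomposeFin.symm.surjective τ
  have hq : q = 0 := by
    rw [← hτ0, ← hqe, Equiv.Perm.decomposeFin_symm_apply_zero]
  subst hq
  have hσ : σ = (σ 0).cycleRange⁻¹ * τ := by simp [hτ]
  refine ⟨e, ?_, fun i => ?_⟩
  · have hs : Equiv.Perm.sign τ = Equiv.Perm.sign e := by
      rw [← hqe, Equiv.Perm.decomposeFin.symm_sign]; simp
    conv_lhs => rw [hσ]
    rw [Equiv.Perm.sign_mul, Equiv.Perm.sign_inv, Fin.sign_cycleRange, hs]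
  · conv_lhs => rw [hσ]
    rw [Equiv.Perm.mul_apply, ← hqe, Equiv.Perm.decomposeFin_symm_apply_succ]
    simp [Equiv.Perm.inv_def]

/-- A linear form as a form of degree one. -/
def oneForm (f : V →ₗ[ℝ] ℝ) : V [⋀^Fin 1]→ₗ[ℝ] ℝ :=
  AlternatingMap.ofSubsingleton ℝ V ℝ 0 f

theorem oneForm_apply (f : V →ₗ[ℝ] ℝ) (v : Fin 1 → V) : oneForm f v = f (v 0) := rfl

theorem wedgeHom_oneForm {l : ℕ} (h : 1 + l = l + 1) (f : V →ₗ[ℝ] ℝ) (b : V [⋀^Fin l]→ₗ[ℝ] ℝ) :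
    wedgeHom h (oneForm f) b = AlternatingMap.alternatizeUncurryFin (f.smulRight b) := by
  have key := factorial_smul_wedgeHom h (oneForm f) b
  have hne : ((Nat.factorial 1 : ℝ) * l.factorial) ≠ 0 := by positivity
  refine smul_right_injective _ hne (key.trans ?_)
  ext v
  rw [alternatization_apply, AlternatingMap.smul_apply,
    AlternatingMap.alternatizeUncurryFin_apply]
  set t : Fin (l + 1) → ℝ := fun p => (-1) ^ (p : ℕ) • (f.smulRight b (v p)) (p.removeNth v)
  -- The term depends on σ 0 only: the permutation of the other entries gives its sign twice, once
  -- from σ and once from b. Each value of σ 0 thus occurs l! times, which is the normalizing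
  -- factor.
  have hF : ∀ σ : Equiv.Perm (Fin (l + 1)), Equiv.Perm.sign σ •
      (domDomCongr σ (finProd h (oneForm f).toMultilinearMap b.toMultilinearMap)) v =
        t (σ 0) := by
    intro σ
    obtain ⟨e, he, hs⟩ := σ.eq_cycleRange_symm_mul
    rw [domDomCongr_apply, finProd_apply]
    have h0 : (Fin.cast h (Fin.castAdd l (0 : Fin 1))) = 0 := rfl
    have hi : ∀ i : Fin l, (Fin.cast h (Fin.natAdd 1 i)) = i.succ := fun i => by
      ext; simp
    simp only [hi, hs]
    have hb := b.map_perm ((σ 0).removeNth v) e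
    have hb' : b.toMultilinearMap (fun i => v ((σ 0).succAbove (e i))) =
        Equiv.Perm.sign e • b ((σ 0).removeNth v) := hb
    have ha : (oneForm f).toMultilinearMap
        (fun i : Fin 1 => v (σ (Fin.cast h (Fin.castAdd l i)))) = f (v (σ 0)) := rfl
    rw [ha, hb', he]
    rcases Int.units_eq_one_or (Equiv.Perm.sign e) with h1 | h1 <;>
      simp [h1, t, Units.smul_def, mul_left_comm, mul_comm]
  rw [Finset.sum_congr rfl fun σ _ => hF σ,
    ← Equiv.sum_comp Equiv.Perm.decomposeFin.symm, Fintype.sum_prod_type]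
  simp [Finset.mul_sum, Fintype.card_perm, t]

end ExtForm

/-! ### Contractions, multiplication by covectors, parity, and generation of forms from 1 -/

namespace ExtForm

open Module

variable {V W : Type*} [AddCommGroup V] [Module ℝ V] [AddCommGroup W] [Module ℝ W]

/-- The endomorphisms of the space of forms are a ring. -/
instance endRing : Ring (Module.End ℝ (ExtForm V)) :=
  { (inferInstance : Semiring (Module.End ℝ (ExtForm V))),
    (inferInstance : AddCommGroup (ExtForm V →ₗ[ℝ] ExtForm V)) with }

theorem wedge_apply (α β : ExtForm V) (m : ℕ) : wedge α β m =
    ∑ p : {p : ℕ × ℕ // p ∈ Finset.HasAntidiagonal.antidiagonal m},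
      wedgeHom (Finset.HasAntidiagonal.mem_antidiagonal.1 p.2) (α p.1.1) (β p.1.2) := rfl

theorem wedgeHom_zero_left {k l m : ℕ} (h : k + l = m) (b : V [⋀^Fin l]→ₗ[ℝ] ℝ) :
    wedgeHom h (0 : V [⋀^Fin k]→ₗ[ℝ] ℝ) b = 0 := by
  simpa using wedgeHom_smul_left h 0 0 b

theorem wedgeHom_zero_right {k l m : ℕ} (h : k + l = m) (a : V [⋀^Fin k]→ₗ[ℝ] ℝ) :
    wedgeHom h a (0 : V [⋀^Fin l]→ₗ[ℝ] ℝ) = 0 := by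
  simpa using wedgeHom_smul_right h 0 a 0

/-- The component of degree `k + l` of the product with a homogeneous form of degree `k`. -/
theorem wedge_single_apply {k l m : ℕ} (h : k + l = m) (a : V [⋀^Fin k]→ₗ[ℝ] ℝ)
    (β : ExtForm V) : wedge (Pi.single k a) β m = wedgeHom h a (β l) := by
  rw [wedge_apply, Finset.sum_eq_single ⟨(k, l), by simpa using h⟩]
  · simp
  · rintro ⟨⟨k', l'⟩, hp⟩ - hne
    have hk : k' ≠ k := by
      rintro rfl
      rw [Finset.HasAntidiagonal.mem_antidiagonal] at hp
      exact hne (Subtype.ext (Prod.ext rfl (by simp only at hp ⊢; omega)))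
    simp [Pi.single_eq_of_ne hk, wedgeHom_zero_left]
  · simp

theorem wedge_single_apply_of_lt {k m : ℕ} (h : m < k) (a : V [⋀^Fin k]→ₗ[ℝ] ℝ)
    (β : ExtForm V) : wedge (Pi.single k a) β m = 0 := by
  rw [wedge_apply]
  refine Finset.sum_eq_zero ?_
  rintro ⟨⟨k', l'⟩, hp⟩ -
  have hk : k' ≠ k := by
    rintro rfl
    rw [Finset.HasAntidiagonal.mem_antidiagonal] at hp
    simp only at hp
    omega
  simp [Pi.single_eq_of_ne hk, wedgeHom_zero_left]

theorem wedge_single_single {k l m : ℕ} (h : k + l = m) (a : V [⋀^Fin k]→ₗ[ℝ] ℝ)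
    (b : V [⋀^Fin l]→ₗ[ℝ] ℝ) :
    wedge (Pi.single k a) (Pi.single l b) = Pi.single m (wedgeHom h a b) := by
  funext j
  by_cases hkj : k ≤ j
  · obtain ⟨l', rfl⟩ := Nat.exists_eq_add_of_le hkj
    rw [wedge_single_apply rfl]
    by_cases hl : l' = l
    · subst hl; subst h; simp
    · rw [Pi.single_eq_of_ne hl, wedgeHom_zero_right, Pi.single_eq_of_ne (by omega)]
  · rw [wedge_single_apply_of_lt (by omega), Pi.single_eq_of_ne (by omega)]

/-- Contraction with a vector. -/
def ins (v : V) : Module.End ℝ (ExtForm V) where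
  toFun α k := (α (k + 1)).curryLeft v
  map_add' _ _ := rfl
  map_smul' _ _ := rfl

theorem ins_apply (v : V) (α : ExtForm V) (k : ℕ) : ins v α k = (α (k + 1)).curryLeft v := rfl

/-- Contraction is linear in the vector. -/
def insₗ : V →ₗ[ℝ] Module.End ℝ (ExtForm V) where
  toFun := ins
  map_add' v w := by ext α k x; simp [ins_apply]
  map_smul' c v := by ext α k x; simp [ins_apply]

theorem insₗ_apply (v : V) : insₗ v = ins v := rfl

/-- Left multiplication by a linear form. -/
def eps (f : V →ₗ[ℝ] ℝ) : Module.End ℝ (ExtForm V) := wedge (Pi.single 1 (oneForm f))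

theorem eps_apply_zero (f : V →ₗ[ℝ] ℝ) (α : ExtForm V) : eps f α 0 = 0 :=
  wedge_single_apply_of_lt one_pos _ _

theorem eps_apply_succ (f : V →ₗ[ℝ] ℝ) (α : ExtForm V) (k : ℕ) :
    eps f α (k + 1) = AlternatingMap.alternatizeUncurryFin (f.smulRight (α k)) := by
  rw [eps, wedge_single_apply (add_comm 1 k), wedgeHom_oneForm]

theorem eps_apply_succ_apply (f : V →ₗ[ℝ] ℝ) (α : ExtForm V) (k : ℕ) (v : Fin (k + 1) → V) :
    eps f α (k + 1) v = ∑ i : Fin (k + 1), (-1) ^ (i : ℕ) * (f (v i) * α k (i.removeNth v)) := by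
  rw [eps_apply_succ, AlternatingMap.alternatizeUncurryFin_apply]
  simp

/-- Left multiplication by a linear form is linear in that form. -/
def epsₗ : (V →ₗ[ℝ] ℝ) →ₗ[ℝ] Module.End ℝ (ExtForm V) where
  toFun := eps
  map_add' f g := by
    refine LinearMap.ext fun α => funext fun k => ?_
    cases k with
    | zero => simp [eps_apply_zero]
    | succ k =>
      ext v
      simp [eps_apply_succ_apply, add_mul, mul_add, Finset.sum_add_distrib]
  map_smul' c f := by
    refine LinearMap.ext fun α => funext fun k => ?_
    cases k with
    | zero => simp [eps_apply_zero]
    | succ k =>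
      ext v
      simp [eps_apply_succ_apply, Finset.mul_sum, mul_assoc, mul_left_comm]

theorem eps_neg (f : V →ₗ[ℝ] ℝ) : eps (-f) = -eps f := map_neg epsₗ f

theorem ins_neg (v : V) : ins (-v) = -ins v := map_neg insₗ v

/-- The operator acting on forms of degree `k` as multiplication by `c k`. -/
def diag (c : ℕ → ℝ) : Module.End ℝ (ExtForm V) where
  toFun α k := c k • α k
  map_add' _ _ := by funext k; simp
  map_smul' r α := by funext k; exact smul_comm (c k) r (α k)

theorem diag_apply (c : ℕ → ℝ) (α : ExtForm V) (k : ℕ) : diag c α k = c k • α k := rfl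

theorem diag_mul_diag (c c' : ℕ → ℝ) : (diag c * diag c' : Module.End ℝ (ExtForm V)) =
    diag fun k => c k * c' k := by
  refine LinearMap.ext fun α => funext fun k => ?_
  simp [diag_apply, smul_smul]

theorem diag_one : (diag fun _ => 1 : Module.End ℝ (ExtForm V)) = 1 := by
  refine LinearMap.ext fun α => funext fun k => ?_
  simp [diag_apply]

theorem diag_const (r : ℝ) : (diag fun _ => r : Module.End ℝ (ExtForm V)) = r • 1 := rfl

theorem diag_sub (c c' : ℕ → ℝ) : (diag (fun k => c k - c' k) : Module.End ℝ (ExtForm V)) =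
    diag c - diag c' := by
  refine LinearMap.ext fun α => funext fun k => ?_
  ext v
  simp [diag_apply, sub_mul]

theorem neg_diag (c : ℕ → ℝ) : (-diag c : Module.End ℝ (ExtForm V)) = diag fun k => -c k := by
  refine LinearMap.ext fun α => funext fun k => ?_
  ext v
  simp [diag_apply]

theorem diag_single (c : ℕ → ℝ) (k : ℕ) (a : V [⋀^Fin k]→ₗ[ℝ] ℝ) :
    diag c (Pi.single k a : ExtForm V) = c k • Pi.single k a := by
  funext j
  by_cases hj : j = k
  · subst hj; simp [diag_apply]
  · simp [diag_apply, Pi.single_eq_of_ne hj]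

theorem diag_mul_eps (c : ℕ → ℝ) (f : V →ₗ[ℝ] ℝ) :
    diag c * eps f = eps f * diag fun k => c (k + 1) := by
  refine LinearMap.ext fun α => funext fun k => ?_
  cases k with
  | zero => simp [diag_apply, eps_apply_zero]
  | succ k =>
    ext v
    simp [diag_apply, eps_apply_succ_apply, Finset.mul_sum, mul_left_comm]

theorem ins_mul_diag (c : ℕ → ℝ) (v : V) :
    ins v * diag c = (diag fun k => c (k + 1)) * ins v := by
  refine LinearMap.ext fun α => funext fun k => ?_
  ext x
  simp [diag_apply, ins_apply]

theorem diag_mul_wedge_single (c : ℕ → ℝ) (j : ℕ) (a : V [⋀^Fin j]→ₗ[ℝ] ℝ) :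
    diag c * wedge (Pi.single j a) = wedge (Pi.single j a) * diag fun k => c (k + j) := by
  refine LinearMap.ext fun α => funext fun k => ?_
  by_cases hkj : j ≤ k
  · obtain ⟨l, rfl⟩ := Nat.exists_eq_add_of_le hkj
    simp only [Module.End.mul_apply, diag_apply, wedge_single_apply rfl, wedgeHom_smul_right,
      add_comm]
  · simp only [Module.End.mul_apply, diag_apply]
    rw [wedge_single_apply_of_lt (by omega), wedge_single_apply_of_lt (by omega), smul_zero]

/-- The parity operator `(-1)^k` on `k`-forms. -/
def parity : Module.End ℝ (ExtForm V) := diag fun k => (-1) ^ k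

theorem parity_mul_parity : (parity * parity : Module.End ℝ (ExtForm V)) = 1 := by
  rw [parity, diag_mul_diag, ← diag_one]
  congr 1
  funext k
  rw [← pow_add, ← two_mul, pow_mul]
  simp

theorem parity_mul_eps (f : V →ₗ[ℝ] ℝ) : parity * eps f = -(eps f * parity) := by
  rw [parity, diag_mul_eps, ← mul_neg, neg_diag]
  simp [pow_succ]

theorem parity_mul_ins (v : V) : parity * ins v = -(ins v * parity) := by
  rw [parity, ins_mul_diag, ← neg_mul, neg_diag]
  simp [pow_succ]

theorem parity_one : parity (one : ExtForm V) = one := by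
  rw [parity, one, diag_single]; simp

/-- The Clifford-type relation: in the expansion of f ∧ α along its first slot, the summand where f
eats v gives f v, and the others cancel against f ∧ ι_v α. -/
theorem ins_mul_eps (v : V) (f : V →ₗ[ℝ] ℝ) : ins v * eps f = f v • 1 - eps f * ins v := by
  rw [eq_sub_iff_add_eq]
  refine LinearMap.ext fun α => funext fun k => ?_
  ext x
  have h0 : ins v (eps f α) k x = ∑ i : Fin (k + 1), (-1) ^ (i : ℕ) *
      (f ((Fin.cons v x : Fin (k + 1) → V) i) *
        α k (i.removeNth (Fin.cons v x : Fin (k + 1) → V))) := by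
    rw [ins_apply, AlternatingMap.curryLeft_apply_apply, eps_apply_succ_apply]
    rfl
  simp only [LinearMap.add_apply, Module.End.mul_apply, LinearMap.smul_apply,
    Module.End.one_apply, Pi.add_apply, Pi.smul_apply, AlternatingMap.add_apply,
    AlternatingMap.smul_apply, smul_eq_mul]
  rw [h0, Fin.sum_univ_succ]
  have hz : (0 : Fin (k + 1)).removeNth (Fin.cons v x : Fin (k + 1) → V) = x := by
    funext i; simp [Fin.removeNth]
  rw [hz]
  simp only [Fin.val_zero, pow_zero, Fin.cons_zero, one_mul, Fin.val_succ, Fin.cons_succ]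
  cases k with
  | zero => simp [eps_apply_zero]
  | succ k =>
    rw [eps_apply_succ_apply, add_assoc, ← Finset.sum_add_distrib, Finset.sum_eq_zero, add_zero]
    intro i _
    have : i.succ.removeNth (Fin.cons v x : Fin (k + 1 + 1) → V) =
        Fin.cons v (i.removeNth x) := by
      funext j
      refine Fin.cases ?_ (fun j => ?_) j <;> simp [Fin.removeNth]
    rw [this, ins_apply, AlternatingMap.curryLeft_apply_apply]
    simp only [Matrix.vecCons]
    ring

theorem ins_mul_ins (v w : V) : ins v * ins w = -(ins w * ins v) := by
  rw [eq_neg_iff_add_eq_zero]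
  refine LinearMap.ext fun α => funext fun k => ?_
  ext x
  -- Polarization: expand the vanishing of the form on the repeated vector v + w.
  have := ((α (k + 2)).curryLeft_same (v + w))
  have h2 : (α (k + 2)) (Matrix.vecCons (v + w) (Matrix.vecCons (v + w) x)) = 0 :=
    congrArg (fun f => f x) this
  have hv : (α (k + 2)) (Matrix.vecCons v (Matrix.vecCons v x)) = 0 :=
    congrArg (fun f => f x) ((α (k + 2)).curryLeft_same v)
  have hw : (α (k + 2)) (Matrix.vecCons w (Matrix.vecCons w x)) = 0 :=
    congrArg (fun f => f x) ((α (k + 2)).curryLeft_same w)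
  have e : ∀ u u' : V, (α (k + 2)) (Matrix.vecCons u (Matrix.vecCons u' x)) =
      ((α (k + 2)).curryLeft u).curryLeft u' x := fun _ _ => rfl
  rw [e] at h2 hv hw
  simp only [map_add, AlternatingMap.curryLeft_add, LinearMap.add_apply,
    AlternatingMap.add_apply] at h2
  change ((α (k + 2)).curryLeft w).curryLeft v x + ((α (k + 2)).curryLeft v).curryLeft w x = 0
  linarith

theorem ins_one (v : V) : ins v (one : ExtForm V) = 0 := by
  funext k
  rw [ins_apply, one, Pi.single_eq_of_ne (by omega)]
  rfl

/-- The anticommutator commutes with every contraction by `ins_mul_eps`, and it has no part in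
degree 0. A form of positive degree is determined by its contractions, so induction on the degree
finishes. -/
theorem eps_mul_eps (f g : V →ₗ[ℝ] ℝ) : eps f * eps g = -(eps g * eps f) := by
  rw [eq_neg_iff_add_eq_zero]
  set X := eps f * eps g + eps g * eps f with hX
  have hc : ∀ v, ins v * X = X * ins v := by
    intro v
    simp only [hX, mul_add, add_mul, ← mul_assoc, ins_mul_eps, sub_mul, smul_mul_assoc, one_mul]
    simp only [mul_assoc, ins_mul_eps, mul_sub, mul_smul_comm, mul_one]
    abel
  have h0 : ∀ m α, X α m = 0 := by
    intro m
    induction m with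
    | zero => intro α; simp [hX, eps_apply_zero]
    | succ m ih =>
      intro α
      ext x
      have := ih (ins (x 0) α)
      rw [← Module.End.mul_apply, ← hc, Module.End.mul_apply, ins_apply] at this
      have h := congrArg (fun f => f (Fin.tail x)) this
      have hx : Matrix.vecCons (x 0) (Fin.tail x) = x := Fin.cons_self_tail x
      simpa [hx] using h
  exact LinearMap.ext fun α => funext fun m => h0 m α

/-- Pullback of forms along a linear map. -/
def pullback (f : V →ₗ[ℝ] W) : ExtForm W →ₗ[ℝ] ExtForm V where
  toFun α k := (α k).compLinearMap f
  map_add' _ _ := rfl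
  map_smul' _ _ := rfl

theorem pullback_apply (f : V →ₗ[ℝ] W) (α : ExtForm W) (k : ℕ) :
    pullback f α k = (α k).compLinearMap f := rfl

theorem pullback_eps (f : V →ₗ[ℝ] W) (φ : W →ₗ[ℝ] ℝ) (α : ExtForm W) :
    pullback f (eps φ α) = eps (φ ∘ₗ f) (pullback f α) := by
  funext k
  cases k with
  | zero => simp [pullback_apply, eps_apply_zero]
  | succ k =>
    ext v
    simp only [pullback_apply, AlternatingMap.compLinearMap_apply, eps_apply_succ_apply]
    rfl

theorem pullback_ins (f : V →ₗ[ℝ] W) (v : V) (α : ExtForm W) :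
    pullback f (ins (f v) α) = ins v (pullback f α) := by
  funext k
  ext x
  simp only [pullback_apply, ins_apply, AlternatingMap.compLinearMap_apply,
    AlternatingMap.curryLeft_apply_apply]
  congr 1
  funext i
  refine Fin.cases ?_ (fun i => ?_) i <;> simp [Matrix.vecCons]

theorem pullback_one (f : V →ₗ[ℝ] W) : pullback f one = one := by
  funext k
  by_cases hk : k = 0
  · subst hk; ext v; simp [pullback_apply, one]
  · simp [pullback_apply, one, Pi.single_eq_of_ne hk]

theorem pullback_single (f : V →ₗ[ℝ] W) (k : ℕ) (a : W [⋀^Fin k]→ₗ[ℝ] ℝ) :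
    pullback f (Pi.single k a) = Pi.single k (a.compLinearMap f) := by
  funext j
  by_cases hj : j = k
  · subst hj; simp [pullback_apply]
  · simp [pullback_apply, Pi.single_eq_of_ne hj]

theorem single_zero_eq (a : V [⋀^Fin 0]→ₗ[ℝ] ℝ) :
    (Pi.single 0 a : ExtForm V) = a 0 • one := by
  rw [one, ← Pi.single_smul]
  congr 1
  ext v
  simp [Subsingleton.elim v 0]

theorem one_wedge (β : ExtForm V) : wedge one β = β := by
  funext m
  rw [one, wedge_single_apply (zero_add m)]
  have h := factorial_smul_wedgeHom (zero_add m) (AlternatingMap.constOfIsEmpty ℝ V (Fin 0) 1)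
    (β m)
  have hp : MultilinearMap.finProd (zero_add m)
      (AlternatingMap.constOfIsEmpty ℝ V (Fin 0) (1 : ℝ)).toMultilinearMap
      (β m).toMultilinearMap = (β m).toMultilinearMap := by
    ext v
    rw [MultilinearMap.finProd_apply]
    simp only [AlternatingMap.coe_multilinearMap, AlternatingMap.constOfIsEmpty_apply,
      Function.const_apply, one_mul]
    congr 1
    funext i
    congr 1
    ext
    simp
  have h2 := alternatization_coe_fin (β m)
  rw [hp, h2] at h
  have hne : ((m.factorial : ℝ)) ≠ 0 := by positivity
  refine smul_right_injective _ hne ?_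
  simpa using h

/-- Euler's identity. -/
theorem sum_eps_mul_ins {ι : Type*} [Fintype ι] (b : Basis ι ℝ V) :
    ∑ i, eps (b.coord i) * ins (b i) = (diag fun k => (k : ℝ) : Module.End ℝ (ExtForm V)) := by
  classical
  refine LinearMap.ext fun α => funext fun k => ?_
  rw [LinearMap.sum_apply, Finset.sum_apply]
  cases k with
  | zero => simp [eps_apply_zero, diag_apply]
  | succ k =>
    have h := AlternatingMap.alternatizeUncurryFin_curryLeft (α (k + 1))
    have hs : (α (k + 1)).curryLeft =
        ∑ i, (b.coord i).smulRight ((α (k + 1)).curryLeft (b i)) := by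
      refine b.ext fun j => ?_
      simp [LinearMap.sum_apply, Finsupp.single_apply]
    rw [hs] at h
    have hl : AlternatingMap.alternatizeUncurryFin
        (∑ i, (b.coord i).smulRight ((α (k + 1)).curryLeft (b i))) =
        ∑ i, AlternatingMap.alternatizeUncurryFin
          ((b.coord i).smulRight ((α (k + 1)).curryLeft (b i))) :=
      map_sum AlternatingMap.alternatizeUncurryFinLM _ _
    rw [hl] at h
    simp only [Module.End.mul_apply, eps_apply_succ, ins_apply, diag_apply]
    rw [h, ← Nat.cast_smul_eq_nsmul ℝ]

section FiniteDimensional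

variable [FiniteDimensional ℝ V] [FiniteDimensional ℝ W]

theorem eq_zero_of_finrank_lt {k : ℕ} (hk : finrank ℝ V < k) (a : V [⋀^Fin k]→ₗ[ℝ] ℝ) :
    a = 0 := by
  refine Basis.ext_alternating (Module.finBasis ℝ V) fun v hv => ?_
  have := Fintype.card_le_of_injective v hv
  simp only [Fintype.card_fin] at this
  omega

/-- Components above the dimension vanish, so the infinite product of degrees is really a finite
direct sum. -/
theorem sum_single (α : ExtForm V) :
    ∑ k ∈ Finset.range (finrank ℝ V + 1), (Pi.single k (α k) : ExtForm V) = α := by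
  funext j
  rw [Finset.sum_apply]
  by_cases hj : j ∈ Finset.range (finrank ℝ V + 1)
  · rw [Finset.sum_eq_single j]
    · simp
    · intro b _ hb
      exact Pi.single_eq_of_ne hb.symm _
    · exact fun h => absurd hj h
  · rw [Finset.sum_eq_zero, eq_zero_of_finrank_lt (by simpa using hj) (α j)]
    intro b hb
    exact Pi.single_eq_of_ne (by rintro rfl; exact hj hb) _

/-- Linear maps on forms agreeing on homogeneous forms are equal. -/
theorem linearMap_ext {X : Type*} [AddCommGroup X] [Module ℝ X] {F G : ExtForm V →ₗ[ℝ] X}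
    (h : ∀ k a, F (Pi.single k a) = G (Pi.single k a)) : F = G := by
  refine LinearMap.ext fun α => ?_
  rw [← sum_single α, map_sum, map_sum]
  exact Finset.sum_congr rfl fun k _ => h k _

theorem wedge_assoc (α β γ : ExtForm V) : wedge (wedge α β) γ = wedge α (wedge β γ) := by
  rw [← sum_single α, ← sum_single β, ← sum_single γ]
  simp only [map_sum, LinearMap.sum_apply]
  refine Finset.sum_congr rfl fun k _ => Finset.sum_congr rfl fun l _ =>
    Finset.sum_congr rfl fun p _ => ?_
  rw [wedge_single_single rfl, wedge_single_single rfl, wedge_single_single rfl,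
    wedge_single_single (add_assoc _ _ _).symm, wedgeHom_assoc]

/-- Forms are generated from `1` by multiplications with linear forms. -/
theorem eps_induction {p : ExtForm V → Prop} (one : p one) (add : ∀ α β, p α → p β → p (α + β))
    (smul : ∀ (c : ℝ) α, p α → p (c • α)) (eps : ∀ f α, p α → p (eps f α)) (α : ExtForm V) :
    p α := by
  have hzero : p 0 := by simpa using smul 0 _ one
  have hsum : ∀ {ι : Type} (s : Finset ι) (F : ι → ExtForm V), (∀ i ∈ s, p (F i)) →
      p (∑ i ∈ s, F i) := by
    intro ι s F hF
    exact Finset.sum_induction F p add hzero hF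
  have hk : ∀ k (a : V [⋀^Fin k]→ₗ[ℝ] ℝ), p (Pi.single k a) := by
    intro k
    induction k with
    | zero => intro a; rw [single_zero_eq]; exact smul _ _ one
    | succ k ih =>
      intro a
      -- Euler's identity writes a form of degree k + 1 as 1/(k + 1) times a sum of products of
      -- covectors with forms of degree k.
      have h := LinearMap.congr_fun (sum_eps_mul_ins (Module.finBasis ℝ V)) (Pi.single (k + 1) a)
      rw [diag_single] at h
      have hne : ((k + 1 : ℕ) : ℝ) ≠ 0 := by positivity
      rw [← inv_smul_eq_iff₀ hne] at h
      rw [← h, LinearMap.sum_apply]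
      refine smul _ _ (hsum _ _ fun i _ => ?_)
      have hins : ins (Module.finBasis ℝ V i) (Pi.single (k + 1) a : ExtForm V) =
          Pi.single k (a.curryLeft (Module.finBasis ℝ V i)) := by
        funext j
        rw [ins_apply]
        by_cases hj : j = k
        · subst hj; simp
        · rw [Pi.single_eq_of_ne hj, Pi.single_eq_of_ne (by omega)]; rfl
      rw [Module.End.mul_apply, hins]
      exact eps _ _ (ih _)
  rw [← sum_single α]
  exact hsum _ _ fun k _ => hk k _

/-- An operator on forms is determined by its value on `1` and by its commutation relations with
multiplication by linear forms. -/
theorem ext_of_eps {X : Type*} [AddCommGroup X] [Module ℝ X] {F G : ExtForm V →ₗ[ℝ] X}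
    (A : (V →ₗ[ℝ] ℝ) → X → X) (hF : ∀ f α, F (eps f α) = A f (F α))
    (hG : ∀ f α, G (eps f α) = A f (G α)) (h1 : F one = G one) : F = G := by
  refine LinearMap.ext fun α => ?_
  induction α using eps_induction with
  | one => exact h1
  | add α β ha hb => rw [map_add, map_add, ha, hb]
  | smul c α ha => rw [map_smul, map_smul, ha]
  | eps f α ha => rw [hF, hG, ha]

theorem eps_wedge (f : V →ₗ[ℝ] ℝ) (α β : ExtForm V) : wedge (eps f α) β = eps f (wedge α β) :=
  wedge_assoc _ _ _

theorem wedge_one (α : ExtForm V) : wedge α one = α := by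
  induction α using eps_induction with
  | one => exact one_wedge _
  | add α β ha hb => rw [map_add, LinearMap.add_apply, ha, hb]
  | smul c α ha => rw [map_smul, LinearMap.smul_apply, ha]
  | eps f α ha => rw [eps_wedge, ha]

theorem ins_wedge (v : V) (α β : ExtForm V) :
    ins v (wedge α β) = wedge (ins v α) β + wedge (parity α) (ins v β) := by
  induction α using eps_induction with
  | one => rw [one_wedge, ins_one, parity_one, one_wedge]; simp
  | add α α' ha hb => simp only [map_add, LinearMap.add_apply, ha, hb]; abel
  | smul c α ha => simp only [map_smul, LinearMap.smul_apply, ha, smul_add]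
  | eps f α ha =>
    have h1 : ∀ γ, ins v (eps f γ) = f v • γ - eps f (ins v γ) := fun γ =>
      LinearMap.congr_fun (ins_mul_eps v f) γ
    have h2 : parity (eps f α) = -eps f (parity α) := LinearMap.congr_fun (parity_mul_eps f) α
    rw [eps_wedge, h1, h1, ha, h2]
    simp only [map_add, map_sub, map_neg, LinearMap.sub_apply, LinearMap.neg_apply, map_smul,
      LinearMap.smul_apply, eps_wedge]
    abel

/-- Covectors anticommute with one another, so moving one past β costs a sign for each degree. This
lets a covector be transferred from one factor of a wedge product to the other. -/
theorem eps_eq_wedge_parity (f : V →ₗ[ℝ] ℝ) (β : ExtForm V) :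
    eps f β = wedge (parity β) (Pi.single 1 (oneForm f)) := by
  induction β using eps_induction with
  | one => rw [parity_one, one_wedge, eps, wedge_one]
  | add α α' ha hb => simp only [map_add, LinearMap.add_apply, ha, hb]
  | smul c α ha => simp only [map_smul, LinearMap.smul_apply, ha]
  | eps g β ha =>
    have h2 : parity (eps g β) = -eps g (parity β) := LinearMap.congr_fun (parity_mul_eps g) β
    have h3 : eps f (eps g β) = -eps g (eps f β) := LinearMap.congr_fun (eps_mul_eps f g) β
    rw [h3, h2, ha, map_neg, LinearMap.neg_apply, eps_wedge]

/-- Graded commutativity. -/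
theorem wedge_comm_single (l : ℕ) (b : V [⋀^Fin l]→ₗ[ℝ] ℝ) (α : ExtForm V) :
    wedge α (Pi.single l b) = wedge (Pi.single l b) ((parity ^ l) α) := by
  have hp : ∀ (l : ℕ) (f : V →ₗ[ℝ] ℝ),
      parity ^ l * eps f = (-1 : ℝ) ^ l • (eps f * parity ^ l) := by
    intro l f
    induction l with
    | zero => simp
    | succ l ih =>
      rw [pow_succ', mul_assoc, ih, mul_smul_comm, ← mul_assoc, parity_mul_eps, neg_mul,
        mul_assoc, pow_succ]
      simp
  have hp1 : (parity ^ l) (one : ExtForm V) = one := by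
    induction l with
    | zero => rfl
    | succ l ih => rw [pow_succ', Module.End.mul_apply, ih (0 : V [⋀^Fin l]→ₗ[ℝ] ℝ), parity_one]
  induction α using eps_induction with
  | one => rw [hp1, one_wedge, wedge_one]
  | add α α' ha hb => simp only [map_add, LinearMap.add_apply, ha, hb]
  | smul c α ha => simp only [map_smul, LinearMap.smul_apply, ha]
  | eps f α ha =>
    have h1 : (parity ^ l) (eps f α) = (-1 : ℝ) ^ l • eps f ((parity ^ l) α) :=
      LinearMap.congr_fun (hp l f) α
    have h2 : parity (Pi.single l b : ExtForm V) = (-1 : ℝ) ^ l • Pi.single l b := diag_single _ _ _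
    rw [eps_wedge, ha, h1, ← eps_wedge, eps_eq_wedge_parity, h2]
    simp only [map_smul, LinearMap.smul_apply, wedge_assoc]
    rfl

theorem pullback_wedge (f : V →ₗ[ℝ] W) (α β : ExtForm W) :
    pullback f (wedge α β) = wedge (pullback f α) (pullback f β) := by
  induction α using eps_induction with
  | one => rw [pullback_one, one_wedge, one_wedge]
  | add α α' ha hb => simp only [map_add, LinearMap.add_apply, ha, hb]
  | smul c α ha => simp only [map_smul, LinearMap.smul_apply, ha]
  | eps g α ha => rw [eps_wedge, pullback_eps, pullback_eps, eps_wedge, ha]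

end FiniteDimensional

end ExtForm

/-! ### Operators of finite order -/

namespace BV

variable {K A : Type*} [Field K] [AddCommGroup A] [Module K A]
variable {gr : ℤ → Submodule K A} {mul : A →ₗ[K] A →ₗ[K] A} {one : A}

theorem HasDegree.zero (k : ℤ) : HasDegree gr k (0 : Module.End K A) :=
  fun _ _ _ => Submodule.zero_mem _

theorem HasDegree.add {k : ℤ} {f g : Module.End K A} (hf : HasDegree gr k f)
    (hg : HasDegree gr k g) : HasDegree gr k (f + g) :=
  fun j a ha => Submodule.add_mem _ (hf j a ha) (hg j a ha)

theorem HasDegree.smul {k : ℤ} {f : Module.End K A} (c : K) (hf : HasDegree gr k f) :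
    HasDegree gr k (c • f) :=
  fun j a ha => Submodule.smul_mem _ c (hf j a ha)

theorem HasDegree.sub {k : ℤ} {f g : Module.End K A} (hf : HasDegree gr k f)
    (hg : HasDegree gr k g) : HasDegree gr k (f - g) :=
  fun j a ha => Submodule.sub_mem _ (hf j a ha) (hg j a ha)

theorem HasDegree.comp {k l : ℤ} {f g : Module.End K A} (hf : HasDegree gr k f)
    (hg : HasDegree gr l g) : HasDegree gr (k + l) (f * g) := fun j a ha => by
  have := hf _ _ (hg j a ha)
  rwa [add_assoc, add_comm l k] at this

theorem HasDegree.congr {k l : ℤ} {f : Module.End K A} (hf : HasDegree gr k f) (h : k = l) :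
    HasDegree gr l f := h ▸ hf

theorem HasDegree.units_smul {k : ℤ} {f : Module.End K A} (u : ℤˣ) (hf : HasDegree gr k f) :
    HasDegree gr k (u • f) := by
  rcases Int.units_eq_one_or u with h | h <;> subst h
  · simpa using hf
  · simpa using hf.smul (-1 : K)

theorem HasDegree.gradedComm {k l : ℤ} {f g : Module.End K A} (hf : HasDegree gr k f)
    (hg : HasDegree gr l g) : HasDegree gr (k + l) (gradedComm k l f g) :=
  (hf.comp hg).sub (((hg.comp hf).congr (add_comm l k)).units_smul _)

theorem IsGradedCommAlgebra.mul_degree (hA : IsGradedCommAlgebra gr mul one) {j : ℤ} {a : A}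
    (ha : a ∈ gr j) : HasDegree gr j (mul a) := fun i b hb => by
  have := hA.mul_mem j i a ha b hb
  rwa [add_comm] at this

theorem gradedComm_zero (k l : ℤ) (f : Module.End K A) : gradedComm k l f 0 = 0 := by
  simp [gradedComm]

theorem zero_gradedComm (k l : ℤ) (f : Module.End K A) : gradedComm k l 0 f = 0 := by
  simp [gradedComm]

theorem gradedComm_add (k l : ℤ) (f g g' : Module.End K A) :
    gradedComm k l f (g + g') = gradedComm k l f g + gradedComm k l f g' := by
  simp only [gradedComm, mul_add, add_mul, smul_add]; abel

theorem gradedComm_smul (k l : ℤ) (c : K) (f g : Module.End K A) :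
    gradedComm k l f (c • g) = c • gradedComm k l f g := by
  simp only [gradedComm, mul_smul_comm, smul_mul_assoc, smul_sub]
  rw [smul_comm]

/-- The graded commutator is a graded derivation in its second argument. -/
theorem gradedComm_mul (j k l : ℤ) (a f g : Module.End K A) :
    gradedComm j (k + l) a (f * g) =
      gradedComm j k a f * g + Int.negOnePow (j * k) • (f * gradedComm j l a g) := by
  simp only [gradedComm, mul_add, Int.negOnePow_add]
  rcases Int.units_eq_one_or (Int.negOnePow (j * k)) with h1 | h1 <;>
  rcases Int.units_eq_one_or (Int.negOnePow (j * l)) with h2 | h2 <;>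
  · simp only [h1, h2, one_smul, Units.neg_smul, mul_one, mul_neg, neg_neg]
    noncomm_ring

/-- The graded Jacobi identity; for each choice of the three signs it is an identity in a
noncommutative ring. -/
theorem gradedComm_gradedComm (j k l : ℤ) (a f g : Module.End K A) :
    gradedComm j (k + l) a (gradedComm k l f g) =
      gradedComm (j + k) l (gradedComm j k a f) g +
        Int.negOnePow (j * k) • gradedComm k (j + l) f (gradedComm j l a g) := by
  simp only [gradedComm, mul_add, add_mul, Int.negOnePow_add, mul_comm k j]
  rcases Int.units_eq_one_or (Int.negOnePow (j * k)) with h1 | h1 <;>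
  rcases Int.units_eq_one_or (Int.negOnePow (j * l)) with h2 | h2 <;>
  rcases Int.units_eq_one_or (Int.negOnePow (k * l)) with h3 | h3 <;>
  · simp only [h1, h2, h3, one_smul, Units.neg_smul, mul_one, mul_neg, neg_neg]
    noncomm_ring

theorem HasOrderLE.degree {r : ℕ} {k : ℤ} {f : Module.End K A} (hf : HasOrderLE gr mul r k f) :
    HasDegree gr k f := by
  cases r <;> exact hf.1

theorem HasOrderLE.congr {r : ℕ} {k l : ℤ} {f : Module.End K A} (hf : HasOrderLE gr mul r k f)
    (h : k = l) : HasOrderLE gr mul r l f := h ▸ hf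

theorem HasOrderLE.zero (r : ℕ) (k : ℤ) : HasOrderLE gr mul r k (0 : Module.End K A) := by
  induction r generalizing k with
  | zero => exact ⟨HasDegree.zero k, fun j a _ => gradedComm_zero _ _ _⟩
  | succ r ih =>
    refine ⟨HasDegree.zero k, fun j a _ => ?_⟩
    rw [gradedComm_zero]
    exact ih _

theorem HasOrderLE.add {r : ℕ} {k : ℤ} {f g : Module.End K A} (hf : HasOrderLE gr mul r k f)
    (hg : HasOrderLE gr mul r k g) : HasOrderLE gr mul r k (f + g) := by
  induction r generalizing k f g with
  | zero =>
    refine ⟨hf.1.add hg.1, fun j a ha => ?_⟩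
    rw [gradedComm_add, hf.2 j a ha, hg.2 j a ha, add_zero]
  | succ r ih =>
    refine ⟨hf.1.add hg.1, fun j a ha => ?_⟩
    rw [gradedComm_add]
    exact ih (hf.2 j a ha) (hg.2 j a ha)

theorem HasOrderLE.smul {r : ℕ} {k : ℤ} {f : Module.End K A} (c : K)
    (hf : HasOrderLE gr mul r k f) : HasOrderLE gr mul r k (c • f) := by
  induction r generalizing k f with
  | zero =>
    refine ⟨hf.1.smul c, fun j a ha => ?_⟩
    rw [gradedComm_smul, hf.2 j a ha, smul_zero]
  | succ r ih =>
    refine ⟨hf.1.smul c, fun j a ha => ?_⟩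
    rw [gradedComm_smul]
    exact ih (hf.2 j a ha)

theorem HasOrderLE.units_smul {r : ℕ} {k : ℤ} {f : Module.End K A} (u : ℤˣ)
    (hf : HasOrderLE gr mul r k f) : HasOrderLE gr mul r k (u • f) := by
  rcases Int.units_eq_one_or u with h | h <;> subst h
  · simpa using hf
  · simpa using hf.smul (-1 : K)

theorem HasOrderLE.sum {ι : Type*} (s : Finset ι) {r : ℕ} {k : ℤ} {f : ι → Module.End K A}
    (hf : ∀ i ∈ s, HasOrderLE gr mul r k (f i)) : HasOrderLE gr mul r k (∑ i ∈ s, f i) :=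
  Finset.sum_induction f (HasOrderLE gr mul r k) (fun _ _ => HasOrderLE.add)
    (HasOrderLE.zero r k) hf

/-- Induction on the total order: by the derivation rule, a commutator with a multiplication lowers
the order of one factor at a time. -/
theorem HasOrderLE.comp {p q : ℕ} {k l : ℤ} {f g : Module.End K A} (hf : HasOrderLE gr mul p k f)
    (hg : HasOrderLE gr mul q l g) : HasOrderLE gr mul (p + q) (k + l) (f * g) := by
  have hdeg := hf.degree.comp hg.degree
  induction hn : p + q generalizing p q k l f g with
  | zero =>
    obtain ⟨rfl, rfl⟩ : p = 0 ∧ q = 0 := by omega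
    refine ⟨hdeg, fun j a ha => ?_⟩
    rw [gradedComm_mul, hf.2 j a ha, hg.2 j a ha]
    simp
  | succ n ih =>
    refine ⟨hdeg, fun j a ha => ?_⟩
    rw [gradedComm_mul]
    refine HasOrderLE.add ?_ (HasOrderLE.units_smul _ ?_)
    · cases p with
      | zero => rw [hf.2 j a ha, zero_mul]; exact HasOrderLE.zero _ _
      | succ p =>
        have h1 := hf.2 j a ha
        exact (ih h1 hg (h1.degree.comp hg.degree) (by omega)).congr (add_assoc _ _ _)
    · cases q with
      | zero => rw [hg.2 j a ha, mul_zero]; exact HasOrderLE.zero _ _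
      | succ q =>
        have h1 := hg.2 j a ha
        exact (ih hf h1 (hf.degree.comp h1.degree) (by omega)).congr (add_left_comm _ _ _)

/-- An operator of order `≤ 0` is the multiplication by its value at the unit. -/
theorem HasOrderLE.eq_mul (hA : IsGradedCommAlgebra gr mul one) {k : ℤ} {f : Module.End K A}
    (hf : HasOrderLE gr mul 0 k f) : f = mul (f one) := by
  have key : ∀ j, ∀ a ∈ gr j, f a = mul (f one) a := by
    intro j a ha
    have h1 := LinearMap.congr_fun (hf.2 j a ha) one
    have hf1 : f one ∈ gr k := by simpa using hf.1 0 one hA.one_mem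
    have h2 := hA.mul_comm j k a ha (f one) hf1
    simp only [gradedComm, LinearMap.sub_apply, Module.End.mul_apply, LinearMap.zero_apply, h2] at h1
    rcases Int.units_eq_one_or (Int.negOnePow (j * k)) with h | h <;> rw [h] at h1
    · rw [sub_eq_zero] at h1
      simpa [hA.mul_one] using h1.symm
    · simp only [Units.neg_smul, one_smul, LinearMap.neg_apply, sub_neg_eq_add,
        Module.End.mul_apply, hA.mul_one] at h1
      exact (neg_add_eq_zero.1 h1).symm
  refine LinearMap.ext fun a => ?_
  have htop : a ∈ ⨆ j, gr j := by
    rw [hA.isInternal.submodule_iSup_eq_top]; trivial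
  induction htop using Submodule.iSup_induction' with
  | mem j x hx => exact key j x hx
  | zero => simp
  | add x y _ _ hx hy => rw [map_add, map_add, hx, hy]

/-- Since f is multiplication by the homogeneous element f(1), the claim is the defining condition
of order ≤ 0 for g. -/
theorem HasOrderLE.gradedComm_eq_zero (hA : IsGradedCommAlgebra gr mul one) {k l : ℤ}
    {f g : Module.End K A} (hf : HasOrderLE gr mul 0 k f) (hg : HasOrderLE gr mul 0 l g) :
    BV.gradedComm k l f g = 0 := by
  have hf1 : f one ∈ gr k := by simpa using hf.1 0 one hA.one_mem
  rw [hf.eq_mul hA]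
  exact hg.2 k _ hf1

/-- The gain of one order over composition comes from commutativity. The Jacobi identity lowers the
orders inductively, and at the bottom operators of order ≤ 0 commute in the graded sense. -/
theorem HasOrderLE.gradedComm (hA : IsGradedCommAlgebra gr mul one) {n p q : ℕ} {k l : ℤ}
    {f g : Module.End K A} (hf : HasOrderLE gr mul p k f) (hg : HasOrderLE gr mul q l g)
    (hn : p + q = n + 1) : HasOrderLE gr mul n (k + l) (gradedComm k l f g) := by
  have hdeg := hf.degree.gradedComm hg.degree
  induction n generalizing p q k l f g with
  | zero =>
    refine ⟨hdeg, fun j a ha => ?_⟩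
    rw [gradedComm_gradedComm]
    obtain ⟨rfl, rfl⟩ | ⟨rfl, rfl⟩ : (p = 0 ∧ q = 1) ∨ (p = 1 ∧ q = 0) := by omega
    · rw [hf.2 j a ha, zero_gradedComm, hf.gradedComm_eq_zero hA (hg.2 j a ha)]; simp
    · rw [hg.2 j a ha, gradedComm_zero, (hf.2 j a ha).gradedComm_eq_zero hA hg]; simp
  | succ n ih =>
    refine ⟨hdeg, fun j a ha => ?_⟩
    rw [gradedComm_gradedComm]
    refine HasOrderLE.add ?_ (HasOrderLE.units_smul _ ?_)
    · cases p with
      | zero => rw [hf.2 j a ha, zero_gradedComm]; exact HasOrderLE.zero _ _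
      | succ p =>
        have h1 := hf.2 j a ha
        exact (ih h1 hg (by omega) (h1.degree.gradedComm hg.degree)).congr (add_assoc _ _ _)
    · cases q with
      | zero => rw [hg.2 j a ha, gradedComm_zero]; exact HasOrderLE.zero _ _
      | succ q =>
        have h1 := hg.2 j a ha
        exact (ih hf h1 (by omega) (hf.degree.gradedComm h1.degree)).congr (add_left_comm _ _ _)

/-- The differential of a commutative dg-algebra has order `≤ 1`. -/
theorem IsCDGA.order_d {d : Module.End K A} (hA : IsCDGA gr mul one d) :
    HasOrderLE gr mul 1 1 d := by
  refine ⟨hA.d_degree, fun j a ha => ?_⟩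
  have hda : d a ∈ gr (j + 1) := hA.d_degree j a ha
  have h1 : BV.gradedComm j 1 (mul a) d = (-Int.negOnePow j) • mul (d a) := by
    refine LinearMap.ext fun b => ?_
    simp only [BV.gradedComm, LinearMap.sub_apply, Module.End.mul_apply, mul_one]
    have h := hA.leibniz j a ha b
    rcases Int.units_eq_one_or (Int.negOnePow j) with h1 | h1 <;> rw [h1] at h ⊢ <;>
      simp [h]
  rw [h1]
  refine HasOrderLE.units_smul _ ⟨hA.toIsGradedCommAlgebra.mul_degree hda, fun i b hb => ?_⟩
  refine LinearMap.ext fun c => ?_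
  simp only [BV.gradedComm, LinearMap.sub_apply, Module.End.mul_apply, LinearMap.zero_apply]
  rw [← hA.mul_assoc, hA.mul_comm i _ b hb _ hda, ← LinearMap.smul_apply]
  rcases Int.units_eq_one_or (Int.negOnePow (i * (j + 1))) with h | h <;> rw [h] <;>
    simp [hA.mul_assoc]

end BV

/-! ### Exponentials of nilpotent elements and conjugation by the Weyl element -/

section Exponential

open Finset

variable {R : Type*} [Ring R]

/-- Evaluation of polynomials at `1`. -/
def evalOne : Polynomial R →+* R :=
  Polynomial.eval₂RingHom' (RingHom.id R) 1 fun _ => Commute.one_right _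

theorem evalOne_C (a : R) : evalOne (Polynomial.C a) = a := by
  simp [evalOne, Polynomial.eval₂RingHom']

theorem evalOne_monomial (n : ℕ) (a : R) : evalOne (Polynomial.monomial n a) = a := by
  simp [evalOne, Polynomial.eval₂RingHom', Polynomial.eval₂_monomial]

variable [Algebra ℝ R]

/-- Every summand is a real multiple of xⁿ, so this is the coefficient identity of exp(X) exp(-X) =
1 in ℝ[[X]]. -/
theorem sum_antidiagonal_exp_mul_exp_neg (x : R) (n : ℕ) :
    ∑ p ∈ antidiagonal n, ((p.1.factorial : ℝ)⁻¹ • x ^ p.1) * ((p.2.factorial : ℝ)⁻¹ • (-x) ^ p.2) =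
      if n = 0 then 1 else 0 := by
  have h := congrArg (PowerSeries.coeff n) (PowerSeries.exp_mul_exp_neg_eq_one (A := ℝ))
  rw [PowerSeries.coeff_mul, PowerSeries.coeff_one] at h
  have h2 : ∀ p ∈ antidiagonal n, ((p.1.factorial : ℝ)⁻¹ • x ^ p.1) *
      ((p.2.factorial : ℝ)⁻¹ • (-x) ^ p.2) =
      (PowerSeries.coeff p.1 (PowerSeries.exp ℝ) *
        PowerSeries.coeff p.2 (PowerSeries.evalNegHom (PowerSeries.exp ℝ))) • x ^ n := by
    intro p hp
    rw [HasAntidiagonal.mem_antidiagonal] at hp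
    have hneg : (-x) ^ p.2 = ((-1 : ℝ) ^ p.2) • x ^ p.2 := by rw [← neg_one_smul ℝ x, smul_pow]
    rw [PowerSeries.evalNegHom, PowerSeries.coeff_rescale, PowerSeries.coeff_exp,
      PowerSeries.coeff_exp, hneg, ← hp, pow_add, smul_smul, smul_mul_smul_comm]
    congr 1
    simp [mul_comm]
  rw [sum_congr rfl h2, ← sum_smul, h]
  split_ifs with hn
  · simp [hn]
  · simp

/-- Here z i plays the role of ad_xⁱ(z 0)/i!, and this is the ξⁿ-coefficient of e^{xξ} z₀ = z(ξ)
e^{xξ}. Multiplying by n + 1 in the induction corresponds to differentiating in ξ. -/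
theorem exp_coeff_mul {x : R} {z : ℕ → R} (hz : ∀ i, ⁅x, z i⁆ = ((i : ℝ) + 1) • z (i + 1)) (n : ℕ) :
    ((n.factorial : ℝ)⁻¹ • x ^ n) * z 0 =
      ∑ p ∈ antidiagonal n, z p.1 * ((p.2.factorial : ℝ)⁻¹ • x ^ p.2) := by
  have hne : ∀ n : ℕ, ((n : ℝ) + 1) ≠ 0 := fun n => by positivity
  have hfac : ∀ j : ℕ, ((j : ℝ) + 1) • (((j + 1).factorial : ℝ)⁻¹ • x ^ (j + 1)) =
      (j.factorial : ℝ)⁻¹ • x ^ (j + 1) := by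
    intro j
    rw [smul_smul, Nat.factorial_succ]
    congr 1
    push_cast
    have := hne j
    field_simp
  induction n with
  | zero => simp
  | succ n ih =>
    have hx : ∀ i, x * z i = z i * x + ((i : ℝ) + 1) • z (i + 1) := by
      intro i
      rw [← hz, Ring.lie_def]; abel
    have h1 : ((n : ℝ) + 1) • ((((n + 1).factorial : ℝ)⁻¹ • x ^ (n + 1)) * z 0) =
        ∑ p ∈ antidiagonal n, (z p.1 * (((p.2 : ℝ) + 1) •
            (((p.2 + 1).factorial : ℝ)⁻¹ • x ^ (p.2 + 1))) +
          (((p.1 : ℝ) + 1) • z (p.1 + 1)) * ((p.2.factorial : ℝ)⁻¹ • x ^ p.2)) := by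
      rw [← smul_mul_assoc, hfac, pow_succ', ← mul_smul_comm, mul_assoc, ih, mul_sum]
      refine sum_congr rfl fun p _ => ?_
      rw [hfac, ← mul_assoc, hx, add_mul, pow_succ', mul_assoc, mul_smul_comm]
    -- On the antidiagonal n + 1 = p.2 + p.1; the two parts are the two terms of the product rule.
    have h2 : ((n : ℝ) + 1) • ∑ p ∈ antidiagonal (n + 1),
        z p.1 * ((p.2.factorial : ℝ)⁻¹ • x ^ p.2) =
        ∑ p ∈ antidiagonal (n + 1), (p.2 : ℝ) • (z p.1 * ((p.2.factorial : ℝ)⁻¹ • x ^ p.2)) +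
        ∑ p ∈ antidiagonal (n + 1), (p.1 : ℝ) • (z p.1 * ((p.2.factorial : ℝ)⁻¹ • x ^ p.2)) := by
      rw [smul_sum, ← sum_add_distrib]
      refine sum_congr rfl fun p hp => ?_
      rw [HasAntidiagonal.mem_antidiagonal] at hp
      rw [← add_smul]
      congr 1
      exact_mod_cast (by omega : n + 1 = p.2 + p.1)
    have h3 : ((n : ℝ) + 1) • ((((n + 1).factorial : ℝ)⁻¹ • x ^ (n + 1)) * z 0) =
        ((n : ℝ) + 1) • ∑ p ∈ antidiagonal (n + 1), z p.1 * ((p.2.factorial : ℝ)⁻¹ • x ^ p.2) := by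
      rw [h1, h2, Finset.Nat.sum_antidiagonal_succ', Finset.Nat.sum_antidiagonal_succ,
        sum_add_distrib]
      simp only [Nat.cast_zero, zero_smul, zero_add, Nat.cast_add, Nat.cast_one,
        mul_smul_comm, smul_mul_assoc, smul_comm ((_ : ℕ).factorial : ℝ)⁻¹ ((_ : ℝ) + 1)]
    exact smul_right_injective _ (hne n) h3

/-- Conjugation by the formal exponential `e^{x ξ}`. -/
theorem expSeries_mul_C {A : Type*} [AddCommGroup A] [Module ℝ A] {x : Module.End ℝ A}
    {z : ℕ → Module.End ℝ A} (hz : ∀ i, ⁅x, z i⁆ = ((i : ℝ) + 1) • z (i + 1)) :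
    BV.expSeries x * PowerSeries.C (z 0) = PowerSeries.mk z * BV.expSeries x := by
  ext1 n
  rw [PowerSeries.coeff_mul_C, PowerSeries.coeff_mul]
  simp only [BV.expSeries, PowerSeries.coeff_mk]
  exact exp_coeff_mul hz n

theorem expSeries_mul_expSeries_neg {A : Type*} [AddCommGroup A] [Module ℝ A]
    (x : Module.End ℝ A) : BV.expSeries x * BV.expSeries (-x) = 1 := by
  ext1 n
  rw [PowerSeries.coeff_mul, PowerSeries.coeff_one]
  simp only [BV.expSeries, PowerSeries.coeff_mk]
  exact sum_antidiagonal_exp_mul_exp_neg x n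

/-- The truncated exponential, as a polynomial `∑_{n < N} xⁿ Xⁿ / n!`. -/
def expPoly (N : ℕ) (x : R) : Polynomial R :=
  ∑ n ∈ range N, Polynomial.monomial n ((n.factorial : ℝ)⁻¹ • x ^ n)

/-- The exponential `∑_{n < N} xⁿ / n!` of an element with `x ^ N = 0`. -/
def nilExp (N : ℕ) (x : R) : R := ∑ n ∈ range N, (n.factorial : ℝ)⁻¹ • x ^ n

/-- Nilpotency makes the truncation harmless: the coefficients agree with those of the full
exponential series in every degree. -/
theorem coeff_expPoly {N : ℕ} {x : R} (hx : x ^ N = 0) (n : ℕ) :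
    (expPoly N x).coeff n = (n.factorial : ℝ)⁻¹ • x ^ n := by
  rw [expPoly, Polynomial.finsetSum_coeff]
  simp only [Polynomial.coeff_monomial]
  rw [sum_ite_eq']
  split_ifs with h
  · rfl
  · rw [pow_eq_zero_of_le (by simpa using h) hx, smul_zero]

theorem evalOne_expPoly (N : ℕ) (x : R) : evalOne (expPoly N x) = nilExp N x := by
  simp only [expPoly, nilExp, map_sum, evalOne_monomial]

/-- Proved for polynomials in a central variable, where coefficients can be compared, and then
evaluated at 1. -/
theorem nilExp_mul_nilExp_neg {N : ℕ} {x : R} (hx : x ^ N = 0) :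
    nilExp N x * nilExp N (-x) = 1 := by
  have hx' : (-x) ^ N = 0 := by rw [neg_pow, hx, mul_zero]
  rw [← evalOne_expPoly, ← evalOne_expPoly, ← map_mul]
  have : expPoly N x * expPoly N (-x) = 1 := by
    ext n
    rw [Polynomial.coeff_mul, Polynomial.coeff_one]
    simp only [coeff_expPoly hx, coeff_expPoly hx']
    exact sum_antidiagonal_exp_mul_exp_neg x n
  rw [this, map_one]

theorem nilExp_neg_mul_nilExp {N : ℕ} {x : R} (hx : x ^ N = 0) :
    nilExp N (-x) * nilExp N x = 1 := by
  have hx' : (-x) ^ N = 0 := by rw [neg_pow, hx, mul_zero]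
  simpa using nilExp_mul_nilExp_neg hx'

/-- Conjugation by the exponential of a nilpotent element: `e^x y e^{-x} = y + [x, y] + ⋯`. -/
theorem nilExp_semiconjBy {N : ℕ} {x : R} (hx : x ^ N = 0) {y y₁ y₂ y₃ : R} (h₀ : ⁅x, y⁆ = y₁)
    (h₁ : ⁅x, y₁⁆ = (2 : ℝ) • y₂) (h₂ : ⁅x, y₂⁆ = (3 : ℝ) • y₃) (h₃ : ⁅x, y₃⁆ = 0) :
    SemiconjBy (nilExp N x) y (y + y₁ + y₂ + y₃) := by
  -- The polynomial e^{xX} y e^{-xX}, cubic since y₃ commutes with x; its value at 1 is the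
  -- conjugate of y.
  set p : Polynomial R := Polynomial.C y + Polynomial.monomial 1 y₁ + Polynomial.monomial 2 y₂ +
    Polynomial.monomial 3 y₃ with hp
  have hz : ∀ i, ⁅x, p.coeff i⁆ = ((i : ℝ) + 1) • p.coeff (i + 1) := by
    intro i
    rcases i with _ | _ | _ | _ | i <;>
      simp [hp, Polynomial.coeff_C, Polynomial.coeff_monomial, h₀, h₁, h₂, h₃] <;> norm_num
  have key : expPoly N x * Polynomial.C (p.coeff 0) = p * expPoly N x := by
    ext n
    rw [Polynomial.coeff_mul_C, Polynomial.coeff_mul]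
    simp only [coeff_expPoly hx]
    exact exp_coeff_mul hz n
  have h := congrArg evalOne key
  have hpe : evalOne p = y + y₁ + y₂ + y₃ := by
    simp only [hp, map_add, evalOne_C, evalOne_monomial]
  have hp0 : p.coeff 0 = y := by simp [hp, Polynomial.coeff_monomial]
  rw [map_mul, map_mul, evalOne_expPoly, evalOne_C, hpe, hp0] at h
  exact h

end Exponential

/-! ### The Weyl element of an sl₂-triple and its action on doublets, triplets and quadruplets -/

section Weyl

variable {R : Type*} [Ring R] [Algebra ℝ R]

/-- The Weyl element `e^{-f} e^{e} e^{-f}`. -/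
def weyl (N : ℕ) (e f : R) : R := nilExp N (-f) * nilExp N e * nilExp N (-f)

/-- The inverse of the Weyl element. -/
def weylInv (N : ℕ) (e f : R) : R := nilExp N f * nilExp N (-e) * nilExp N f

variable {N : ℕ} {e f h : R}

theorem weyl_mul_weylInv (he : e ^ N = 0) (hf : f ^ N = 0) : weyl N e f * weylInv N e f = 1 := by
  have h1 := nilExp_neg_mul_nilExp hf
  have h2 := nilExp_mul_nilExp_neg he
  calc weyl N e f * weylInv N e f
      = nilExp N (-f) * (nilExp N e * (nilExp N (-f) * nilExp N f) * nilExp N (-e)) *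
        nilExp N f := by simp only [weyl, weylInv, mul_assoc]
    _ = 1 := by rw [h1, mul_one, h2, mul_one, h1]

theorem weylInv_mul_weyl (he : e ^ N = 0) (hf : f ^ N = 0) : weylInv N e f * weyl N e f = 1 := by
  have h1 := nilExp_mul_nilExp_neg hf
  have h2 := nilExp_neg_mul_nilExp he
  calc weylInv N e f * weyl N e f
      = nilExp N f * (nilExp N (-e) * (nilExp N f * nilExp N (-f)) * nilExp N e) *
        nilExp N (-f) := by simp only [weyl, weylInv, mul_assoc]
    _ = 1 := by rw [h1, mul_one, h2, mul_one, h1]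

theorem Commute.nilExp_right {x y : R} (N : ℕ) (h : Commute x y) : Commute x (nilExp N y) :=
  Commute.sum_right _ _ _ fun _ _ => (h.pow_right _).smul_right _

theorem Commute.weyl_right {x : R} (N : ℕ) (he : Commute x e) (hf : Commute x f) :
    Commute x (weyl N e f) :=
  ((hf.neg_right.nilExp_right N).mul_right (he.nilExp_right N)).mul_right
    (hf.neg_right.nilExp_right N)

/-- In the basis (v, u) the three exponentials act by unipotent 2 × 2 matrices, and their product is
a quarter turn. -/
theorem weyl_semiconjBy_doublet (he : e ^ N = 0) (hf : f ^ N = 0) {v u : R} (ev : ⁅e, v⁆ = 0)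
    (fv : ⁅f, v⁆ = u) (eu : ⁅e, u⁆ = v) (fu : ⁅f, u⁆ = 0) :
    SemiconjBy (weyl N e f) v (-u) ∧ SemiconjBy (weyl N e f) u v := by
  have hf' : (-f) ^ N = 0 := by rw [neg_pow, hf, mul_zero]
  have Fv : SemiconjBy (nilExp N (-f)) v (v - u) := by
    have := nilExp_semiconjBy hf' (y := v) (y₁ := -u) (y₂ := 0) (y₃ := 0)
      (by simp [fv]) (by simp [fu]) (by simp) (by simp)
    simpa [sub_eq_add_neg] using this
  have Fu : SemiconjBy (nilExp N (-f)) u u := by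
    have := nilExp_semiconjBy hf' (y := u) (y₁ := 0) (y₂ := 0) (y₃ := 0)
      (by simp [fu]) (by simp) (by simp) (by simp)
    simpa using this
  have Ev : SemiconjBy (nilExp N e) v v := by
    have := nilExp_semiconjBy he (y := v) (y₁ := 0) (y₂ := 0) (y₃ := 0)
      (by simp [ev]) (by simp) (by simp) (by simp)
    simpa using this
  have Eu : SemiconjBy (nilExp N e) u (u + v) := by
    have := nilExp_semiconjBy he (y := u) (y₁ := v) (y₂ := 0) (y₃ := 0)
      (by simp [eu]) (by simp [ev]) (by simp) (by simp)
    simpa using this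
  constructor
  · have h1 := (Ev.sub_right Eu).mul_left Fv
    have h2 := Fu.neg_right
    rw [show v - (u + v) = -u by abel] at h1
    rw [weyl, mul_assoc]
    exact h2.mul_left h1
  · have h1 := Eu.mul_left Fu
    have h2 := Fu.add_right Fv
    rw [show u + (v - u) = v by abel] at h2
    rw [weyl, mul_assoc]
    exact h2.mul_left h1

/-- The same computation in the adjoint representation, spanned by e, h and f. -/
theorem weyl_semiconjBy_triple (he : e ^ N = 0) (hf : f ^ N = 0) (ef : ⁅e, f⁆ = h)
    (he2 : ⁅h, e⁆ = (2 : ℝ) • e) (hf2 : ⁅h, f⁆ = -((2 : ℝ) • f)) :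
    SemiconjBy (weyl N e f) e (-f) ∧ SemiconjBy (weyl N e f) f (-e) := by
  have hf' : (-f) ^ N = 0 := by rw [neg_pow, hf, mul_zero]
  have fe : ⁅f, e⁆ = -h := by rw [← lie_skew, ef]
  have fh : ⁅f, h⁆ = (2 : ℝ) • f := by rw [← lie_skew, hf2, neg_neg]
  have eh : ⁅e, h⁆ = -((2 : ℝ) • e) := by rw [← lie_skew, he2]
  have Fe : SemiconjBy (nilExp N (-f)) e (e + h - f) := by
    have := nilExp_semiconjBy hf' (y := e) (y₁ := h) (y₂ := -f) (y₃ := 0)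
      (by simp [fe]) (by simp [fh]) (by simp) (by simp)
    simpa [sub_eq_add_neg] using this
  have Fh : SemiconjBy (nilExp N (-f)) h (h - (2 : ℝ) • f) := by
    have := nilExp_semiconjBy hf' (y := h) (y₁ := -((2 : ℝ) • f)) (y₂ := 0) (y₃ := 0)
      (by simp [fh]) (by simp) (by simp) (by simp)
    simpa [sub_eq_add_neg] using this
  have Ff : SemiconjBy (nilExp N (-f)) f f := by
    have := nilExp_semiconjBy hf' (y := f) (y₁ := 0) (y₂ := 0) (y₃ := 0)
      (by simp) (by simp) (by simp) (by simp)
    simpa using this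
  have Ee : SemiconjBy (nilExp N e) e e := by
    have := nilExp_semiconjBy he (y := e) (y₁ := 0) (y₂ := 0) (y₃ := 0)
      (by simp) (by simp) (by simp) (by simp)
    simpa using this
  have Eh : SemiconjBy (nilExp N e) h (h - (2 : ℝ) • e) := by
    have := nilExp_semiconjBy he (y := h) (y₁ := -((2 : ℝ) • e)) (y₂ := 0) (y₃ := 0)
      (by simp [eh]) (by simp) (by simp) (by simp)
    simpa [sub_eq_add_neg] using this
  have Ef : SemiconjBy (nilExp N e) f (f + h - e) := by
    have := nilExp_semiconjBy he (y := f) (y₁ := h) (y₂ := -e) (y₃ := 0)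
      (by simp [ef]) (by simp [eh]) (by simp) (by simp)
    simpa [sub_eq_add_neg] using this
  constructor
  · have h1 := ((Ee.add_right Eh).sub_right Ef).mul_left Fe
    rw [show e + (h - (2 : ℝ) • e) - (f + h - e) = -f by module] at h1
    rw [weyl, mul_assoc]
    exact Ff.neg_right.mul_left h1
  · have h1 := Ef.mul_left Ff
    have h2 := (Ff.add_right Fh).sub_right Fe
    rw [show f + (h - (2 : ℝ) • f) - (e + h - f) = -e by module] at h2
    rw [weyl, mul_assoc]
    exact h2.mul_left h1

/-- The normalization vᵢ = ad_fⁱ(v₀)/i! makes the action of e and f symmetric, so that the Weyl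
element permutes the basis up to signs. The image of v₁ enters the formula for d_c^*, and that of v₃
the adjoint of dω_c. -/
theorem weyl_semiconjBy_quadruplet (he : e ^ N = 0) (hf : f ^ N = 0) {v₀ v₁ v₂ v₃ : R}
    (e₀ : ⁅e, v₀⁆ = 0) (e₁ : ⁅e, v₁⁆ = (3 : ℝ) • v₀) (e₂ : ⁅e, v₂⁆ = (2 : ℝ) • v₁)
    (e₃ : ⁅e, v₃⁆ = v₂) (f₀ : ⁅f, v₀⁆ = v₁) (f₁ : ⁅f, v₁⁆ = (2 : ℝ) • v₂)
    (f₂ : ⁅f, v₂⁆ = (3 : ℝ) • v₃) (f₃ : ⁅f, v₃⁆ = 0) :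
    SemiconjBy (weyl N e f) v₁ v₂ ∧ SemiconjBy (weyl N e f) v₃ v₀ := by
  have hf' : (-f) ^ N = 0 := by rw [neg_pow, hf, mul_zero]
  have F₀ : SemiconjBy (nilExp N (-f)) v₀ (v₀ - v₁ + v₂ - v₃) := by
    have := nilExp_semiconjBy hf' (y := v₀) (y₁ := -v₁) (y₂ := v₂) (y₃ := -v₃)
      (by simp [f₀]) (by simp [f₁]) (by simp [f₂]) (by simp [f₃])
    simpa [sub_eq_add_neg] using this
  have F₁ : SemiconjBy (nilExp N (-f)) v₁ (v₁ - (2 : ℝ) • v₂ + (3 : ℝ) • v₃) := by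
    have := nilExp_semiconjBy hf' (y := v₁) (y₁ := -((2 : ℝ) • v₂)) (y₂ := (3 : ℝ) • v₃) (y₃ := 0)
      (by simp [f₁]) (by simp [f₂]) (by simp [f₃]) (by simp)
    simpa [sub_eq_add_neg] using this
  have F₂ : SemiconjBy (nilExp N (-f)) v₂ (v₂ - (3 : ℝ) • v₃) := by
    have := nilExp_semiconjBy hf' (y := v₂) (y₁ := -((3 : ℝ) • v₃)) (y₂ := 0) (y₃ := 0)
      (by simp [f₂]) (by simp [f₃]) (by simp) (by simp)
    simpa [sub_eq_add_neg] using this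
  have F₃ : SemiconjBy (nilExp N (-f)) v₃ v₃ := by
    have := nilExp_semiconjBy hf' (y := v₃) (y₁ := 0) (y₂ := 0) (y₃ := 0)
      (by simp [f₃]) (by simp) (by simp) (by simp)
    simpa using this
  have E₁ : SemiconjBy (nilExp N e) v₁ (v₁ + (3 : ℝ) • v₀) := by
    have := nilExp_semiconjBy he (y := v₁) (y₁ := (3 : ℝ) • v₀) (y₂ := 0) (y₃ := 0)
      (by simp [e₁]) (by simp [e₀]) (by simp) (by simp)
    simpa using this
  have E₂ : SemiconjBy (nilExp N e) v₂ (v₂ + (2 : ℝ) • v₁ + (3 : ℝ) • v₀) := by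
    have := nilExp_semiconjBy he (y := v₂) (y₁ := (2 : ℝ) • v₁) (y₂ := (3 : ℝ) • v₀) (y₃ := 0)
      (by simp [e₂]) (by simp [e₁]) (by simp [e₀]) (by simp)
    simpa using this
  have E₃ : SemiconjBy (nilExp N e) v₃ (v₃ + v₂ + v₁ + v₀) :=
    nilExp_semiconjBy he (by simp [e₃]) (by simp [e₂]) (by simp [e₁]) (by simp [e₀])
  constructor
  · have h1 := ((E₁.sub_right (E₂.smul_right (2 : ℝ))).add_right (E₃.smul_right (3 : ℝ))).mul_left F₁
    have h2 := F₂.add_right (F₃.smul_right (3 : ℝ))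
    rw [show v₁ + (3 : ℝ) • v₀ - (2 : ℝ) • (v₂ + (2 : ℝ) • v₁ + (3 : ℝ) • v₀) +
      (3 : ℝ) • (v₃ + v₂ + v₁ + v₀) = v₂ + (3 : ℝ) • v₃ by module] at h1
    rw [show v₂ - (3 : ℝ) • v₃ + (3 : ℝ) • v₃ = v₂ by abel] at h2
    rw [weyl, mul_assoc]
    exact h2.mul_left h1
  · have h1 := E₃.mul_left F₃
    have h2 := ((F₃.add_right F₂).add_right F₁).add_right F₀
    rw [show v₃ + (v₂ - (3 : ℝ) • v₃) + (v₁ - (2 : ℝ) • v₂ + (3 : ℝ) • v₃) +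
      (v₀ - v₁ + v₂ - v₃) = v₀ by module] at h2
    rw [weyl, mul_assoc]
    exact h2.mul_left h1

end Weyl

/-! ### Highest weight vectors for sl₂ -/

section HighestWeight

variable {X : Type*} [AddCommGroup X] [Module ℝ X]

theorem lower_pow_weight {f h : Module.End ℝ X} (hf : ⁅h, f⁆ = -((2 : ℝ) • f)) {v : X} {μ : ℝ}
    (hv : h v = μ • v) (j : ℕ) : h ((f ^ j) v) = (μ - 2 * j) • (f ^ j) v := by
  have hh : ∀ x, h (f x) = f (h x) - (2 : ℝ) • f x := by
    intro x
    have := LinearMap.congr_fun hf x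
    simp only [Ring.lie_def, LinearMap.sub_apply, Module.End.mul_apply, LinearMap.neg_apply,
      LinearMap.smul_apply] at this
    rw [sub_eq_iff_eq_add] at this
    rw [this]; abel
  induction j with
  | zero => simp [hv]
  | succ j ih =>
    rw [pow_succ', Module.End.mul_apply, hh, ih, map_smul]
    push_cast
    module

/-- Commuting e past one f at a time adds up the weights μ, μ - 2, …, μ - 2j. -/
theorem raise_lower_pow {e f h : Module.End ℝ X} (ef : ⁅e, f⁆ = h) (hf : ⁅h, f⁆ = -((2 : ℝ) • f))
    {v : X} {μ : ℝ} (ev : e v = 0) (hv : h v = μ • v) (j : ℕ) :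
    e ((f ^ (j + 1)) v) = (((j : ℝ) + 1) * (μ - j)) • (f ^ j) v := by
  have hh : ∀ x, e (f x) = f (e x) + h x := by
    intro x
    rw [← ef]
    simp [Ring.lie_def]
  induction j with
  | zero => simp [hh, ev, hv]
  | succ j ih =>
    rw [pow_succ', Module.End.mul_apply, hh, ih, lower_pow_weight hf hv, map_smul,
      ← Module.End.mul_apply, ← pow_succ']
    push_cast
    module

/-- For μ < 0 the factors (j + 1)(μ - j) never vanish, so applying e shows that fʲ⁺¹ v = 0 forces fʲ
v = 0. Descend from a vanishing power. -/
theorem eq_zero_of_highest_weight_neg {e f h : Module.End ℝ X} (ef : ⁅e, f⁆ = h)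
    (hf : ⁅h, f⁆ = -((2 : ℝ) • f)) {v : X} {μ : ℝ} (hμ : μ < 0) (ev : e v = 0) (hv : h v = μ • v)
    (hnil : ∃ N, (f ^ N) v = 0) : v = 0 := by
  obtain ⟨N, hN⟩ := hnil
  induction N with
  | zero => simpa using hN
  | succ N ih =>
    apply ih
    have h1 := raise_lower_pow ef hf ev hv N
    rw [hN, map_zero] at h1
    refine (smul_eq_zero.1 h1.symm).resolve_left (mul_ne_zero (by positivity) ?_)
    have : (0 : ℝ) ≤ N := N.cast_nonneg
    linarith

/-- The vector fᵐ⁺¹ v is again killed by e, because the factor μ - j vanishes at j = m, and its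
weight -m - 2 is negative. -/
theorem lower_pow_eq_zero {e f h : Module.End ℝ X} (ef : ⁅e, f⁆ = h)
    (hf : ⁅h, f⁆ = -((2 : ℝ) • f)) {v : X} {m : ℕ} (ev : e v = 0) (hv : h v = (m : ℝ) • v)
    (hnil : IsNilpotent f) : (f ^ (m + 1)) v = 0 := by
  obtain ⟨N, hN⟩ := hnil
  refine eq_zero_of_highest_weight_neg ef hf (μ := (m : ℝ) - 2 * ((m + 1 : ℕ) : ℝ)) ?_ ?_ ?_
    ⟨N, by rw [hN]; rfl⟩
  · push_cast
    have : (0 : ℝ) ≤ m := m.cast_nonneg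
    linarith
  · rw [raise_lower_pow ef hf ev hv]; simp
  · exact lower_pow_weight hf hv _

end HighestWeight

/-! ### Doublets and quadruplets of operators under commutators with an sl₂-triple -/

section LieTriple

variable {R : Type*} [Ring R] [Algebra ℝ R] {N : ℕ} {e f h : R}

theorem isNilpotent_ad_of_pow_eq_zero (hf : f ^ N = 0) : IsNilpotent (LieAlgebra.ad ℝ R f) :=
  LieAlgebra.ad_nilpotent_of_nilpotent ⟨N, hf⟩

/-- Highest weight theory for the adjoint action on R, with weight 1; ad f is nilpotent because f
is. -/
theorem lie_doublet (hf : f ^ N = 0) (ef : ⁅e, f⁆ = h) (hf2 : ⁅h, f⁆ = -((2 : ℝ) • f)) {v : R}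
    (ev : ⁅e, v⁆ = 0) (hv : ⁅h, v⁆ = v) : ⁅e, ⁅f, v⁆⁆ = v ∧ ⁅f, ⁅f, v⁆⁆ = 0 := by
  have a1 : ⁅LieAlgebra.ad ℝ R e, LieAlgebra.ad ℝ R f⁆ = LieAlgebra.ad ℝ R h := by
    rw [← LieHom.map_lie, ef]
  have a2 : ⁅LieAlgebra.ad ℝ R h, LieAlgebra.ad ℝ R f⁆ = -((2 : ℝ) • LieAlgebra.ad ℝ R f) := by
    rw [← LieHom.map_lie, hf2, map_neg, map_smul]
  have hv' : LieAlgebra.ad ℝ R h v = ((1 : ℕ) : ℝ) • v := by simpa using hv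
  have ev' : LieAlgebra.ad ℝ R e v = 0 := by simpa using ev
  have h0 := raise_lower_pow a1 a2 ev' hv' 0
  have hz := lower_pow_eq_zero a1 a2 ev' hv' (isNilpotent_ad_of_pow_eq_zero hf)
  constructor
  · simpa using h0
  · simpa [pow_succ] using hz

/-- Weight 3: the constants 3, 4, 3 are (j + 1)(3 - j) for j = 0, 1, 2. -/
theorem lie_quadruplet (hf : f ^ N = 0) (ef : ⁅e, f⁆ = h) (hf2 : ⁅h, f⁆ = -((2 : ℝ) • f)) {v : R}
    (ev : ⁅e, v⁆ = 0) (hv : ⁅h, v⁆ = (3 : ℝ) • v) :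
    ⁅e, ⁅f, v⁆⁆ = (3 : ℝ) • v ∧ ⁅e, ⁅f, ⁅f, v⁆⁆⁆ = (4 : ℝ) • ⁅f, v⁆ ∧
      ⁅e, ⁅f, ⁅f, ⁅f, v⁆⁆⁆⁆ = (3 : ℝ) • ⁅f, ⁅f, v⁆⁆ ∧ ⁅f, ⁅f, ⁅f, ⁅f, v⁆⁆⁆⁆ = 0 := by
  have a1 : ⁅LieAlgebra.ad ℝ R e, LieAlgebra.ad ℝ R f⁆ = LieAlgebra.ad ℝ R h := by
    rw [← LieHom.map_lie, ef]
  have a2 : ⁅LieAlgebra.ad ℝ R h, LieAlgebra.ad ℝ R f⁆ = -((2 : ℝ) • LieAlgebra.ad ℝ R f) := by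
    rw [← LieHom.map_lie, hf2, map_neg, map_smul]
  have hv' : LieAlgebra.ad ℝ R h v = ((3 : ℕ) : ℝ) • v := by simpa using hv
  have ev' : LieAlgebra.ad ℝ R e v = 0 := by simpa using ev
  have h0 := raise_lower_pow a1 a2 ev' hv' 0
  have h1 := raise_lower_pow a1 a2 ev' hv' 1
  have h2 := raise_lower_pow a1 a2 ev' hv' 2
  have hz := lower_pow_eq_zero a1 a2 ev' hv' (isNilpotent_ad_of_pow_eq_zero hf)
  simp only [pow_succ, pow_zero, one_mul, Module.End.mul_apply, LieAlgebra.ad_apply,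
    Module.End.one_apply] at h0 h1 h2 hz
  norm_num at h0 h1 h2
  exact ⟨h0, h1, h2, hz⟩

/-- Conjugation by the Weyl element of a primitive vector of weight three. -/
theorem weyl_semiconjBy_of_weight_three (he : e ^ N = 0) (hf : f ^ N = 0) (ef : ⁅e, f⁆ = h)
    (hf2 : ⁅h, f⁆ = -((2 : ℝ) • f)) {v : R} (ev : ⁅e, v⁆ = 0) (hv : ⁅h, v⁆ = (3 : ℝ) • v) :
    SemiconjBy (weyl N e f) ⁅f, v⁆ ((1 / 2 : ℝ) • ⁅f, ⁅f, v⁆⁆) ∧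
      SemiconjBy (weyl N e f) ((1 / 6 : ℝ) • ⁅f, ⁅f, ⁅f, v⁆⁆⁆) v := by
  obtain ⟨h1, h2, h3, h4⟩ := lie_quadruplet hf ef hf2 ev hv
  refine weyl_semiconjBy_quadruplet he hf ev h1 ?_ ?_ rfl ?_ ?_ ?_
  · rw [lie_smul, h2, smul_smul]; norm_num
  · rw [lie_smul, h3, smul_smul]; norm_num
  · rw [smul_smul]; norm_num
  · rw [lie_smul, smul_smul]; norm_num
  · rw [lie_smul, h4, smul_zero]

/-- The differential of a Lefschetz-type operator: if `[e, d] = -η` where `η` commutes with `e`, then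
the iterated brackets of `f` with `d` and the conjugate of `d` by the Weyl element are determined
by `η`. -/
theorem lie_differential (he : e ^ N = 0) (hf : f ^ N = 0) (ef : ⁅e, f⁆ = h)
    (hf2 : ⁅h, f⁆ = -((2 : ℝ) • f)) {d η : R} (ed : ⁅e, d⁆ = -η) (hd : ⁅h, d⁆ = d)
    (eη : ⁅e, η⁆ = 0) (hη : ⁅h, η⁆ = (3 : ℝ) • η) :
    (1 / 2 : ℝ) • ⁅f, ⁅f, d⁆⁆ = -((1 / 6 : ℝ) • ⁅f, ⁅f, ⁅f, η⁆⁆⁆) ∧ ⁅f, ⁅f, ⁅f, d⁆⁆⁆ = 0 ∧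
      SemiconjBy (weyl N e f) d (-⁅f, d⁆ - (1 / 2 : ℝ) • ⁅f, ⁅f, η⁆⁆) := by
  obtain ⟨h1, h2, h3, h4⟩ := lie_quadruplet hf ef hf2 eη hη
  have hfη : ⁅h, ⁅f, η⁆⁆ = ⁅f, η⁆ := by
    rw [leibniz_lie, hf2, hη, neg_lie, smul_lie, lie_smul]
    module
  -- The correction making d primitive: [e, [f, η]] = 3η, so a third of [f, η] compensates [e, d] =
  -- -η.
  set d' := d + (1 / 3 : ℝ) • ⁅f, η⁆ with hd'
  have ed' : ⁅e, d'⁆ = 0 := by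
    rw [hd', lie_add, lie_smul, ed, h1, smul_smul]
    norm_num
  have hhd' : ⁅h, d'⁆ = d' := by rw [hd', lie_add, lie_smul, hd, hfη]
  obtain ⟨k1, k2⟩ := lie_doublet hf ef hf2 ed' hhd'
  have hff : ⁅f, ⁅f, d⁆⁆ = -((1 / 3 : ℝ) • ⁅f, ⁅f, ⁅f, η⁆⁆⁆) := by
    rw [hd', lie_add, lie_add, lie_smul, lie_smul] at k2
    exact eq_neg_of_add_eq_zero_left k2
  refine ⟨?_, ?_, ?_⟩
  · rw [hff, smul_neg, smul_smul]; norm_num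
  · rw [hff, lie_neg, lie_smul, h4, smul_zero, neg_zero]
  -- Write d = d' - ⅓[f, η]; the first term is the top of a doublet and the second lies in the
  -- quadruplet of η, so both conjugates are known.
  · have s1 := (weyl_semiconjBy_doublet he hf ed' rfl k1 k2).1
    have s2 := (weyl_semiconjBy_of_weight_three he hf ef hf2 eη hη).1
    have s3 := s1.sub_right (s2.smul_right (1 / 3 : ℝ))
    have e1 : d' - (1 / 3 : ℝ) • ⁅f, η⁆ = d := by rw [hd']; abel
    have e2 : -⁅f, d'⁆ - (1 / 3 : ℝ) • (1 / 2 : ℝ) • ⁅f, ⁅f, η⁆⁆ =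
        -⁅f, d⁆ - (1 / 2 : ℝ) • ⁅f, ⁅f, η⁆⁆ := by
      rw [hd', lie_add, lie_smul]
      module
    rwa [e1, e2] at s3

end LieTriple

/-! ### Linear algebra of a Hermitian vector space -/

namespace HermitianSpace

open Module ExtForm

variable {V : Type*} [AddCommGroup V] [Module ℝ V] (h : HermitianSpace V)

theorem g_J_left (v w : V) : h.g (h.J v) w = -h.g v (h.J w) := by
  have := h.g_J v (h.J w)
  rw [h.J_sq, map_neg] at this
  linarith

theorem g_J_J (v : V) : h.g (h.J (h.J v)) = -h.g v := by rw [h.J_sq, map_neg]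

theorem g_comp_J (v : V) : h.g v ∘ₗ h.J = -h.g (h.J v) := by
  ext w
  simp [h.g_J_left]

/-- The complex structure as a linear equivalence. -/
def JEquiv : V ≃ₗ[ℝ] V :=
  LinearEquiv.ofLinearMap h.J (-h.J) (by ext v; simp [h.J_sq]) (by ext v; simp [h.J_sq])

theorem JEquiv_apply (v : V) : h.JEquiv v = h.J v := rfl

theorem ins_omega (v : V) : ins v h.omega = Pi.single 1 (oneForm (h.g (h.J v))) := by
  funext k
  rw [ins_apply, omega]
  by_cases hk : k = 1
  · subst hk
    ext x
    simp [oneForm_apply, fundamentalForm]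
  · rw [Pi.single_eq_of_ne hk, Pi.single_eq_of_ne (by omega)]
    rfl

theorem parity_omega : parity h.omega = h.omega := by
  rw [parity, omega, diag_single]; simp

theorem diag_mul_L (c : ℕ → ℝ) : diag c * h.L = h.L * diag fun k => c (k + 2) :=
  diag_mul_wedge_single _ _ _

/-- The `j`-th power of `L` raises the degree by `2 j`. -/
theorem L_pow_apply_of_lt (j : ℕ) (α : ExtForm V) {k : ℕ} (hk : k < 2 * j) :
    (h.L ^ j) α k = 0 := by
  induction j generalizing k with
  | zero => omega
  | succ j ih =>
    rw [pow_succ', Module.End.mul_apply, L, omega]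
    by_cases hk2 : k < 2
    · exact wedge_single_apply_of_lt hk2 _ _
    · obtain ⟨l, rfl⟩ := Nat.exists_eq_add_of_le (not_lt.1 hk2)
      rw [wedge_single_apply rfl]
      have := ih (k := l) (by omega)
      rw [L, omega] at this
      rw [this, wedgeHom_zero_right]

theorem L_pow_one_apply_of_ne (j : ℕ) {k : ℕ} (hk : k ≠ 2 * j) :
    (h.L ^ j) (one : ExtForm V) k = 0 := by
  induction j generalizing k with
  | zero => rw [pow_zero, Module.End.one_apply, one, Pi.single_eq_of_ne (by omega)]
  | succ j ih =>
    rw [pow_succ', Module.End.mul_apply, L, omega]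
    by_cases hk2 : k < 2
    · exact wedge_single_apply_of_lt hk2 _ _
    · obtain ⟨l, rfl⟩ := Nat.exists_eq_add_of_le (not_lt.1 hk2)
      rw [wedge_single_apply rfl]
      have := ih (k := l) (by omega)
      rw [L, omega] at this
      rw [this, wedgeHom_zero_right]

theorem Jform_mul_JformInv : h.Jform * h.JformInv = 1 := by
  refine LinearMap.ext fun α => funext fun k => ?_
  ext v
  exact congrArg (α k) (funext fun i => by simp [h.J_sq] : _ = v)

theorem JformInv_mul_Jform : h.JformInv * h.Jform = 1 := by
  refine LinearMap.ext fun α => funext fun k => ?_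
  ext v
  exact congrArg (α k) (funext fun i => by simp [h.J_sq] : _ = v)

theorem Jform_mul_Jform : h.Jform * h.Jform = parity := by
  refine LinearMap.ext fun α => funext fun k => ?_
  ext v
  have := (α k).toMultilinearMap.map_smul_univ (fun _ => (-1 : ℝ)) v
  simp only [Finset.prod_const, Finset.card_univ, Fintype.card_fin] at this
  refine Eq.trans ?_ this
  have hv : ⇑h.J ∘ ⇑h.J ∘ v = fun i => (-1 : ℝ) • v i := by
    funext i; simp [h.J_sq]
  exact congrArg (α k) hv

theorem Jform_one : h.Jform one = one := pullback_one h.J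

theorem Jform_mul_diag (c : ℕ → ℝ) : Commute h.Jform (diag c) := rfl

theorem Jform_ins (v : V) : h.Jform * ins (h.J v) = ins v * h.Jform :=
  LinearMap.ext fun α => pullback_ins h.J v α

theorem Jform_mul_ins (v : V) : h.Jform * ins v = -(ins (h.J v) * h.Jform) := by
  have := h.Jform_ins (h.J v)
  rw [h.J_sq, ins_neg, mul_neg] at this
  rw [← this, neg_neg]

theorem Jform_mul_eps (v : V) : h.Jform * eps (h.g v) = -(eps (h.g (h.J v)) * h.Jform) := by
  refine LinearMap.ext fun α => ?_
  have := pullback_eps h.J (h.g v) α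
  rw [h.g_comp_J, eps_neg] at this
  exact this

theorem fundamentalForm_comp_J : h.fundamentalForm.compLinearMap h.J = h.fundamentalForm := by
  ext v
  exact h.g_J (h.J (v 0)) (v 1)

/-- The weight operator `k - n` on `k`-forms, where `dim V = 2 n`. -/
def weight (V : Type*) [AddCommGroup V] [Module ℝ V] : Module.End ℝ (ExtForm V) :=
  diag fun k => (k : ℝ) - finrank ℝ V / 2

theorem weight_lie_L : ⁅weight V, h.L⁆ = (2 : ℝ) • h.L := by
  rw [Ring.lie_def, weight, diag_mul_L, ← mul_sub, ← diag_sub]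
  have : (fun k : ℕ => ((k + 2 : ℕ) : ℝ) - finrank ℝ V / 2 - ((k : ℝ) - finrank ℝ V / 2)) =
      fun _ => 2 := by
    funext k; push_cast; ring
  rw [this, diag_const, mul_smul_comm, mul_one]

variable [FiniteDimensional ℝ V]

theorem g_onb (i j : Fin (finrank ℝ V)) : h.g (h.onb i) (h.onb j) = if i = j then 1 else 0 :=
  h.exists_orthonormal_basis.choose_spec i j

theorem onb_coord (i : Fin (finrank ℝ V)) : h.onb.coord i = h.g (h.onb i) := by
  refine h.onb.ext fun j => ?_
  rw [h.g_onb]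
  simp [Finsupp.single_apply, eq_comm]

theorem sum_g_onb (v : V) : ∑ i, h.g v (h.onb i) • h.onb i = v := by
  conv_rhs => rw [← h.onb.sum_repr v]
  refine Finset.sum_congr rfl fun i _ => ?_
  rw [h.g_symm, ← h.onb_coord i]
  rfl

theorem sum_g_J_onb (v : V) : ∑ i, h.g v (h.onb i) • h.J (h.onb i) = h.J v := by
  conv_rhs => rw [← h.sum_g_onb v, map_sum]
  simp

theorem exists_g_eq (f : V →ₗ[ℝ] ℝ) : ∃ v, f = h.g v := by
  refine ⟨∑ i, f (h.onb i) • h.onb i, h.onb.ext fun j => ?_⟩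
  simp [h.g_onb]

theorem sum_eps_ins : ∑ i, eps (h.g (h.onb i)) * ins (h.onb i) =
    (diag fun k => (k : ℝ) : Module.End ℝ (ExtForm V)) := by
  rw [← sum_eps_mul_ins h.onb]
  exact Finset.sum_congr rfl fun i _ => by rw [h.onb_coord]

theorem sum_eps_ins_J : ∑ i, eps (h.g (h.J (h.onb i))) * ins (h.J (h.onb i)) =
    (diag fun k => (k : ℝ) : Module.End ℝ (ExtForm V)) := by
  rw [← sum_eps_mul_ins (h.onb.map h.JEquiv)]
  refine Finset.sum_congr rfl fun i _ => ?_
  rw [Basis.map_apply, h.JEquiv_apply]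
  congr 2
  refine (h.onb.map h.JEquiv).ext fun j => ?_
  have h1 : (h.onb.map h.JEquiv).coord i ((h.onb.map h.JEquiv) j) = if j = i then 1 else 0 := by
    rw [Basis.coord_apply, Basis.repr_self, Finsupp.single_apply]
  rw [h1, Basis.map_apply, h.JEquiv_apply, h.g_J, h.g_onb]
  simp [eq_comm]

theorem formInner_parity (α β : ExtForm V) :
    h.formInner (parity α) (parity β) = h.formInner α β := by
  rw [formInner_apply, formInner_apply]
  refine Finset.sum_congr rfl fun k _ => ?_
  congr 1
  refine Finset.sum_congr rfl fun i _ => ?_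
  simp only [parity, diag_apply, AlternatingMap.smul_apply, smul_eq_mul]
  have : ((-1 : ℝ) ^ k) * (-1) ^ k = 1 := by rw [← mul_pow]; simp
  linear_combination (α k (h.onb ∘ i) * β k (h.onb ∘ i)) * this

theorem formInner_one (β : ExtForm V) : h.formInner one β = β 0 0 := by
  rw [formInner_apply, Finset.sum_eq_single 0]
  · simp only [Nat.factorial_zero, Nat.cast_one, inv_one, one_mul, Finset.univ_unique,
      Finset.sum_singleton]
    rw [one, Pi.single_eq_same, AlternatingMap.constOfIsEmpty_apply, Function.const_apply, one_mul]
    congr 1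
    exact Subsingleton.elim _ _
  · intro k _ hk
    simp [one, Pi.single_eq_of_ne hk]
  · simp

/-- Contraction with `v` is adjoint to multiplication by `g(v, -)`. -/
theorem formInner_eps (v : V) (α β : ExtForm V) :
    h.formInner (eps (h.g v) α) β = h.formInner α (ins v β) := by
  -- Multiplication by a covector shifts degrees by one, leaving two boundary terms: degree 0 on the
  -- left and degree dim V on the right. Both vanish.
  rw [formInner_apply, formInner_apply, Finset.sum_range_succ', Finset.sum_range_succ]
  have hz : ∀ i, eps (h.g v) α 0 (h.onb ∘ i) * β 0 (h.onb ∘ i) = 0 := fun i => by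
    simp [eps_apply_zero]
  have hD : ins v β (finrank ℝ V) = 0 := by
    rw [ins_apply, eq_zero_of_finrank_lt (Nat.lt_succ_self _) (β _)]; rfl
  simp only [hz, hD, Finset.sum_const_zero, AlternatingMap.zero_apply, mul_zero, add_zero]
  refine Finset.sum_congr rfl fun k _ => ?_
  have key : ∑ i : Fin (k + 1) → Fin (finrank ℝ V),
      eps (h.g v) α (k + 1) (h.onb ∘ i) * β (k + 1) (h.onb ∘ i) =
      ((k : ℝ) + 1) * ∑ i : Fin k → Fin (finrank ℝ V), α k (h.onb ∘ i) * ins v β k (h.onb ∘ i) := by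
    simp only [eps_apply_succ_apply, Finset.sum_mul]
    rw [Finset.sum_comm]
    -- Every slot p contributes equally, as moving the entry of β in slot p to the front absorbs the
    -- sign. The k + 1 slots turn 1/(k + 1)! into 1/k!.
    have hp : ∀ p : Fin (k + 1), ∑ i : Fin (k + 1) → Fin (finrank ℝ V),
        (-1) ^ (p : ℕ) * (h.g v ((h.onb ∘ i) p) * α k (p.removeNth (h.onb ∘ i))) *
          β (k + 1) (h.onb ∘ i) =
        ∑ i : Fin k → Fin (finrank ℝ V), α k (h.onb ∘ i) * ins v β k (h.onb ∘ i) := by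
      intro p
      rw [← (Fin.insertNthEquiv (fun _ => Fin (finrank ℝ V)) p).sum_comp, Fintype.sum_prod_type,
        Finset.sum_comm]
      refine Finset.sum_congr rfl fun i _ => ?_
      have hb : ∀ c, h.onb ∘ (p.insertNth c i : Fin (k + 1) → Fin (finrank ℝ V)) =
          p.insertNth (h.onb c) (h.onb ∘ i) := by
        intro c
        funext j
        refine Fin.succAboveCases p ?_ (fun j => ?_) j <;> simp
      have hβ : ∀ c, (-1) ^ (p : ℕ) * β (k + 1) (p.insertNth (h.onb c) (h.onb ∘ i)) =
          (β (k + 1)).curryLeft (h.onb c) (h.onb ∘ i) := by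
        intro c
        have := (β (k + 1)).neg_one_pow_smul_map_insertNth p (h.onb c) (h.onb ∘ i)
        rw [AlternatingMap.curryLeft_apply_apply, ← this]
        simp
      have hv : ins v β k (h.onb ∘ i) =
          ∑ c, h.g v (h.onb c) * (β (k + 1)).curryLeft (h.onb c) (h.onb ∘ i) := by
        let ev : V →ₗ[ℝ] ℝ :=
          { toFun := fun u => (β (k + 1)).curryLeft u (h.onb ∘ i)
            map_add' := fun u u' => by rw [map_add]; rfl
            map_smul' := fun c u => by rw [map_smul]; rfl }
        have := congrArg ev (h.sum_g_onb v)
        rw [map_sum] at this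
        simp only [map_smul, smul_eq_mul] at this
        exact this.symm
      rw [hv, Finset.mul_sum]
      refine Finset.sum_congr rfl fun c _ => ?_
      have hc : (Fin.insertNthEquiv (fun _ => Fin (finrank ℝ V)) p) (c, i) =
          (p.insertNth c i : Fin (k + 1) → Fin (finrank ℝ V)) := rfl
      rw [hc, hb, ← hβ, Fin.insertNth_apply_same, Fin.removeNth_insertNth]
      ring
    rw [Finset.sum_congr rfl fun p _ => hp p]
    simp
  rw [key, Nat.factorial_succ]
  push_cast
  have : ((k : ℝ) + 1) ≠ 0 := by positivity
  field_simp

theorem formInner_adjoint (φ : Module.End ℝ (ExtForm V)) (α β : ExtForm V) :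
    h.formInner (φ α) β = h.formInner α (h.adjoint φ β) :=
  (h.exists_adjoint φ).choose_spec α β

theorem adjoint_eq {φ ψ : Module.End ℝ (ExtForm V)}
    (H : ∀ α β, h.formInner (φ α) β = h.formInner α (ψ β)) : h.adjoint φ = ψ := by
  refine LinearMap.ext fun β => sub_eq_zero.1 (h.formInner_self_eq_zero ?_)
  rw [map_sub (h.formInner _), ← formInner_adjoint, ← H, sub_self]

/-- Euler's identity applied to ω, which has degree 2 and whose contraction with eᵢ is g(J eᵢ, -).
-/
theorem L_eq : h.L = (1 / 2 : ℝ) • ∑ i, eps (h.g (h.onb i)) * eps (h.g (h.J (h.onb i))) := by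
  have h1 := LinearMap.congr_fun h.sum_eps_ins h.omega
  have h2 : (diag fun k => (k : ℝ)) h.omega = (2 : ℝ) • h.omega := by
    rw [omega, diag_single]; simp
  rw [h2, LinearMap.sum_apply] at h1
  have h3 : h.omega = (1 / 2 : ℝ) • ∑ i, (eps (h.g (h.onb i)))
      (Pi.single 1 (oneForm (h.g (h.J (h.onb i))))) := by
    rw [eq_comm, one_div, inv_smul_eq_iff₀ two_ne_zero, ← h1]
    refine Finset.sum_congr rfl fun i _ => ?_
    rw [Module.End.mul_apply, ins_omega]
  refine LinearMap.ext fun α => ?_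
  rw [L, h3]
  simp only [map_smul, map_sum, LinearMap.smul_apply, LinearMap.sum_apply, eps_wedge]
  rfl

/-- Take adjoints term by term in `L_eq`; the order of the two factors is reversed. -/
theorem Lam_eq : h.Lam = (1 / 2 : ℝ) • ∑ i, ins (h.J (h.onb i)) * ins (h.onb i) := by
  refine h.adjoint_eq fun α β => ?_
  rw [L_eq]
  simp only [LinearMap.smul_apply, LinearMap.sum_apply, map_smul, map_sum, Module.End.mul_apply,
    formInner_eps]

theorem ins_mul_L (v : V) : ins v * h.L = h.L * ins v + eps (h.g (h.J v)) := by
  refine LinearMap.ext fun α => ?_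
  have := ins_wedge v h.omega α
  rw [ins_omega, parity_omega, add_comm] at this
  exact this

theorem L_lie_ins (v : V) : ⁅h.L, ins v⁆ = -eps (h.g (h.J v)) := by
  rw [Ring.lie_def, ins_mul_L]; abel

theorem L_lie_ins_J (v : V) : ⁅h.L, ins (h.J v)⁆ = eps (h.g v) := by
  rw [L_lie_ins, h.g_J_J, eps_neg, neg_neg]

theorem L_lie_eps (f : V →ₗ[ℝ] ℝ) : ⁅h.L, eps f⁆ = 0 := by
  rw [Ring.lie_def, sub_eq_zero]
  refine LinearMap.ext fun α => ?_
  have := eps_eq_wedge_parity f h.omega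
  rw [parity_omega] at this
  calc wedge h.omega (eps f α) = wedge (wedge h.omega (Pi.single 1 (oneForm f))) α :=
        (wedge_assoc _ _ _).symm
    _ = eps f (wedge h.omega α) := by rw [← this, eps_wedge]

theorem Lam_lie_ins (v : V) : ⁅h.Lam, ins v⁆ = 0 := by
  rw [Ring.lie_def, sub_eq_zero, Lam_eq, smul_mul_assoc, mul_smul_comm, Finset.sum_mul,
    Finset.mul_sum]
  congr 1
  refine Finset.sum_congr rfl fun i _ => ?_
  rw [mul_assoc, ins_mul_ins (h.onb i) v, mul_neg, ← mul_assoc, ins_mul_ins _ v, neg_mul, neg_neg,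
    mul_assoc]

theorem Lam_lie_eps (v : V) : ⁅h.Lam, eps (h.g v)⁆ = ins (h.J v) := by
  have key : ∀ i, ins (h.J (h.onb i)) * ins (h.onb i) * eps (h.g v) -
      eps (h.g v) * (ins (h.J (h.onb i)) * ins (h.onb i)) =
      h.g v (h.onb i) • ins (h.J (h.onb i)) + h.g (h.J v) (h.onb i) • ins (h.onb i) := by
    intro i
    rw [mul_assoc, ins_mul_eps, mul_sub, mul_smul_comm, mul_one, ← mul_assoc, ins_mul_eps, sub_mul,
      smul_mul_assoc, one_mul, h.g_J_left, mul_assoc]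
    module
  have h1 : ∑ i, h.g v (h.onb i) • ins (h.J (h.onb i)) = ins (h.J v) := by
    conv_rhs => rw [← h.sum_g_J_onb v, ← insₗ_apply, map_sum]
    simp [insₗ_apply]
  have h2 : ∑ i, h.g (h.J v) (h.onb i) • ins (h.onb i) = ins (h.J v) := by
    conv_rhs => rw [← h.sum_g_onb (h.J v), ← insₗ_apply, map_sum]
    simp [insₗ_apply]
  rw [Ring.lie_def, Lam_eq, smul_mul_assoc, mul_smul_comm, Finset.sum_mul, Finset.mul_sum,
    ← smul_sub, ← Finset.sum_sub_distrib, Finset.sum_congr rfl fun i _ => key i,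
    Finset.sum_add_distrib, h1, h2]
  module

/-- Each index contributes two Euler terms, for eᵢ and for J eᵢ, minus 1. Both families are bases,
so the total is ½(k + k - dim V) on k-forms. -/
theorem L_lie_Lam : ⁅h.L, h.Lam⁆ = weight V := by
  have key : ∀ i, h.L * (ins (h.J (h.onb i)) * ins (h.onb i)) -
      ins (h.J (h.onb i)) * ins (h.onb i) * h.L =
      eps (h.g (h.onb i)) * ins (h.onb i) +
        eps (h.g (h.J (h.onb i))) * ins (h.J (h.onb i)) - 1 := by
    intro i
    have h1 : h.L * ins (h.J (h.onb i)) = ins (h.J (h.onb i)) * h.L + eps (h.g (h.onb i)) := by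
      rw [← L_lie_ins_J, Ring.lie_def]; abel
    have h2 : h.L * ins (h.onb i) = ins (h.onb i) * h.L - eps (h.g (h.J (h.onb i))) := by
      rw [ins_mul_L]; abel
    have h3 : h.g (h.J (h.onb i)) (h.J (h.onb i)) = 1 := by rw [h.g_J, h.g_onb, if_pos rfl]
    rw [← mul_assoc, h1, add_mul, mul_assoc, h2, mul_sub, ins_mul_eps, h3, one_smul, mul_assoc]
    abel
  rw [Ring.lie_def, Lam_eq, smul_mul_assoc, mul_smul_comm, Finset.sum_mul, Finset.mul_sum,
    ← smul_sub, ← Finset.sum_sub_distrib, Finset.sum_congr rfl fun i _ => key i,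
    Finset.sum_sub_distrib, Finset.sum_add_distrib, sum_eps_ins, sum_eps_ins_J]
  rw [weight, diag_sub, diag_const]
  simp only [Finset.sum_const, Finset.card_univ, Fintype.card_fin]
  module

theorem Lam_mul_diag (c : ℕ → ℝ) : h.Lam * diag c = (diag fun k => c (k + 2)) * h.Lam := by
  rw [Lam_eq, smul_mul_assoc, mul_smul_comm, Finset.sum_mul, Finset.mul_sum]
  congr 1

theorem weight_lie_Lam : ⁅weight V, h.Lam⁆ = -((2 : ℝ) • h.Lam) := by
  rw [Ring.lie_def, weight, Lam_mul_diag, ← sub_mul, ← diag_sub]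
  have : (fun k : ℕ => (k : ℝ) - finrank ℝ V / 2 - (((k + 2 : ℕ) : ℝ) - finrank ℝ V / 2)) =
      fun _ => -2 := by
    funext k; push_cast; ring
  rw [this, diag_const, smul_mul_assoc, one_mul, neg_smul]

theorem L_pow_eq_zero : h.L ^ (finrank ℝ V + 1) = 0 := by
  refine LinearMap.ext fun α => funext fun k => ?_
  by_cases hk : k < 2 * (finrank ℝ V + 1)
  · exact h.L_pow_apply_of_lt _ _ hk
  · exact eq_zero_of_finrank_lt (by omega) _

theorem Lam_pow_apply_of_lt (j : ℕ) (α : ExtForm V) {k : ℕ} (hk : finrank ℝ V < k + 2 * j) :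
    (h.Lam ^ j) α k = 0 := by
  induction j generalizing k with
  | zero => exact eq_zero_of_finrank_lt hk _
  | succ j ih =>
    rw [pow_succ', Module.End.mul_apply, Lam_eq]
    simp only [LinearMap.smul_apply, LinearMap.sum_apply, Pi.smul_apply, Finset.sum_apply,
      Module.End.mul_apply, ins_apply]
    rw [← Lam_eq, ih (k := k + 1 + 1) (by omega)]
    ext x
    simp

theorem Lam_pow_eq_zero : h.Lam ^ (finrank ℝ V + 1) = 0 :=
  LinearMap.ext fun α => funext fun k => h.Lam_pow_apply_of_lt _ α (by omega)

theorem Jform_commute_L : Commute h.Jform h.L := by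
  refine LinearMap.ext fun α => ?_
  have := pullback_wedge h.J h.omega α
  rw [omega, pullback_single, fundamentalForm_comp_J] at this
  exact this

theorem Jform_commute_Lam : Commute h.Jform h.Lam := by
  rw [Lam_eq]
  refine (Commute.sum_right _ _ _ fun i _ => ?_).smul_right _
  change _ = _
  rw [← mul_assoc, Jform_mul_ins, h.J_sq, ins_neg, neg_mul, neg_mul, neg_mul, neg_neg,
    mul_assoc, Jform_mul_ins, mul_neg, ← mul_assoc, ins_mul_ins, neg_mul, neg_neg]

/-- The Weyl element of the Lefschetz triple. -/
def weylOp : Module.End ℝ (ExtForm V) := weyl (finrank ℝ V + 1) h.L h.Lam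

/-- The inverse of the Weyl element. -/
def weylOpInv : Module.End ℝ (ExtForm V) := weylInv (finrank ℝ V + 1) h.L h.Lam

theorem weylOp_mul_weylOpInv : h.weylOp * h.weylOpInv = 1 :=
  weyl_mul_weylInv h.L_pow_eq_zero h.Lam_pow_eq_zero

theorem weylOpInv_mul_weylOp : h.weylOpInv * h.weylOp = 1 :=
  weylInv_mul_weyl h.L_pow_eq_zero h.Lam_pow_eq_zero

/-- Multiplication by g(v, -) and contraction with J v form a doublet, which the Weyl element
rotates. -/
theorem weylOp_mul_eps (v : V) : h.weylOp * eps (h.g v) = -(ins (h.J v) * h.weylOp) := by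
  have := (weyl_semiconjBy_doublet h.L_pow_eq_zero h.Lam_pow_eq_zero (h.L_lie_eps (h.g v))
    (h.Lam_lie_eps v) (h.L_lie_ins_J v) (h.Lam_lie_ins (h.J v))).1.eq
  rwa [neg_mul] at this

theorem weylOp_mul_ins_J (v : V) : h.weylOp * ins (h.J v) = eps (h.g v) * h.weylOp :=
  (weyl_semiconjBy_doublet h.L_pow_eq_zero h.Lam_pow_eq_zero (h.L_lie_eps (h.g v))
    (h.Lam_lie_eps v) (h.L_lie_ins_J v) (h.Lam_lie_ins (h.J v))).2.eq

theorem weylOp_semiconjBy : SemiconjBy h.weylOp h.L (-h.Lam) ∧ SemiconjBy h.weylOp h.Lam (-h.L) :=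
  weyl_semiconjBy_triple h.L_pow_eq_zero h.Lam_pow_eq_zero h.L_lie_Lam h.weight_lie_L
    h.weight_lie_Lam

/-- Conjugation by the Weyl element takes L to -Λ and Λ to -L, hence negates [L, Λ]: degrees are
reflected about the middle one, as the star requires. -/
theorem weylOp_mul_weight : h.weylOp * weight V = -(weight V * h.weylOp) := by
  obtain ⟨h1, h2⟩ := h.weylOp_semiconjBy
  have h3 := ((h1.mul_right h2).sub_right (h2.mul_right h1)).eq
  rw [← Ring.lie_def, L_lie_Lam] at h3
  rw [h3, ← L_lie_Lam, Ring.lie_def, ← neg_mul]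
  congr 1
  noncomm_ring

theorem Jform_commute_weylOp : Commute h.Jform h.weylOp :=
  h.Jform_commute_L.weyl_right _ h.Jform_commute_Lam

theorem parity_commute_weylOp : Commute parity h.weylOp := by
  rw [← h.Jform_mul_Jform]
  exact h.Jform_commute_weylOp.mul_left h.Jform_commute_weylOp

end HermitianSpace

/-! ### The Hodge star as J w σ, and its commutation relations -/

namespace HermitianSpace

open Module ExtForm

variable {V : Type*} [AddCommGroup V] [Module ℝ V] (h : HermitianSpace V)

theorem one_ne_zero' : (one : ExtForm V) ≠ 0 := by
  intro h0
  have := congrArg (fun f => f 0) (congrFun h0 0)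
  simp [one] at this

/-- The sign operator `(-1)^{k (k + 1) / 2}` on `k`-forms. -/
def signOp (V : Type*) [AddCommGroup V] [Module ℝ V] : Module.End ℝ (ExtForm V) :=
  diag fun k => (-1) ^ (k * (k + 1) / 2)

theorem neg_one_pow_triangle_succ (k : ℕ) : (-1 : ℝ) ^ ((k + 1) * (k + 1 + 1) / 2) =
    (-1) ^ (k * (k + 1) / 2) * (-1) ^ (k + 1) := by
  rw [← pow_add]
  congr 1
  have : (k + 1) * (k + 1 + 1) = k * (k + 1) + 2 * (k + 1) := by ring
  omega

theorem neg_one_pow_mul_self (k : ℕ) : (-1 : ℝ) ^ k * (-1) ^ k = 1 := by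
  rw [← mul_pow]; simp

theorem signOp_mul_signOp : signOp V * signOp V = 1 := by
  rw [signOp, diag_mul_diag, ← diag_one]
  congr 1
  funext k
  exact neg_one_pow_mul_self _

theorem signOp_mul_eps (f : V →ₗ[ℝ] ℝ) : signOp V * eps f = -(eps f * signOp V * parity) := by
  rw [signOp, diag_mul_eps, mul_assoc, parity, diag_mul_diag, ← mul_neg, neg_diag]
  congr 2
  funext k
  rw [neg_one_pow_triangle_succ, pow_succ]
  ring

theorem ins_mul_signOp (v : V) : ins v * signOp V = -(signOp V * parity * ins v) := by
  rw [signOp, ins_mul_diag, parity, diag_mul_diag, ← neg_mul, neg_diag]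
  congr 2
  funext k
  rw [neg_one_pow_triangle_succ, pow_succ]
  ring

theorem signOp_commute_diag (c : ℕ → ℝ) : Commute (signOp V) (diag c) := by
  change _ = _
  rw [signOp, diag_mul_diag, diag_mul_diag]
  congr 1
  funext k
  ring

theorem signOp_commute_parity : Commute (signOp V) parity := signOp_commute_diag _

theorem signOp_one : signOp V one = one := by
  rw [signOp, one, diag_single]; simp

theorem signOp_mul_wedge_three (a : V [⋀^Fin 3]→ₗ[ℝ] ℝ) :
    signOp V * wedge (Pi.single 3 a) = wedge (Pi.single 3 a) * signOp V * parity := by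
  rw [signOp, diag_mul_wedge_single, mul_assoc, parity, diag_mul_diag]
  congr 2
  funext k
  rw [neg_one_pow_triangle_succ, neg_one_pow_triangle_succ, neg_one_pow_triangle_succ]
  simp only [pow_succ]
  have := neg_one_pow_mul_self k
  linear_combination (-1 : ℝ) ^ (k * (k + 1) / 2) * (-1) ^ k * this

theorem parity_mul_wedge_three (a : V [⋀^Fin 3]→ₗ[ℝ] ℝ) :
    parity * wedge (Pi.single 3 a) = -(wedge (Pi.single 3 a) * parity) := by
  rw [parity, diag_mul_wedge_single, ← mul_neg, neg_diag]
  congr 2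
  funext k
  simp [pow_succ]

theorem weight_one : weight V one = -(((finrank ℝ V : ℝ) / 2) • (one : ExtForm V)) := by
  rw [weight, one, diag_single, Nat.cast_zero, zero_sub]
  module

variable [FiniteDimensional ℝ V]

theorem Lam_one : h.Lam one = 0 := by
  rw [Lam_eq]
  simp [ins_one]

/-- The unit has weight -n, so its image has weight n and lies in top degree. There only Lⁿ/n!
survives: the first exponential fixes 1 as Λ kills it, and the nontrivial terms of the last one
never reach top degree. -/
theorem weylOp_one : h.weylOp one = Pi.single (finrank ℝ V) h.vol := by
  have hw : weight V (h.weylOp one) = ((finrank ℝ V : ℝ) / 2) • h.weylOp one := by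
    have := LinearMap.congr_fun h.weylOp_mul_weight one
    rw [Module.End.mul_apply, weight_one, map_neg, map_smul, LinearMap.neg_apply,
      Module.End.mul_apply, neg_inj] at this
    exact this.symm
  funext k
  by_cases hk : k = finrank ℝ V
  · subst hk
    rw [Pi.single_eq_same, weylOp, weyl, Module.End.mul_apply, Module.End.mul_apply]
    have h1 : nilExp (finrank ℝ V + 1) (-h.Lam) one = one := by
      rw [nilExp, Finset.sum_range_succ', LinearMap.add_apply, LinearMap.sum_apply,
        Finset.sum_eq_zero]
      · simp
      · intro j _
        rw [LinearMap.smul_apply, pow_succ, Module.End.mul_apply, LinearMap.neg_apply, Lam_one]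
        simp
    have h2 : ∀ β : ExtForm V, nilExp (finrank ℝ V + 1) (-h.Lam) β (finrank ℝ V) =
        β (finrank ℝ V) := by
      intro β
      rw [nilExp, Finset.sum_range_succ', LinearMap.add_apply, LinearMap.sum_apply, Pi.add_apply,
        Finset.sum_apply, Finset.sum_eq_zero]
      · simp
      · intro j _
        rw [LinearMap.smul_apply, Pi.smul_apply, ← neg_one_smul ℝ h.Lam, smul_pow,
          LinearMap.smul_apply, Pi.smul_apply, h.Lam_pow_apply_of_lt _ _ (by omega), smul_zero,
          smul_zero]
    rw [h1, h2, nilExp, LinearMap.sum_apply, Finset.sum_apply, vol,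
      Finset.sum_eq_single (finrank ℝ V / 2)]
    · rfl
    · intro j _ hj
      rw [LinearMap.smul_apply, Pi.smul_apply, h.L_pow_one_apply_of_ne j (by omega), smul_zero]
    · intro hj
      exact absurd (Finset.mem_range.2 (by omega)) hj
  · rw [Pi.single_eq_of_ne hk]
    have := congrFun hw k
    rw [weight, diag_apply, Pi.smul_apply] at this
    have h3 : ((k : ℝ) - finrank ℝ V) • h.weylOp one k = 0 := by
      have h4 : ((k : ℝ) - finrank ℝ V / 2 - finrank ℝ V / 2) • h.weylOp one k =
          ((k : ℝ) - finrank ℝ V / 2) • h.weylOp one k -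
            ((finrank ℝ V : ℝ) / 2) • h.weylOp one k := by module
      rw [this, sub_self] at h4
      rw [← h4]
      congr 1
      ring
    refine (smul_eq_zero.1 h3).resolve_left ?_
    exact sub_ne_zero.2 (by exact_mod_cast hk)

/-- The volume form is the image of 1 under the invertible Weyl element. -/
theorem vol_ne_zero : h.vol ≠ 0 := by
  intro h0
  have h1 := h.weylOp_one
  rw [h0, Pi.single_zero] at h1
  have h2 := LinearMap.congr_fun h.weylOpInv_mul_weylOp one
  rw [Module.End.mul_apply, h1, map_zero] at h2
  exact one_ne_zero' h2.symm

/-- The operator `J w σ`, where `w` is the Weyl element and `σ` the sign operator. -/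
def starOp : Module.End ℝ (ExtForm V) := h.Jform * h.weylOp * signOp V

theorem starOp_mul_weight : h.starOp * weight V = -(weight V * h.starOp) := by
  have h1 : signOp V * weight V = weight V * signOp V := signOp_commute_diag _
  have h2 : h.Jform * weight V = weight V * h.Jform := h.Jform_mul_diag _
  rw [starOp, mul_assoc, h1, ← mul_assoc, mul_assoc h.Jform, weylOp_mul_weight,
    mul_neg, neg_mul, ← mul_assoc, h2]
  simp only [mul_assoc]

/-- The relation that characterises the star up to its value at 1. The twist by J undoes the J in
`weylOp_mul_ins_J`, and σ supplies the degree-dependent sign. -/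
theorem eps_mul_starOp (v : V) : eps (h.g v) * h.starOp = h.starOp * parity * ins v := by
  have h1 : h.weylOp * ins v = -(eps (h.g (h.J v)) * h.weylOp) := by
    have := h.weylOp_mul_ins_J (h.J v)
    rw [h.J_sq, ins_neg, mul_neg] at this
    rw [← this, neg_neg]
  have h2 : h.Jform * eps (h.g (h.J v)) = eps (h.g v) * h.Jform := by
    rw [Jform_mul_eps, h.g_J_J, eps_neg, neg_mul, neg_neg]
  have h3 : signOp V * parity * ins v = -(ins v * signOp V) := by rw [ins_mul_signOp, neg_neg]
  calc eps (h.g v) * h.starOp = h.Jform * (eps (h.g (h.J v)) * h.weylOp) * signOp V := by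
        rw [starOp, ← mul_assoc, ← mul_assoc, ← h2]; simp only [mul_assoc]
    _ = h.Jform * h.weylOp * -(ins v * signOp V) := by
        rw [← neg_eq_iff_eq_neg.2 h1, mul_neg, mul_neg, neg_mul]; simp only [mul_assoc]
    _ = h.starOp * parity * ins v := by rw [← h3, starOp]; simp only [mul_assoc]

theorem starOp_one : h.starOp one = Pi.single (finrank ℝ V) h.vol := by
  rw [starOp, Module.End.mul_apply, signOp_one, h.Jform_commute_weylOp.eq, Module.End.mul_apply,
    Jform_one, weylOp_one]

/-- The operator negates weights, so only the degree 0 part of β reaches top degree, and that part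
is a multiple of 1. -/
theorem starOp_apply_top (β : ExtForm V) :
    h.starOp β (finrank ℝ V) = h.formInner one β • h.vol := by
  let F : ExtForm V →ₗ[ℝ] V [⋀^Fin (finrank ℝ V)]→ₗ[ℝ] ℝ :=
    LinearMap.proj (finrank ℝ V) ∘ₗ h.starOp
  let G : ExtForm V →ₗ[ℝ] V [⋀^Fin (finrank ℝ V)]→ₗ[ℝ] ℝ := (h.formInner one).smulRight h.vol
  suffices hFG : F = G from LinearMap.congr_fun hFG β
  refine linearMap_ext fun k b => ?_
  change h.starOp (Pi.single k b) (finrank ℝ V) = h.formInner one (Pi.single k b) • h.vol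
  rw [formInner_one]
  by_cases hk : k = 0
  · subst hk
    conv_lhs => rw [single_zero_eq, map_smul, starOp_one]
    simp
  · rw [Pi.single_eq_of_ne (Ne.symm hk), AlternatingMap.zero_apply, zero_smul]
    have h1 := congrFun (LinearMap.congr_fun h.starOp_mul_weight (Pi.single k b)) (finrank ℝ V)
    rw [Module.End.mul_apply, weight, diag_single, map_smul, LinearMap.neg_apply,
      Module.End.mul_apply, Pi.neg_apply, diag_apply, Pi.smul_apply] at h1
    have h2 : (k : ℝ) • h.starOp (Pi.single k b) (finrank ℝ V) = 0 := by
      rw [eq_neg_iff_add_eq_zero, ← add_smul] at h1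
      rw [← h1]
      congr 1
      ring
    exact (smul_eq_zero.1 h2).resolve_left (by exact_mod_cast hk)

theorem starOp_isHodgeStar : h.IsHodgeStar h.starOp := by
  -- Induction on α by covectors. Passing a covector across α introduces the parity of α, so the
  -- statement is carried for α and its parity image together.
  have key : ∀ α : ExtForm V, (∀ β, wedge α (h.starOp β) (finrank ℝ V) =
      h.formInner α β • h.vol) ∧ (∀ β, wedge (parity α) (h.starOp β) (finrank ℝ V) =
      h.formInner (parity α) β • h.vol) := by
    intro α
    induction α using eps_induction with
    | one =>
      have : ∀ β, wedge one (h.starOp β) (finrank ℝ V) = h.formInner one β • h.vol := fun β => by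
        rw [one_wedge, starOp_apply_top]
      exact ⟨this, by rwa [parity_one]⟩
    | add α α' ha ha' =>
      constructor <;> intro β
      · simp only [map_add, LinearMap.add_apply, Pi.add_apply, ha.1, ha'.1, add_smul]
      · simp only [map_add, LinearMap.add_apply, Pi.add_apply, ha.2, ha'.2, add_smul]
    | smul c α ha =>
      constructor <;> intro β
      · simp only [map_smul, LinearMap.smul_apply, Pi.smul_apply, ha.1, smul_smul, smul_eq_mul]
      · simp only [map_smul, LinearMap.smul_apply, Pi.smul_apply, ha.2, smul_smul, smul_eq_mul]
    | eps f α ha =>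
      obtain ⟨v, rfl⟩ := h.exists_g_eq f
      have step : ∀ α' : ExtForm V, (∀ β, wedge (parity α') (h.starOp β) (finrank ℝ V) =
          h.formInner (parity α') β • h.vol) → ∀ β, wedge (eps (h.g v) α') (h.starOp β)
          (finrank ℝ V) = h.formInner (eps (h.g v) α') β • h.vol := by
        intro α' hα' β
        have h1 : eps (h.g v) (h.starOp β) = h.starOp (parity (ins v β)) :=
          LinearMap.congr_fun (h.eps_mul_starOp v) β
        rw [eps_eq_wedge_parity, wedge_assoc]
        change wedge (parity α') (eps (h.g v) (h.starOp β)) _ = _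
        rw [h1, hα', formInner_parity, ← eps_eq_wedge_parity, formInner_eps]
      refine ⟨step α ha.2, ?_⟩
      have h2 : parity (eps (h.g v) α) = -eps (h.g v) (parity α) :=
        LinearMap.congr_fun (parity_mul_eps _) α
      have h3 : parity (parity α) = α := LinearMap.congr_fun parity_mul_parity α
      have h4 := step (parity α) (by rw [h3]; exact ha.1)
      intro β
      rw [h2]
      simp only [map_neg, LinearMap.neg_apply, Pi.neg_apply, h4]
      module
  exact fun α β => (key α).1 β

theorem starOp_surjective (γ : ExtForm V) : ∃ β, h.starOp β = γ := by
  refine ⟨signOp V (h.weylOpInv (h.JformInv γ)), ?_⟩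
  have h1 : h.starOp * (signOp V * h.weylOpInv * h.JformInv) = 1 := by
    calc h.starOp * (signOp V * h.weylOpInv * h.JformInv)
        = h.Jform * (h.weylOp * (signOp V * signOp V) * h.weylOpInv) * h.JformInv := by
          rw [starOp]; simp only [mul_assoc]
      _ = 1 := by
          rw [signOp_mul_signOp, mul_one, weylOp_mul_weylOpInv, mul_one, Jform_mul_JformInv]
  exact LinearMap.congr_fun h1 γ

theorem star_isHodgeStar : h.IsHodgeStar h.star := by
  have H : ∃ S, h.IsHodgeStar S := ⟨_, h.starOp_isHodgeStar⟩
  rw [star, dif_pos H]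
  exact H.choose_spec

/-- The Hodge star operator is unique. -/
theorem IsHodgeStar.eq_starOp {S : Module.End ℝ (ExtForm V)} (hS : h.IsHodgeStar S) :
    S = h.starOp := by
  refine LinearMap.ext fun β => ?_
  -- With the difference written as ⋆γ, pairing it with γ itself gives ⟨γ, γ⟩ vol = 0, and
  -- positivity gives γ = 0.
  obtain ⟨γ, hγ⟩ := h.starOp_surjective (S β - h.starOp β)
  have h1 := h.starOp_isHodgeStar γ γ
  rw [hγ, map_sub, Pi.sub_apply, hS, h.starOp_isHodgeStar, sub_self] at h1
  have h2 := (smul_eq_zero.1 h1.symm).resolve_right h.vol_ne_zero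
  rw [h.formInner_self_eq_zero h2, map_zero] at hγ
  exact sub_eq_zero.1 hγ.symm

theorem star_eq : h.star = h.starOp := h.star_isHodgeStar.eq_starOp

/-- Otherwise det(J)² = (-1)^{dim V} would be negative. -/
theorem even_finrank (h : HermitianSpace V) : Even (finrank ℝ V) := by
  have h1 : h.J ∘ₗ h.J = (-1 : ℝ) • LinearMap.id := by ext v; simp [h.J_sq]
  have h2 := congrArg LinearMap.det h1
  rw [LinearMap.det_comp, LinearMap.det_smul, LinearMap.det_id, mul_one] at h2
  by_contra hodd
  rw [Nat.not_even_iff_odd] at hodd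
  rw [hodd.neg_one_pow] at h2
  nlinarith [mul_self_nonneg (LinearMap.det h.J)]

theorem weylOp_one_eq : h.weylOp one =
    (((finrank ℝ V / 2).factorial : ℝ)⁻¹) • (h.L ^ (finrank ℝ V / 2)) one := by
  rw [weylOp_one]
  have hev := h.even_finrank
  funext k
  by_cases hk : k = finrank ℝ V
  · subst hk; rw [Pi.single_eq_same]; rfl
  · rw [Pi.single_eq_of_ne hk, Pi.smul_apply, h.L_pow_one_apply_of_ne, smul_zero]
    obtain ⟨m, hm⟩ := hev
    omega

/-- For the reversed triple (Λ, L, -H) the unit is a highest weight vector of weight n, so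
`raise_lower_pow` applies. -/
theorem Lam_pow_L_pow_one {j : ℕ} (hj : j ≤ finrank ℝ V / 2) : (h.Lam ^ j) ((h.L ^ j) one) =
    ((j.factorial : ℝ) * (finrank ℝ V / 2).descFactorial j) • (one : ExtForm V) := by
  have hn : ((finrank ℝ V / 2 : ℕ) : ℝ) = (finrank ℝ V : ℝ) / 2 := by
    obtain ⟨m, hm⟩ := h.even_finrank
    rw [hm, show (m + m) / 2 = m by omega]
    push_cast
    ring
  have ef : ⁅h.Lam, h.L⁆ = -weight V := by rw [← lie_skew, L_lie_Lam]
  have hf : ⁅-weight V, h.L⁆ = -((2 : ℝ) • h.L) := by rw [neg_lie, weight_lie_L]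
  have hv : (-weight V) (one : ExtForm V) = ((finrank ℝ V / 2 : ℕ) : ℝ) • one := by
    rw [LinearMap.neg_apply, weight_one, hn, neg_neg]
  induction j with
  | zero => simp
  | succ j ih =>
    have h1 := raise_lower_pow ef hf h.Lam_one hv j
    rw [pow_succ, Module.End.mul_apply, h1, map_smul, ih (by omega), smul_smul,
      Nat.factorial_succ, Nat.descFactorial_succ]
    congr 1
    push_cast [Nat.cast_sub (show j ≤ finrank ℝ V / 2 by omega)]
    ring

/-- Both sides anticommute with covectors, so it suffices to evaluate at 1. There w² 1 = (-Λ)ⁿ Lⁿ 1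
/ (n!)², and Λⁿ Lⁿ 1 = (n!)² · 1. -/
theorem weylOp_mul_weylOp :
    h.weylOp * h.weylOp = ((-1 : ℝ) ^ (finrank ℝ V / 2)) • parity := by
  set n := finrank ℝ V / 2 with hn
  refine ext_of_eps (fun f γ => -eps f γ) ?_ ?_ ?_
  · intro f α
    obtain ⟨v, rfl⟩ := h.exists_g_eq f
    have : h.weylOp * h.weylOp * eps (h.g v) = -(eps (h.g v) * (h.weylOp * h.weylOp)) := by
      rw [mul_assoc, weylOp_mul_eps, mul_neg, ← mul_assoc, weylOp_mul_ins_J, mul_assoc]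
    exact LinearMap.congr_fun this α
  · intro f α
    have : parity (eps f α) = -eps f (parity α) := LinearMap.congr_fun (parity_mul_eps f) α
    rw [LinearMap.smul_apply, this, LinearMap.smul_apply, map_smul, smul_neg]
  · have h1 : h.weylOp * h.L ^ n = (-h.Lam) ^ n * h.weylOp := (h.weylOp_semiconjBy.1.pow_right n).eq
    have h2 : h.weylOp ((h.L ^ n) one) = ((-h.Lam) ^ n) (h.weylOp one) :=
      LinearMap.congr_fun h1 one
    rw [Module.End.mul_apply, weylOp_one_eq, ← hn, map_smul, h2, weylOp_one_eq, ← hn, map_smul,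
      ← neg_one_smul ℝ h.Lam, smul_pow, LinearMap.smul_apply, h.Lam_pow_L_pow_one le_rfl, ← hn,
      Nat.descFactorial_self, LinearMap.smul_apply, parity_one, smul_smul, smul_smul, smul_smul]
    congr 1
    have : (n.factorial : ℝ) ≠ 0 := by positivity
    field_simp

/-- Both sides turn multiplication by g(v, -) into the same operator, -ι_{Jv} after parity, so they
agree up to their value at 1. In degree 2n the sign σ is (-1)^{2n² + n} = (-1)ⁿ. -/
theorem signOp_mul_weylOp : signOp V * h.weylOp =
    ((-1 : ℝ) ^ (finrank ℝ V / 2)) • (h.weylOp * signOp V * parity) := by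
  have hPw := h.parity_commute_weylOp.eq
  have hPs := (signOp_commute_parity (V := V)).eq
  refine ext_of_eps (F := signOp V * h.weylOp) (fun f γ => -ins (h.J (h.exists_g_eq f).choose)
    (parity γ)) ?_ ?_ ?_
  · intro f α
    obtain hv := (h.exists_g_eq f).choose_spec
    set v := (h.exists_g_eq f).choose
    have h1 : signOp V * ins (h.J v) = ins (h.J v) * parity * signOp V := by
      have hP : ins (h.J v) * parity = -(parity * ins (h.J v)) := by rw [parity_mul_ins, neg_neg]
      rw [mul_assoc, ← hPs, ← mul_assoc, ins_mul_signOp, neg_mul, mul_assoc _ _ parity, hP, mul_neg,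
        neg_neg, ← mul_assoc, mul_assoc (signOp V), parity_mul_parity, mul_one]
    have : signOp V * h.weylOp * eps (h.g v) =
        -(ins (h.J v) * (parity * (signOp V * h.weylOp))) := by
      rw [mul_assoc, weylOp_mul_eps, mul_neg, ← mul_assoc, h1]
      simp only [mul_assoc]
    rw [hv]
    exact LinearMap.congr_fun this α
  · intro f α
    obtain hv := (h.exists_g_eq f).choose_spec
    set v := (h.exists_g_eq f).choose
    have : h.weylOp * signOp V * parity * eps (h.g v) =
        -(ins (h.J v) * (parity * (h.weylOp * signOp V * parity))) := by
      have h1 : parity * (h.weylOp * signOp V * parity) = h.weylOp * signOp V := by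
        rw [← mul_assoc, ← mul_assoc, hPw, mul_assoc h.weylOp, ← hPs, mul_assoc, mul_assoc,
          parity_mul_parity, mul_one]
      rw [h1, mul_assoc, parity_mul_eps, mul_neg, ← mul_assoc, mul_assoc h.weylOp, signOp_mul_eps,
        mul_neg, neg_mul, neg_neg, ← mul_assoc, ← mul_assoc, weylOp_mul_eps, mul_assoc _ parity,
        parity_mul_parity, mul_one, neg_mul, mul_assoc]
    have h2 : (h.weylOp * signOp V * parity : Module.End ℝ (ExtForm V)) (eps (h.g v) α) =
        -ins (h.J v) (parity ((h.weylOp * signOp V * parity : Module.End ℝ (ExtForm V)) α)) :=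
        LinearMap.congr_fun this α
    rw [LinearMap.smul_apply, LinearMap.smul_apply, map_smul, map_smul, hv, h2]
    module
  · rw [LinearMap.smul_apply, Module.End.mul_apply, Module.End.mul_apply, Module.End.mul_apply,
      parity_one, signOp_one, weylOp_one, signOp, diag_single]
    congr 1
    obtain ⟨m, hm⟩ := h.even_finrank
    rw [hm, show (m + m) / 2 = m by omega,
      show (m + m) * (m + m + 1) / 2 = 2 * (m * m) + m by
        rw [show (m + m) * (m + m + 1) = 2 * (2 * (m * m) + m) by ring]; omega,
      pow_add, pow_mul]
    simp

end HermitianSpace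

/-! ### Homogeneous forms and the order of multiplications and contractions -/

namespace ExtForm

open Module

variable {V : Type*} [AddCommGroup V] [Module ℝ V]

/-- The forms concentrated in degree `k`. -/
def homog (V : Type*) [AddCommGroup V] [Module ℝ V] (k : ℤ) : Submodule ℝ (ExtForm V) where
  carrier := {α | ∀ j : ℕ, (j : ℤ) ≠ k → α j = 0}
  add_mem' {α β} hα hβ j hj := by rw [Pi.add_apply, hα j hj, hβ j hj, add_zero]
  zero_mem' _ _ := rfl
  smul_mem' c α hα j hj := by rw [Pi.smul_apply, hα j hj, smul_zero]

theorem eq_single_of_mem_homog {k : ℕ} {α : ExtForm V} (hα : α ∈ homog V k) :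
    α = Pi.single k (α k) := by
  funext j
  by_cases hj : j = k
  · subst hj; simp
  · rw [Pi.single_eq_of_ne hj, hα j (by exact_mod_cast hj)]

theorem single_mem_homog (k : ℕ) (a : V [⋀^Fin k]→ₗ[ℝ] ℝ) :
    (Pi.single k a : ExtForm V) ∈ homog V k := fun j hj =>
  Pi.single_eq_of_ne (by exact_mod_cast hj) _

theorem eq_zero_of_mem_homog_of_neg {k : ℤ} (hk : k < 0) {α : ExtForm V} (hα : α ∈ homog V k) :
    α = 0 := by
  funext j
  exact hα j (by omega)

/-- A homogeneous form is zero or a form of some degree `k : ℕ`. -/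
theorem homog_cases {p : ℤ → ExtForm V → Prop} (hzero : ∀ k, p k 0)
    (hsingle : ∀ (k : ℕ) a, p k (Pi.single k a)) {k : ℤ} {α : ExtForm V} (hα : α ∈ homog V k) :
    p k α := by
  by_cases hk : k < 0
  · rw [eq_zero_of_mem_homog_of_neg hk hα]; exact hzero k
  · obtain ⟨n, rfl⟩ := Int.eq_ofNat_of_zero_le (not_lt.1 hk)
    rw [eq_single_of_mem_homog hα]; exact hsingle _ _

theorem parity_of_mem_homog {k : ℤ} {α : ExtForm V} (hα : α ∈ homog V k) :
    parity α = Int.negOnePow k • α := by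
  refine homog_cases (p := fun k α => parity α = Int.negOnePow k • α) (fun k => ?_)
    (fun k a => ?_) hα
  · simp
  · rw [parity, diag_single]
    rcases Nat.even_or_odd k with hk | hk
    · rw [hk.neg_one_pow, Int.negOnePow_even _ (by exact_mod_cast hk)]; simp
    · rw [hk.neg_one_pow, Int.negOnePow_odd _ (by exact_mod_cast hk), Units.neg_smul]
      simp only [one_smul]
      module

theorem ins_mem_homog (v : V) {k : ℤ} {α : ExtForm V} (hα : α ∈ homog V k) :
    ins v α ∈ homog V (k + -1) := fun j hj => by
  rw [ins_apply, hα (j + 1) (by push_cast; omega)]; rfl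

theorem wedge_mem_homog {i j : ℤ} {α β : ExtForm V} (hα : α ∈ homog V i) (hβ : β ∈ homog V j) :
    wedge α β ∈ homog V (i + j) := by
  refine homog_cases (p := fun i α => wedge α β ∈ homog V (i + j)) (fun k => ?_)
    (fun k a => ?_) hα
  · rw [map_zero]; exact Submodule.zero_mem _
  · refine homog_cases (p := fun j β => wedge (Pi.single k a) β ∈ homog V (k + j)) (fun l => ?_)
      (fun l b => ?_) hβ
    · rw [map_zero]; exact Submodule.zero_mem _
    · rw [wedge_single_single rfl]
      exact_mod_cast single_mem_homog _ _

theorem one_mem_homog : (one : ExtForm V) ∈ homog V 0 := single_mem_homog 0 _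

variable [FiniteDimensional ℝ V]

theorem wedge_comm_of_mem_homog {i j : ℤ} {α β : ExtForm V} (hα : α ∈ homog V i)
    (hβ : β ∈ homog V j) : wedge α β = Int.negOnePow (i * j) • wedge β α := by
  have hpow : ∀ (n : ℕ), (parity ^ n) α = Int.negOnePow (i * n) • α := by
    intro n
    induction n with
    | zero => simp
    | succ n ih =>
      rw [pow_succ', Module.End.mul_apply, ih]
      have : parity (Int.negOnePow (i * n) • α) = Int.negOnePow (i * n) • parity α := by
        rcases Int.units_eq_one_or (Int.negOnePow (i * n)) with h | h <;> rw [h] <;> simp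
      rw [this, parity_of_mem_homog hα, smul_smul, ← Int.negOnePow_add]
      congr 2
      push_cast
      ring
  refine homog_cases (p := fun j β => wedge α β = Int.negOnePow (i * j) • wedge β α)
    (fun l => ?_) (fun l b => ?_) hβ
  · simp
  · rw [wedge_comm_single, hpow]
    rcases Int.units_eq_one_or (Int.negOnePow (i * l)) with h | h <;> rw [h] <;> simp

theorem wedge_hasOrderLE {k : ℤ} {α : ExtForm V} (hα : α ∈ homog V k) :
    BV.HasOrderLE (homog V) wedge 0 k (wedge α) := by
  refine ⟨fun j β hβ => ?_, fun j β hβ => LinearMap.ext fun γ => ?_⟩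
  · rw [add_comm]; exact wedge_mem_homog hα hβ
  · have h1 := wedge_comm_of_mem_homog hβ hα
    change wedge β (wedge α γ) - Int.negOnePow (j * k) • wedge α (wedge β γ) = 0
    rw [← wedge_assoc, ← wedge_assoc, h1, sub_eq_zero]
    rcases Int.units_eq_one_or (Int.negOnePow (j * k)) with h | h <;> rw [h] <;> simp

/-- Contraction is an antiderivation, so its graded commutator with multiplication by α is, up to
sign, multiplication by ι_v α. -/
theorem ins_hasOrderLE (v : V) : BV.HasOrderLE (homog V) wedge 1 (-1) (ins v) := by
  refine ⟨fun j β hβ => ins_mem_homog v hβ, fun j α hα => ?_⟩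
  have h1 : BV.gradedComm j (-1) (wedge α) (ins v) = (-Int.negOnePow j) • wedge (ins v α) := by
    refine LinearMap.ext fun γ => ?_
    change wedge α (ins v γ) - Int.negOnePow (j * -1) • ins v (wedge α γ) =
      (-Int.negOnePow j) • wedge (ins v α) γ
    rw [ins_wedge, parity_of_mem_homog hα, mul_neg, mul_one, Int.negOnePow_neg]
    rcases Int.units_eq_one_or (Int.negOnePow j) with h | h <;> rw [h] <;> simp
  rw [h1]
  exact (wedge_hasOrderLE (ins_mem_homog v hα)).units_smul _

end ExtForm

/-! ### Metric adjoints of J-conjugated operators, and Λ as a Poisson contraction -/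

namespace HermitianSpace

open Module ExtForm

variable {V : Type*} [AddCommGroup V] [Module ℝ V] (h : HermitianSpace V)

theorem weight_lie_wedge_single (j : ℕ) (a : V [⋀^Fin j]→ₗ[ℝ] ℝ) :
    ⁅weight V, wedge (Pi.single j a)⁆ = (j : ℝ) • wedge (Pi.single j a : ExtForm V) := by
  rw [Ring.lie_def, weight, diag_mul_wedge_single, ← mul_sub, ← diag_sub]
  have : (fun k : ℕ => ((k + j : ℕ) : ℝ) - finrank ℝ V / 2 - ((k : ℝ) - finrank ℝ V / 2)) =
      fun _ => (j : ℝ) := by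
    funext k; push_cast; ring
  rw [this, diag_const, mul_smul_comm, mul_one]

variable [FiniteDimensional ℝ V]

theorem Lam_hasOrderLE : BV.HasOrderLE (homog V) wedge 2 (-2) h.Lam := by
  rw [Lam_eq]
  refine BV.HasOrderLE.smul _ (BV.HasOrderLE.sum _ fun i _ => ?_)
  exact (ins_hasOrderLE (h.J (h.onb i))).comp (ins_hasOrderLE (h.onb i))

theorem L_lie_wedge (α : ExtForm V) : ⁅h.L, wedge α⁆ = 0 := by
  rw [Ring.lie_def, sub_eq_zero]
  refine LinearMap.ext fun β => ?_
  have h1 := wedge_comm_single 2 h.fundamentalForm α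
  rw [pow_two, parity_mul_parity] at h1
  change wedge h.omega (wedge α β) = wedge α (wedge h.omega β)
  rw [← wedge_assoc, ← wedge_assoc, omega, h1]
  rfl

/-- The adjoint of the `J`-conjugate of the multiplication with a three-form. -/
theorem adjoint_conj_wedge_three (a : V [⋀^Fin 3]→ₗ[ℝ] ℝ) :
    h.adjoint (h.JformInv * wedge (Pi.single 3 a) * h.Jform) =
      -((1 / 6 : ℝ) • ⁅h.Lam, ⁅h.Lam, ⁅h.Lam, wedge (Pi.single 3 a)⁆⁆⁆) := by
  set η : Module.End ℝ (ExtForm V) := wedge (Pi.single 3 a) with hη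
  set Y := (1 / 6 : ℝ) • ⁅h.Lam, ⁅h.Lam, ⁅h.Lam, η⁆⁆⁆ with hY
  have hw : h.weylOp * Y = η * h.weylOp :=
    (weyl_semiconjBy_of_weight_three h.L_pow_eq_zero h.Lam_pow_eq_zero h.L_lie_Lam
      h.weight_lie_Lam (h.L_lie_wedge _) (by
        have := weight_lie_wedge_single 3 a
        exact_mod_cast this)).2.eq
  have hconj : h.JformInv * η * h.Jform = wedge (h.JformInv (Pi.single 3 a)) := by
    refine LinearMap.ext fun α => ?_
    have h1 : h.JformInv (h.Jform α) = α := LinearMap.congr_fun h.JformInv_mul_Jform α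
    have h2 := pullback_wedge (-h.J) (Pi.single 3 a) (h.Jform α)
    have h3 : pullback (-h.J) (h.Jform α) = α := h1
    rw [h3] at h2
    exact h2
  obtain ⟨a', ha'⟩ : ∃ a', h.JformInv (Pi.single 3 a) = Pi.single 3 a' :=
    ⟨_, pullback_single (-h.J) 3 a⟩
  have hcomm : ∀ α : ExtForm V, wedge (Pi.single 3 a') α = wedge (parity α) (Pi.single 3 a') := by
    intro α
    have hP : (parity ^ 3 : Module.End ℝ (ExtForm V)) * parity = 1 := by
      rw [pow_succ, pow_two, parity_mul_parity, one_mul, parity_mul_parity]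
    have h' : (parity ^ 3 : Module.End ℝ (ExtForm V)) (parity α) = α := LinearMap.congr_fun hP α
    have h'' := wedge_comm_single 3 a' (parity α)
    rw [h'] at h''
    exact h''.symm
  have hPw := h.parity_commute_weylOp.eq
  have hPs := (signOp_commute_parity (V := V)).eq
  -- The J-conjugate of η is moved through ⋆ = J w σ by means of w Y = η w. The two factors J
  -- multiply to the parity, and the signs from exchanging σ and w cancel because c² = 1.
  have key : h.JformInv * η * h.Jform * h.starOp = -(h.starOp * parity * Y) := by
    set c := (-1 : ℝ) ^ (finrank ℝ V / 2) with hc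
    have hcc : c * c = 1 := neg_one_pow_mul_self _
    have h1 : h.weylOp * signOp V * parity = c • (signOp V * h.weylOp) := by
      rw [signOp_mul_weylOp, smul_smul, hcc, one_smul]
    have h2 : h.weylOp * signOp V * parity * Y = c • (signOp V * η * h.weylOp) := by
      rw [h1, smul_mul_assoc, mul_assoc, hw, mul_assoc]
    have h3 : η * parity * h.weylOp * signOp V =
        -(parity * (h.weylOp * signOp V * parity * Y)) := by
      rw [h2, signOp_mul_wedge_three, mul_smul_comm, ← mul_assoc, ← mul_assoc, ← mul_assoc,
        parity_mul_wedge_three]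
      rw [show -(wedge (Pi.single 3 a) * parity) * signOp V * parity * h.weylOp =
        -(η * (signOp V * h.weylOp)) by
          have hsps : parity * (signOp V * (parity * h.weylOp)) = signOp V * h.weylOp := by
            rw [← mul_assoc, ← mul_assoc, ← hPs, mul_assoc (signOp V), parity_mul_parity, mul_one]
          simp only [neg_mul, mul_assoc, hsps, hη]]
      rw [smul_neg, neg_neg, ← mul_smul_comm, ← h1, mul_assoc η, hPw, mul_assoc η, mul_assoc,
        mul_assoc, hPs]
    calc h.JformInv * η * h.Jform * h.starOp
        = h.JformInv * (η * (h.Jform * h.Jform) * h.weylOp * signOp V) := by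
          rw [starOp]; simp only [mul_assoc]
      _ = h.JformInv * -(parity * (h.weylOp * signOp V * parity * Y)) := by
          rw [Jform_mul_Jform, h3]
      _ = -(h.JformInv * h.Jform * h.Jform * (h.weylOp * signOp V * parity * Y)) := by
          rw [← h.Jform_mul_Jform, mul_neg]; simp only [mul_assoc]
      _ = -(h.starOp * parity * Y) := by
          rw [JformInv_mul_Jform, one_mul, starOp]; simp only [mul_assoc]
  -- Compare the top-degree parts of (η_c α) ∧ ⋆β: the conjugated 3-form moves across α at the cost
  -- of parity, `key` moves it through the star, and the volume form cancels.
  refine h.adjoint_eq fun α β => ?_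
  have h1 := h.starOp_isHodgeStar ((h.JformInv * η * h.Jform) α) β
  have h2 := h.starOp_isHodgeStar (parity α) (-(parity (Y β)))
  have h3 : (h.JformInv * η * h.Jform) (h.starOp β) = h.starOp (-(parity (Y β))) := by
    rw [map_neg]
    exact LinearMap.congr_fun key β
  rw [hconj, ha'] at h1 h3
  rw [hcomm, wedge_assoc, h3, h2] at h1
  have h4 := smul_left_injective ℝ h.vol_ne_zero h1
  rw [hconj, ha', hcomm, ← h4, map_neg, formInner_parity, LinearMap.neg_apply, map_neg]

/-- J commutes with Λ, so the conjugate of [Λ, η] is [Λ, η_c], whose adjoint is [η_c^*, L]. With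
η_c^* = -⅙ ad_Λ³(η), the quadruplet relation [L, ad_Λ³(η)] = 3 ad_Λ²(η) gives the factor ½. -/
theorem adjoint_conj_lie_wedge_three (a : V [⋀^Fin 3]→ₗ[ℝ] ℝ) :
    h.adjoint (h.JformInv * ⁅h.Lam, wedge (Pi.single 3 a)⁆ * h.Jform) =
      (1 / 2 : ℝ) • ⁅h.Lam, ⁅h.Lam, wedge (Pi.single 3 a)⁆⁆ := by
  set η : Module.End ℝ (ExtForm V) := wedge (Pi.single 3 a) with hη
  have h0 : ⁅weight V, η⁆ = (3 : ℝ) • η := by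
    have := weight_lie_wedge_single 3 a
    exact_mod_cast this
  have hq := (lie_quadruplet h.Lam_pow_eq_zero h.L_lie_Lam h.weight_lie_Lam
    (h.L_lie_wedge (Pi.single 3 a)) h0).2.2.1
  set ηc := h.JformInv * η * h.Jform with hηc
  have hJinv : h.JformInv * h.Lam = h.Lam * h.JformInv := by
    calc h.JformInv * h.Lam = h.JformInv * h.Lam * (h.Jform * h.JformInv) := by
          rw [Jform_mul_JformInv, mul_one]
      _ = h.JformInv * (h.Jform * h.Lam) * h.JformInv := by
          rw [h.Jform_commute_Lam.eq]; simp only [mul_assoc]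
      _ = h.Lam * h.JformInv := by rw [← mul_assoc, JformInv_mul_Jform, one_mul]
  have h1 : h.JformInv * ⁅h.Lam, η⁆ * h.Jform = h.Lam * ηc - ηc * h.Lam := by
    rw [Ring.lie_def, mul_sub, sub_mul, hηc, ← mul_assoc, hJinv, mul_assoc _ h.Jform,
      h.Jform_commute_Lam.eq]
    simp only [mul_assoc]
  have hadj := h.adjoint_conj_wedge_three a
  rw [← hη, ← hηc] at hadj
  have hL : ∀ α β, h.formInner (h.Lam α) β = h.formInner α (h.L β) := by
    have hsymm : ∀ α β, h.formInner α β = h.formInner β α := fun α β => by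
      simp only [formInner_apply, mul_comm]
    intro α β
    rw [hsymm, hsymm α, formInner_adjoint, Lam]
  have hX : (1 / 2 : ℝ) • ⁅h.Lam, ⁅h.Lam, η⁆⁆ = h.adjoint ηc * h.L - h.L * h.adjoint ηc := by
    rw [← hη] at hq
    rw [hadj, neg_mul, mul_neg, sub_neg_eq_add, neg_add_eq_sub, mul_smul_comm, smul_mul_assoc,
      ← smul_sub, ← Ring.lie_def, hq, smul_smul]
    norm_num
  rw [hX]
  refine h.adjoint_eq fun α β => ?_
  rw [h1, LinearMap.sub_apply, LinearMap.sub_apply, map_sub, map_sub, LinearMap.sub_apply]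
  exact congrArg₂ (· - ·) ((hL (ηc α) β).trans (h.formInner_adjoint ηc α (h.L β)))
    ((h.formInner_adjoint ηc (h.Lam α) β).trans (hL α _))

/-- An explicit left inverse of the matrix of ω: the coordinates of ∑ J eᵢ ⊗ eᵢ, the tensor by which
Λ contracts. It depends on no relation between b and the metric. -/
theorem mul_fundamentalForm_matrix {ι : Type*} [Fintype ι] [DecidableEq ι] (b : Basis ι ℝ V) :
    (Matrix.of fun c a => ∑ i, b.repr (h.J (h.onb i)) c * b.repr (h.onb i) a) *
      (Matrix.of fun i j => h.fundamentalForm ![b i, b j]) = 1 := by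
  set W : Matrix ι ι ℝ := Matrix.of fun i j => h.fundamentalForm ![b i, b j] with hW
  set Q : Matrix ι ι ℝ := Matrix.of fun c a => ∑ i, b.repr (h.J (h.onb i)) c * b.repr (h.onb i) a
    with hQ
  ext c k
  have h1 : ∀ i, ∑ a, b.repr (h.onb i) a * h.g (h.J (b a)) (b k) =
      h.g (h.J (h.onb i)) (b k) := by
    intro i
    conv_rhs => rw [← b.sum_repr (h.onb i), map_sum, map_sum, LinearMap.sum_apply]
    simp
  have h2 : ∑ i, b.repr (h.J (h.onb i)) c * h.g (h.J (h.onb i)) (b k) = b.repr (b k) c := by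
    have h3 := h.sum_g_J_onb (-h.J (b k))
    have e : h.J (-h.J (b k)) = b k := by rw [map_neg, h.J_sq, neg_neg]
    rw [e] at h3
    conv_rhs => rw [← h3, map_sum, Finsupp.finsetSum_apply]
    refine Finset.sum_congr rfl fun i _ => ?_
    rw [map_smul, Finsupp.smul_apply, smul_eq_mul, mul_comm, h.g_J_left, h.g_symm (h.onb i),
      map_neg, LinearMap.neg_apply]
  have h4 : (Q * W) c k = ∑ i, b.repr (h.J (h.onb i)) c * h.g (h.J (h.onb i)) (b k) := by
    rw [Matrix.mul_apply]
    simp only [hQ, hW, Matrix.of_apply, Finset.sum_mul]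
    rw [Finset.sum_comm]
    refine Finset.sum_congr rfl fun i _ => ?_
    rw [← h1 i, Finset.mul_sum]
    refine Finset.sum_congr rfl fun a _ => ?_
    rw [mul_assoc]
    rfl
  rw [h4, h2, b.repr_self, Finsupp.single_apply, Matrix.one_apply]
  simp [eq_comm]

theorem det_fundamentalForm_ne_zero {ι : Type*} [Fintype ι] [DecidableEq ι] (b : Basis ι ℝ V) :
    (Matrix.of fun i j => h.fundamentalForm ![b i, b j]).det ≠ 0 := by
  have h1 := congrArg Matrix.det (h.mul_fundamentalForm_matrix b)
  rw [Matrix.det_mul, Matrix.det_one] at h1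
  exact right_ne_zero_of_mul_eq_one h1

/-- `Λ` is the contraction with the inverse of the fundamental form, in any basis. -/
theorem Lam_eq_of_basis {ι : Type*} [Fintype ι] [DecidableEq ι] (b : Basis ι ℝ V) :
    h.Lam = (1 / 2 : ℝ) • ∑ i, ∑ j, ((Matrix.of fun i j => h.fundamentalForm ![b i, b j])⁻¹ j i) •
      (ins (b j) * ins (b i)) := by
  set W : Matrix ι ι ℝ := Matrix.of fun i j => h.fundamentalForm ![b i, b j] with hW
  set Q : Matrix ι ι ℝ := Matrix.of fun c a => ∑ i, b.repr (h.J (h.onb i)) c * b.repr (h.onb i) a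
    with hQ
  have hQW : Q * W = 1 := h.mul_fundamentalForm_matrix b
  have hinv : W⁻¹ = Q := Matrix.inv_eq_left_inv hQW
  rw [Lam_eq, hinv]
  congr 1
  have hexp : ∀ i, ins (h.J (h.onb i)) * ins (h.onb i) =
      ∑ a, ∑ c, (b.repr (h.J (h.onb i)) c * b.repr (h.onb i) a) • (ins (b c) * ins (b a)) := by
    intro i
    have e1 : ins (h.J (h.onb i)) = ∑ c, b.repr (h.J (h.onb i)) c • ins (b c) := by
      conv_lhs => rw [← b.sum_repr (h.J (h.onb i)), ← insₗ_apply, map_sum]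
      simp [insₗ_apply]
    have e2 : ins (h.onb i) = ∑ a, b.repr (h.onb i) a • ins (b a) := by
      conv_lhs => rw [← b.sum_repr (h.onb i), ← insₗ_apply, map_sum]
      simp [insₗ_apply]
    rw [e1, e2, Finset.sum_mul_sum, Finset.sum_comm]
    refine Finset.sum_congr rfl fun a _ => Finset.sum_congr rfl fun c _ => ?_
    rw [smul_mul_smul_comm]
  rw [Finset.sum_congr rfl fun i _ => hexp i, Finset.sum_comm]
  refine Finset.sum_congr rfl fun a _ => ?_
  rw [Finset.sum_comm]
  refine Finset.sum_congr rfl fun c _ => ?_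
  rw [hQ, Matrix.of_apply, Finset.sum_smul]

theorem Lam_eq_poissonContraction (α : ExtForm V) :
    h.Lam α = poissonContraction h.fundamentalForm α := by
  rw [h.Lam_eq_of_basis (Module.finBasis ℝ V)]
  funext k
  simp only [LinearMap.smul_apply, LinearMap.sum_apply, Pi.smul_apply, Finset.sum_apply,
    Module.End.mul_apply, poissonContraction]
  rfl

end HermitianSpace

/-! ### Exterior calculus on a vector space -/

namespace ExtForm

open Module

/-! ### Forms on V as a finite-dimensional normed space -/

section Norm

variable {V : Type*} [AddCommGroup V] [Module ℝ V] [FiniteDimensional ℝ V]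

/-- The coordinates of a form in a basis. -/
def coords : ExtForm V →ₗ[ℝ]
    ((Σ k : Fin (finrank ℝ V + 1), (Fin k → Fin (finrank ℝ V))) → ℝ) where
  toFun α p := α p.1 (Module.finBasis ℝ V ∘ p.2)
  map_add' _ _ := rfl
  map_smul' _ _ := rfl

theorem coords_injective : Function.Injective (coords (V := V)) := by
  refine (injective_iff_map_eq_zero _).2 fun α hα => ?_
  funext k
  by_cases hk : k < finrank ℝ V + 1
  · exact Basis.ext_alternating (Module.finBasis ℝ V) fun v _ => congrFun hα ⟨⟨k, hk⟩, v⟩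
  · exact eq_zero_of_finrank_lt (by omega) _

instance finiteDimensional : FiniteDimensional ℝ (ExtForm V) :=
  FiniteDimensional.of_injective coords coords_injective

/-- A norm on the finite-dimensional space of forms. -/
@[reducible] def normedAddCommGroup : NormedAddCommGroup (ExtForm V) :=
  NormedAddCommGroup.induced _ _ (coords (V := V)) coords_injective

attribute [local instance] normedAddCommGroup

/-- A normed space structure on the finite-dimensional space of forms. -/
@[reducible] def normedSpace : NormedSpace ℝ (ExtForm V) :=
  NormedSpace.induced ℝ (ExtForm V) _ (coords (V := V))

end Norm

attribute [local instance] normedAddCommGroup normedSpace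

variable {V : Type*} [AddCommGroup V] [Module ℝ V] [FiniteDimensional ℝ V]
variable {F : Type*} [NormedAddCommGroup F] [NormedSpace ℝ F]

/-- Evaluation of the component of degree `k` of forms. -/
def evalₗ (k : ℕ) (v : Fin k → V) : ExtForm V →ₗ[ℝ] ℝ where
  toFun α := α k v
  map_add' _ _ := rfl
  map_smul' _ _ := rfl

theorem contDiff_linearMap {W₁ W₂ : Type*} [NormedAddCommGroup W₁] [NormedSpace ℝ W₁]
    [FiniteDimensional ℝ W₁] [NormedAddCommGroup W₂] [NormedSpace ℝ W₂] (T : W₁ →ₗ[ℝ] W₂) :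
    ContDiff ℝ ∞ T := (LinearMap.toContinuousLinearMap T).contDiff

/-- Compose with a linear left inverse of T, smooth because its source is finite-dimensional. -/
theorem contDiffOn_of_injective {W₁ W₂ : Type*} [NormedAddCommGroup W₁] [NormedSpace ℝ W₁]
    [NormedAddCommGroup W₂] [NormedSpace ℝ W₂] [FiniteDimensional ℝ W₂] {T : W₁ →ₗ[ℝ] W₂}
    (hT : Function.Injective T) {f : F → W₁} {s : Set F}
    (hf : ContDiffOn ℝ ∞ (fun y => T (f y)) s) : ContDiffOn ℝ ∞ f s := by
  obtain ⟨R, hR⟩ := T.exists_leftInverse_of_injective (LinearMap.ker_eq_bot.2 hT)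
  have h := (contDiff_linearMap R).comp_contDiffOn hf
  refine h.congr fun y _ => ?_
  exact (LinearMap.congr_fun hR (f y)).symm

theorem contDiffOn_iff {f : F → ExtForm V} {s : Set F} :
    ContDiffOn ℝ ∞ f s ↔ ∀ (k : ℕ) (v : Fin k → V), ContDiffOn ℝ ∞ (fun y => f y k v) s := by
  refine ⟨fun hf k v => ?_, fun hf => contDiffOn_of_injective coords_injective
    (contDiffOn_pi.2 fun p => hf _ _)⟩
  exact (contDiff_linearMap (evalₗ k v)).comp_contDiffOn hf

theorem contDiffOn_linear (T : ExtForm V →ₗ[ℝ] ExtForm V) {f : F → ExtForm V} {s : Set F}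
    (hf : ContDiffOn ℝ ∞ f s) : ContDiffOn ℝ ∞ (fun y => T (f y)) s :=
  (contDiff_linearMap T).comp_contDiffOn hf

/-- The wedge product as a continuous bilinear map. -/
def wedgeL (V : Type*) [AddCommGroup V] [Module ℝ V] [FiniteDimensional ℝ V] :
    ExtForm V →L[ℝ] ExtForm V →L[ℝ] ExtForm V :=
  LinearMap.toContinuousLinearMap
    ((LinearMap.toContinuousLinearMap (𝕜 := ℝ) (E := ExtForm V) (F' := ExtForm V)).toLinearMap ∘ₗ
      wedge)

theorem wedgeL_apply (α β : ExtForm V) : wedgeL V α β = wedge α β := rfl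

theorem contDiffOn_wedge {f g : F → ExtForm V} {s : Set F} (hf : ContDiffOn ℝ ∞ f s)
    (hg : ContDiffOn ℝ ∞ g s) : ContDiffOn ℝ ∞ (fun y => wedge (f y) (g y)) s :=
  ((wedgeL V).contDiff.comp_contDiffOn hf).clm_apply hg

/-- By multilinearity the pulled-back form has coefficients polynomial in the entries of A and
linear in the coefficients of f. -/
theorem contDiffOn_pullback {f : F → ExtForm V} {A : F → V →ₗ[ℝ] V} {s : Set F}
    (hf : ContDiffOn ℝ ∞ f s)
    (hA : ∀ v (ℓ : V →ₗ[ℝ] ℝ), ContDiffOn ℝ ∞ (fun y => ℓ (A y v)) s) :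
    ContDiffOn ℝ ∞ (fun y => pullback (A y) (f y)) s := by
  refine contDiffOn_iff.2 fun k v => ?_
  let b := Module.finBasis ℝ V
  have key : ∀ y, pullback (A y) (f y) k v = ∑ r : Fin k → Fin (finrank ℝ V),
      (∏ i, b.coord (r i) (A y (v i))) * f y k (fun i => b (r i)) := by
    intro y
    rw [pullback_apply, AlternatingMap.compLinearMap_apply]
    have h0 : (fun i => A y (v i)) = fun i => ∑ j, b.repr (A y (v i)) j • b j :=
      funext fun i => (b.sum_repr _).symm
    have h1 := (f y k).toMultilinearMap.map_sum (fun i j => b.repr (A y (v i)) j • b j)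
    change f y k (fun i => A y (v i)) = _
    rw [h0]
    refine h1.trans (Finset.sum_congr rfl fun r _ => ?_)
    exact (f y k).toMultilinearMap.map_smul_univ _ _
  simp only [key]
  exact ContDiffOn.sum fun r _ => (contDiffOn_prod fun i _ => hA _ _).mul
    (contDiffOn_iff.1 hf _ _)

variable {E : Type*} [NormedAddCommGroup E] [NormedSpace ℝ E] [FiniteDimensional ℝ E]

/-- The component of degree `k` of a form as a continuous alternating map. -/
def toCont (E : Type*) [NormedAddCommGroup E] [NormedSpace ℝ E] [FiniteDimensional ℝ E] (k : ℕ) :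
    ExtForm E →ₗ[ℝ] E [⋀^Fin k]→L[ℝ] ℝ where
  toFun α := toContinuousAlternating (α k)
  map_add' _ _ := rfl
  map_smul' _ _ := rfl

theorem toCont_apply (k : ℕ) (α : ExtForm E) (v : Fin k → E) : toCont E k α v = α k v := rfl

theorem contDiffOn_iff_toCont {f : F → ExtForm E} {s : Set F} :
    ContDiffOn ℝ ∞ f s ↔ ∀ k, ContDiffOn ℝ ∞ (fun y => toCont E k (f y)) s := by
  refine ⟨fun hf k => (contDiff_linearMap (toCont E k)).comp_contDiffOn hf, fun hf =>
    contDiffOn_iff.2 fun k v => ?_⟩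
  exact (ContinuousAlternatingMap.apply ℝ E ℝ v).contDiff.comp_contDiffOn (hf k)

/-- The exterior derivative of a form of mixed degree on a vector space. -/
def extDer (f : E → ExtForm E) (y : E) : ExtForm E :=
  ∑ i, eps ((Module.finBasis ℝ E).coord i) (fderiv ℝ f y (Module.finBasis ℝ E i))

theorem extDer_apply_zero (f : E → ExtForm E) (y : E) : extDer f y 0 = 0 := by
  rw [extDer, Finset.sum_apply]
  exact Finset.sum_eq_zero fun i _ => eps_apply_zero _ _

/-- Links the formula ∑ dxᵢ ∧ ∂ᵢ, convenient for mixed degrees, with `extDeriv`: expand the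
derivative in each direction v j in the basis. -/
theorem toCont_extDer {f : E → ExtForm E} {y : E} (hf : DifferentiableAt ℝ f y) (k : ℕ) :
    toCont E (k + 1) (extDer f y) = extDeriv (fun z => toCont E k (f z)) y := by
  have hk : HasFDerivAt (fun z => toCont E k (f z))
      ((LinearMap.toContinuousLinearMap (toCont E k)).comp (fderiv ℝ f y)) y :=
    (LinearMap.toContinuousLinearMap (toCont E k)).hasFDerivAt.comp y hf.hasFDerivAt
  ext v
  rw [extDeriv, hk.fderiv, ContinuousAlternatingMap.alternatizeUncurryFin_apply]
  change evalₗ (k + 1) v (extDer f y) = _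
  rw [extDer, map_sum]
  simp only [evalₗ, LinearMap.coe_mk, AddHom.coe_mk, eps_apply_succ_apply]
  rw [Finset.sum_comm]
  refine Finset.sum_congr rfl fun j _ => ?_
  have : fderiv ℝ f y (v j) = ∑ i, (Module.finBasis ℝ E).coord i (v j) •
      fderiv ℝ f y (Module.finBasis ℝ E i) := by
    conv_lhs => rw [← (Module.finBasis ℝ E).sum_repr (v j), map_sum]
    simp
  change _ = (-1) ^ (j : ℕ) • (evalₗ k (j.removeNth v) (fderiv ℝ f y (v j)))
  rw [this, map_sum, Finset.smul_sum]
  refine Finset.sum_congr rfl fun i _ => ?_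
  rw [map_smul]
  simp [evalₗ]

theorem toCont_ext {α β : ExtForm E} (h0 : α 0 = β 0)
    (h : ∀ k, toCont E (k + 1) α = toCont E (k + 1) β) : α = β := by
  funext k
  cases k with
  | zero => exact h0
  | succ k =>
    ext v
    exact congrArg (fun a => a v) (h k)

theorem Filter.EventuallyEq.extDer_eq {f g : E → ExtForm E} {y : E} (h : f =ᶠ[nhds y] g) :
    extDer f y = extDer g y := by
  rw [extDer, extDer, h.fderiv_eq]

theorem contDiffOn_extDer {f : E → ExtForm E} {s : Set E} (hs : IsOpen s)
    (hf : ContDiffOn ℝ ∞ f s) : ContDiffOn ℝ ∞ (extDer f) s := by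
  refine ContDiffOn.sum fun i _ => contDiffOn_linear _ ?_
  exact (hf.fderiv_of_isOpen hs (m := ∞) (by simp)).clm_apply contDiffOn_const

theorem extDer_extDer {f : E → ExtForm E} {y : E} {s : Set E} (hs : IsOpen s) (hy : y ∈ s)
    (hf : ContDiffOn ℝ ∞ f s) : extDer (extDer f) y = 0 := by
  have hd : ∀ {g : E → ExtForm E}, ContDiffOn ℝ ∞ g s → ∀ z ∈ s, DifferentiableAt ℝ g z :=
    fun hg z hz => (hg.contDiffAt (hs.mem_nhds hz)).differentiableAt (by simp)
  refine toCont_ext (extDer_apply_zero _ _) fun k => ?_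
  rw [toCont_extDer (hd (contDiffOn_extDer hs hf) y hy), map_zero]
  cases k with
  | zero =>
    have : (fun z => toCont E 0 (extDer f z)) = fun _ => 0 := by
      funext z; ext v; rw [toCont_apply, extDer_apply_zero]; rfl
    rw [this, extDeriv]
    simp only [fderiv_fun_const, Pi.zero_apply]
    exact map_zero (ContinuousAlternatingMap.alternatizeUncurryFinCLM ℝ E ℝ)
  | succ k =>
    have : (fun z => toCont E (k + 1) (extDer f z)) =ᶠ[nhds y]
        extDeriv (fun z => toCont E k (f z)) :=
      Filter.eventually_of_mem (hs.mem_nhds hy) fun z hz => toCont_extDer (hd hf z hz) k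
    rw [this.extDeriv_eq]
    exact extDeriv_extDeriv_apply ((contDiffOn_iff_toCont.1 hf k).contDiffAt (hs.mem_nhds hy))
      (by simpa using (WithTop.coe_le_coe.2 (le_top : (2 : ℕ∞) ≤ ⊤)))

/-- The ordinary product rule for each ∂ᵢ; in the second term the covector dxᵢ must pass f, which
produces the parity. -/
theorem extDer_wedge {f g : E → ExtForm E} {y : E} (hf : DifferentiableAt ℝ f y)
    (hg : DifferentiableAt ℝ g y) : extDer (fun z => wedge (f z) (g z)) y =
      wedge (extDer f y) (g y) + wedge (parity (f y)) (extDer g y) := by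
  have h := ((wedgeL E).hasFDerivAt_of_bilinear hf.hasFDerivAt hg.hasFDerivAt).fderiv
  have hcross : ∀ (φ : E →ₗ[ℝ] ℝ) (α β : ExtForm E), eps φ (wedge α β) =
      wedge (parity α) (eps φ β) := by
    intro φ α β
    rw [← eps_wedge, eps_eq_wedge_parity φ α, wedge_assoc]
    rfl
  simp only [wedgeL_apply] at h
  rw [extDer, extDer, extDer, h, map_sum, map_sum, LinearMap.sum_apply, ← Finset.sum_add_distrib]
  refine Finset.sum_congr rfl fun i _ => ?_
  have h2 : ((wedgeL E).precompR E (f y) (fderiv ℝ g y) +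
      (wedgeL E).precompL E (fderiv ℝ f y) (g y)) (Module.finBasis ℝ E i) =
      wedge (f y) (fderiv ℝ g y (Module.finBasis ℝ E i)) +
        wedge (fderiv ℝ f y (Module.finBasis ℝ E i)) (g y) := rfl
  rw [h2, map_add, hcross, eps_wedge, add_comm]

theorem extDer_pullback {f : E → ExtForm E} {τ : E → E} {y : E}
    (hf : DifferentiableAt ℝ f (τ y)) (hτ : ContDiffAt ℝ ∞ τ y)
    (hd : DifferentiableAt ℝ (fun z => pullback (fderiv ℝ τ z).toLinearMap (f (τ z))) y) :
    extDer (fun z => pullback (fderiv ℝ τ z).toLinearMap (f (τ z))) y =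
      pullback (fderiv ℝ τ y).toLinearMap (extDer f (τ y)) := by
  refine toCont_ext ?_ fun k => ?_
  · rw [extDer_apply_zero, pullback_apply, extDer_apply_zero]; rfl
  · rw [toCont_extDer hd]
    have h1 : DifferentiableAt ℝ (fun z => toCont E k (f z)) (τ y) :=
      (LinearMap.toContinuousLinearMap (toCont E k)).differentiableAt.comp (τ y) hf
    have h2 := extDeriv_pullback h1 hτ
      (by simpa using (WithTop.coe_le_coe.2 (le_top : (2 : ℕ∞) ≤ ⊤)))
    rw [← toCont_extDer hf] at h2
    exact h2

theorem extDer_add {f g : E → ExtForm E} {y : E} (hf : DifferentiableAt ℝ f y)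
    (hg : DifferentiableAt ℝ g y) :
    extDer (fun z => f z + g z) y = extDer f y + extDer g y := by
  rw [extDer, fderiv_fun_add hf hg, extDer, extDer, ← Finset.sum_add_distrib]
  exact Finset.sum_congr rfl fun i _ => map_add _ _ _

theorem extDer_smul {f : E → ExtForm E} {y : E} (hf : DifferentiableAt ℝ f y) (c : ℝ) :
    extDer (fun z => c • f z) y = c • extDer f y := by
  rw [extDer, fderiv_fun_const_smul hf, extDer, Finset.smul_sum]
  exact Finset.sum_congr rfl fun i _ => LinearMap.map_smul (eps _) c _

theorem fderiv_linear_apply (T : ExtForm E →ₗ[ℝ] ExtForm E) {f : E → ExtForm E} {y : E}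
    (hf : DifferentiableAt ℝ f y) (v : E) :
    fderiv ℝ (fun z => T (f z)) y v = T (fderiv ℝ f y v) := by
  have hk : HasFDerivAt (fun z => T (f z))
      ((LinearMap.toContinuousLinearMap T).comp (fderiv ℝ f y)) y :=
    (LinearMap.toContinuousLinearMap T).hasFDerivAt.comp y hf.hasFDerivAt
  rw [hk.fderiv]
  rfl

theorem extDer_linear {T T' : ExtForm E →ₗ[ℝ] ExtForm E}
    (hT : ∀ (φ : E →ₗ[ℝ] ℝ) (α : ExtForm E), eps φ (T α) = T' (eps φ α)) {f : E → ExtForm E} {y : E}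
    (hf : DifferentiableAt ℝ f y) : extDer (fun z => T (f z)) y = T' (extDer f y) := by
  unfold extDer
  simp only [fderiv_linear_apply T hf, hT]
  exact (map_sum T' _ _).symm

theorem extDer_diag {f : E → ExtForm E} {y : E} (hf : DifferentiableAt ℝ f y) (c : ℕ → ℝ) :
    extDer (fun z => diag (fun k => c (k + 1)) (f z)) y = diag c (extDer f y) := by
  have h : ∀ (φ : E →ₗ[ℝ] ℝ) (α : ExtForm E),
      eps φ (diag (fun k => c (k + 1)) α) = diag c (eps φ α) := by
    intro φ α
    have := LinearMap.congr_fun (diag_mul_eps c φ) α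
    exact this.symm
  exact extDer_linear (T := diag fun k => c (k + 1)) (T' := diag c) h hf

end ExtForm

/-! ### Local expressions of differential forms -/

section Local

set_option linter.unusedSectionVars false

open ExtForm

attribute [local instance] ExtForm.normedAddCommGroup ExtForm.normedSpace

variable {E : Type*} [NormedAddCommGroup E] [NormedSpace ℝ E] [FiniteDimensional ℝ E]
variable {M : Type*} [TopologicalSpace M] [ChartedSpace E M]

/-- The pullback of a form on `M` along a map `f : E → M`. -/
def pullForm (f : E → M) (α : RoughForm E M) (y : E) : ExtForm E :=
  pullback (mfderiv 𝓘(ℝ, E) 𝓘(ℝ, E) f y).toLinearMap (α (f y))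

theorem pullForm_congr {f g : E → M} {y : E} (h : f =ᶠ[nhds y] g) (α : RoughForm E M) :
    pullForm f α y = pullForm g α y := by
  -- The fibre depends on the base point, so the two points are generalized and identified before
  -- the forms can be compared.
  have key : ∀ (p q : M) (A B : E →L[ℝ] E), p = q → A = B →
      pullback (V := E) (W := TangentSpace 𝓘(ℝ, E) p) A.toLinearMap (α p) =
        pullback (V := E) (W := TangentSpace 𝓘(ℝ, E) q) B.toLinearMap (α q) := by
    rintro p _ A _ rfl rfl
    rfl
  exact key _ _ _ _ h.self_of_nhds h.mfderiv_eq

theorem pullForm_comp {f : E → M} {τ : E → E} {y : E} (hτ : DifferentiableAt ℝ τ y)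
    (hf : MDifferentiableAt 𝓘(ℝ, E) 𝓘(ℝ, E) f (τ y)) (α : RoughForm E M) :
    pullForm (f ∘ τ) α y = pullback (fderiv ℝ τ y).toLinearMap (pullForm f α (τ y)) := by
  have h := mfderiv_comp y hf hτ.mdifferentiableAt
  rw [mfderiv_eq_fderiv] at h
  unfold pullForm
  rw [h]
  rfl

/-- The local expression of a form in the chart around `x₀`. -/
def locForm (α : RoughForm E M) (x₀ : M) : E → ExtForm E :=
  pullForm (extChartAt 𝓘(ℝ, E) x₀).symm α

theorem locForm_apply (α : RoughForm E M) (x₀ : M) (y : E) : locForm α x₀ y =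
    pullback (mfderiv 𝓘(ℝ, E) 𝓘(ℝ, E) (extChartAt 𝓘(ℝ, E) x₀).symm y).toLinearMap
      (α ((extChartAt 𝓘(ℝ, E) x₀).symm y)) := rfl

theorem mem_smoothForms_iff {α : RoughForm E M} : α ∈ SmoothForms E M ↔
    ∀ x₀ : M, ContDiffOn ℝ ∞ (locForm α x₀) (extChartAt 𝓘(ℝ, E) x₀).target := by
  refine ⟨fun h x₀ => contDiffOn_iff_toCont.2 fun k => h k x₀, fun h k x₀ => ?_⟩
  exact contDiffOn_iff_toCont.1 (h x₀) k

theorem locForm_add (α β : RoughForm E M) (x₀ : M) :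
    locForm (α + β) x₀ = fun y => locForm α x₀ y + locForm β x₀ y := rfl

theorem locForm_smul (c : ℝ) (α : RoughForm E M) (x₀ : M) :
    locForm (c • α) x₀ = fun y => c • locForm α x₀ y := rfl

theorem locForm_wedge (α β : RoughForm E M) (x₀ : M) :
    locForm (fun x => wedge (α x) (β x)) x₀ =
      fun y => wedge (locForm α x₀ y) (locForm β x₀ y) := by
  funext y
  exact pullback_wedge _ _ _

theorem locForm_diag (c : ℕ → ℝ) (α : RoughForm E M) (x₀ : M) :
    locForm (fun x => diag c (α x)) x₀ = fun y => diag c (locForm α x₀ y) := rfl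

theorem locForm_one (x₀ : M) : locForm (fun _ : M => (one : ExtForm (TangentSpace 𝓘(ℝ, E) _))) x₀ =
    fun _ => one := by
  funext y
  exact pullback_one _

variable [IsManifold 𝓘(ℝ, E) ∞ M]

theorem mdifferentiableAt_extChartAt_symm {x₀ : M} {y : E}
    (hy : y ∈ (extChartAt 𝓘(ℝ, E) x₀).target) :
    MDifferentiableAt 𝓘(ℝ, E) 𝓘(ℝ, E) (extChartAt 𝓘(ℝ, E) x₀).symm y := by
  have h := mdifferentiableWithinAt_extChartAt_symm (I := 𝓘(ℝ, E)) hy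
  rwa [modelWithCornersSelf_coe, Set.range_id, mdifferentiableWithinAt_univ] at h

theorem coframe_comp_frame {x₀ : M} {y : E} (hy : y ∈ (extChartAt 𝓘(ℝ, E) x₀).target) (v : E) :
    mfderiv 𝓘(ℝ, E) 𝓘(ℝ, E) (extChartAt 𝓘(ℝ, E) x₀) ((extChartAt 𝓘(ℝ, E) x₀).symm y)
      (mfderiv 𝓘(ℝ, E) 𝓘(ℝ, E) (extChartAt 𝓘(ℝ, E) x₀).symm y v) = v := by
  have h := mfderiv_extChartAt_comp_mfderivWithin_extChartAt_symm (I := 𝓘(ℝ, E)) hy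
  rw [modelWithCornersSelf_coe, Set.range_id, mfderivWithin_univ] at h
  exact congrArg (fun A => A v) h

theorem frame_comp_coframe {x₀ : M} {y : E} (hy : y ∈ (extChartAt 𝓘(ℝ, E) x₀).target)
    (v : TangentSpace 𝓘(ℝ, E) ((extChartAt 𝓘(ℝ, E) x₀).symm y)) :
    mfderiv 𝓘(ℝ, E) 𝓘(ℝ, E) (extChartAt 𝓘(ℝ, E) x₀).symm y
      (mfderiv 𝓘(ℝ, E) 𝓘(ℝ, E) (extChartAt 𝓘(ℝ, E) x₀) ((extChartAt 𝓘(ℝ, E) x₀).symm y) v) =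
      v := by
  have h := mfderivWithin_extChartAt_symm_comp_mfderiv_extChartAt (I := 𝓘(ℝ, E)) hy
  rw [modelWithCornersSelf_coe, Set.range_id, mfderivWithin_univ] at h
  exact congrArg (fun A => A v) h

/-- A form is determined by its local expressions. -/
theorem ext_locForm {α β : RoughForm E M}
    (h : ∀ x₀ : M, ∀ y ∈ (extChartAt 𝓘(ℝ, E) x₀).target, locForm α x₀ y = locForm β x₀ y) :
    α = β := by
  have key : ∀ (γ : RoughForm E M) (x₀ : M), ∀ y ∈ (extChartAt 𝓘(ℝ, E) x₀).target,
      pullback (V := TangentSpace 𝓘(ℝ, E) ((extChartAt 𝓘(ℝ, E) x₀).symm y)) (W := E)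
        (mfderiv 𝓘(ℝ, E) 𝓘(ℝ, E) (extChartAt 𝓘(ℝ, E) x₀)
          ((extChartAt 𝓘(ℝ, E) x₀).symm y)).toLinearMap (locForm γ x₀ y) =
        γ ((extChartAt 𝓘(ℝ, E) x₀).symm y) := by
    intro γ x₀ y hy
    funext k
    ext v
    change γ _ k (fun i => mfderiv 𝓘(ℝ, E) 𝓘(ℝ, E) (extChartAt 𝓘(ℝ, E) x₀).symm y
      (mfderiv 𝓘(ℝ, E) 𝓘(ℝ, E) (extChartAt 𝓘(ℝ, E) x₀) _ (v i))) = γ _ k v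
    simp only [frame_comp_coframe hy]
  funext x
  have hy := mem_extChartAt_target (I := 𝓘(ℝ, E)) x
  have h1 := key α x _ hy
  rw [h x _ hy, key β x _ hy, extChartAt_to_inv] at h1
  exact h1.symm

theorem SmoothForms.differentiableAt {α : RoughForm E M} (hα : α ∈ SmoothForms E M) {x₀ : M}
    {y : E} (hy : y ∈ (extChartAt 𝓘(ℝ, E) x₀).target) : DifferentiableAt ℝ (locForm α x₀) y :=
  ((mem_smoothForms_iff.1 hα x₀).contDiffAt
    ((isOpen_extChartAt_target x₀).mem_nhds hy)).differentiableAt (by simp)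

theorem extd_eq {α : RoughForm E M} (hα : α ∈ SmoothForms E M) (x : M) :
    extd α x = pullback (V := TangentSpace 𝓘(ℝ, E) x) (W := E)
      (mfderiv 𝓘(ℝ, E) 𝓘(ℝ, E) (extChartAt 𝓘(ℝ, E) x) x).toLinearMap
        (extDer (locForm α x) (extChartAt 𝓘(ℝ, E) x x)) := by
  funext k
  cases k with
  | zero =>
    ext v
    exact (congrArg (fun a : E [⋀^Fin 0]→ₗ[ℝ] ℝ => a fun i =>
      mfderiv 𝓘(ℝ, E) 𝓘(ℝ, E) (extChartAt 𝓘(ℝ, E) x) x (v i)) (extDer_apply_zero _ _)).symm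
  | succ k =>
    have h := toCont_extDer (SmoothForms.differentiableAt hα (mem_extChartAt_target x)) k
    ext v
    exact (congrArg (fun a : E [⋀^Fin (k + 1)]→L[ℝ] ℝ => a fun i =>
      mfderiv 𝓘(ℝ, E) 𝓘(ℝ, E) (extChartAt 𝓘(ℝ, E) x) x (v i)) h).symm

/-- The exterior derivative can be computed in any chart. -/
theorem locForm_extd {α : RoughForm E M} (hα : α ∈ SmoothForms E M) {x₀ : M} {y : E}
    (hy : y ∈ (extChartAt 𝓘(ℝ, E) x₀).target) :
    locForm (extd α) x₀ y = extDer (locForm α x₀) y := by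
  set φ := extChartAt 𝓘(ℝ, E) x₀ with hφ
  set x := φ.symm y with hx
  set ψ := extChartAt 𝓘(ℝ, E) x with hψ
  set τ : E → E := ψ ∘ φ.symm with hτ
  have hsymm : ContMDiffAt 𝓘(ℝ, E) 𝓘(ℝ, E) ∞ φ.symm y :=
    (contMDiffOn_extChartAt_symm x₀).contMDiffAt ((isOpen_extChartAt_target x₀).mem_nhds hy)
  have hτs : ContDiffAt ℝ ∞ τ y :=
    contMDiffAt_iff_contDiffAt.1 ((contMDiffAt_extChartAt (x := x)).comp y hsymm)
  have hev : ∀ᶠ z in nhds y, φ.symm z ∈ ψ.source :=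
    hsymm.continuousAt (extChartAt_source_mem_nhds x)
  have hd : ∀ᶠ z in nhds y, DifferentiableAt ℝ τ z :=
    ((hτs.of_le (m := 1) (by simp)).eventually (by simp)).mono fun z hz => hz.differentiableAt (by simp)
  -- Near y the expression in the chart at x₀ is the pullback, along the transition map τ, of the
  -- expression in the chart at x. The claim is thereby reduced to naturality of the exterior
  -- derivative.
  have hloc : locForm α x₀ =ᶠ[nhds y] fun z => pullback (fderiv ℝ τ z).toLinearMap
      (locForm α x (τ z)) := by
    filter_upwards [hev, hd, hev.eventually_nhds] with z hz hdz hez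
    rw [locForm, locForm, ← pullForm_comp hdz
      (mdifferentiableAt_extChartAt_symm (ψ.map_source hz))]
    refine pullForm_congr ?_ α
    filter_upwards [hez] with w hw
    exact (ψ.left_inv hw).symm
  have hτy : τ y = ψ x := rfl
  have hdl : DifferentiableAt ℝ (locForm α x) (τ y) :=
    SmoothForms.differentiableAt hα (mem_extChartAt_target x)
  rw [Filter.EventuallyEq.extDer_eq hloc, extDer_pullback hdl hτs
    ((SmoothForms.differentiableAt hα hy).congr_of_eventuallyEq hloc.symm), locForm_apply,
    extd_eq hα]
  have hcomp : fderiv ℝ τ y = (mfderiv 𝓘(ℝ, E) 𝓘(ℝ, E) ψ x).comp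
      (mfderiv 𝓘(ℝ, E) 𝓘(ℝ, E) φ.symm y) := by
    rw [← mfderiv_eq_fderiv]
    exact mfderiv_comp y (mdifferentiableAt_extChartAt (mem_chart_source E x))
      (hsymm.mdifferentiableAt (by simp))
  rw [hcomp]
  rfl

theorem contDiffOn_locForm_extd {α : RoughForm E M} (hα : α ∈ SmoothForms E M) (x₀ : M) :
    ContDiffOn ℝ ∞ (locForm (extd α) x₀) (extChartAt 𝓘(ℝ, E) x₀).target :=
  (contDiffOn_extDer (isOpen_extChartAt_target x₀) (mem_smoothForms_iff.1 hα x₀)).congr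
    fun _ hy => locForm_extd hα hy

theorem extd_mem {α : RoughForm E M} (hα : α ∈ SmoothForms E M) : extd α ∈ SmoothForms E M :=
  mem_smoothForms_iff.2 fun x₀ => contDiffOn_locForm_extd hα x₀

theorem extd_add {α β : RoughForm E M} (hα : α ∈ SmoothForms E M) (hβ : β ∈ SmoothForms E M) :
    extd (α + β) = extd α + extd β := by
  refine ext_locForm fun x₀ y hy => ?_
  rw [locForm_extd (Submodule.add_mem _ hα hβ) hy, locForm_add, locForm_add,
    extDer_add (SmoothForms.differentiableAt hα hy) (SmoothForms.differentiableAt hβ hy)]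
  simp only [locForm_extd hα hy, locForm_extd hβ hy]

theorem extd_smul (c : ℝ) {α : RoughForm E M} (hα : α ∈ SmoothForms E M) :
    extd (c • α) = c • extd α := by
  refine ext_locForm fun x₀ y hy => ?_
  rw [locForm_extd (Submodule.smul_mem _ c hα) hy, locForm_smul, locForm_smul,
    extDer_smul (SmoothForms.differentiableAt hα hy)]
  simp only [locForm_extd hα hy]

theorem extd_extd {α : RoughForm E M} (hα : α ∈ SmoothForms E M) : extd (extd α) = 0 := by
  refine ext_locForm fun x₀ y hy => ?_
  have hopen := isOpen_extChartAt_target (I := 𝓘(ℝ, E)) x₀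
  have : locForm (extd α) x₀ =ᶠ[nhds y] extDer (locForm α x₀) :=
    Filter.eventually_of_mem (hopen.mem_nhds hy) fun z hz => locForm_extd hα hz
  rw [locForm_extd (extd_mem hα) hy, Filter.EventuallyEq.extDer_eq this,
    extDer_extDer hopen hy (mem_smoothForms_iff.1 hα x₀)]
  rfl

theorem wedge_mem {α β : RoughForm E M} (hα : α ∈ SmoothForms E M) (hβ : β ∈ SmoothForms E M) :
    (fun x => wedge (α x) (β x)) ∈ SmoothForms E M := mem_smoothForms_iff.2 fun x₀ => by
  rw [locForm_wedge]
  exact contDiffOn_wedge (mem_smoothForms_iff.1 hα x₀) (mem_smoothForms_iff.1 hβ x₀)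

theorem diag_mem (c : ℕ → ℝ) {α : RoughForm E M} (hα : α ∈ SmoothForms E M) :
    (fun x => diag c (α x)) ∈ SmoothForms E M := mem_smoothForms_iff.2 fun x₀ => by
  rw [locForm_diag]
  exact contDiffOn_linear _ (mem_smoothForms_iff.1 hα x₀)

theorem one_mem : (fun _ => one) ∈ SmoothForms E M := mem_smoothForms_iff.2 fun x₀ => by
  rw [locForm_one]
  exact contDiffOn_const

/-- The Leibniz rule. -/
theorem extd_wedge {α β : RoughForm E M} (hα : α ∈ SmoothForms E M) (hβ : β ∈ SmoothForms E M) :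
    extd (fun x => wedge (α x) (β x)) =
      (fun x => wedge (extd α x) (β x)) + fun x => wedge (parity (α x)) (extd β x) := by
  refine ext_locForm fun x₀ y hy => ?_
  rw [locForm_extd (wedge_mem hα hβ) hy, locForm_add, locForm_wedge, locForm_wedge, locForm_wedge,
    extDer_wedge (SmoothForms.differentiableAt hα hy) (SmoothForms.differentiableAt hβ hy)]
  simp only [locForm_extd hα hy, locForm_extd hβ hy]
  rfl

theorem extd_diag (c : ℕ → ℝ) {α : RoughForm E M} (hα : α ∈ SmoothForms E M) :
    extd (fun x => diag (fun k => c (k + 1)) (α x)) = fun x => diag c (extd α x) := by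
  refine ext_locForm fun x₀ y hy => ?_
  rw [locForm_extd (diag_mem _ hα) hy, locForm_diag, locForm_diag,
    extDer_diag (SmoothForms.differentiableAt hα hy)]
  simp only [locForm_extd hα hy]

end Local

/-! ### Smoothness of the operators of an almost Hermitian structure -/

section HermitianLocal

open ExtForm Bundle

set_option linter.unusedSectionVars false

attribute [local instance] ExtForm.normedAddCommGroup ExtForm.normedSpace

variable {E : Type*} [NormedAddCommGroup E] [NormedSpace ℝ E] [FiniteDimensional ℝ E]
variable {M : Type*} [TopologicalSpace M] [ChartedSpace E M] [IsManifold 𝓘(ℝ, E) ∞ M]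

/-- The derivative of the inverse of the chart around `x₀`. -/
def frame (x₀ : M) (y : E) : E →L[ℝ] TangentSpace 𝓘(ℝ, E) ((extChartAt 𝓘(ℝ, E) x₀).symm y) :=
  mfderiv 𝓘(ℝ, E) 𝓘(ℝ, E) (extChartAt 𝓘(ℝ, E) x₀).symm y

/-- The derivative of the chart around `x₀`. -/
def coframe (x₀ x : M) : TangentSpace 𝓘(ℝ, E) x →L[ℝ] E :=
  mfderiv 𝓘(ℝ, E) 𝓘(ℝ, E) (extChartAt 𝓘(ℝ, E) x₀) x

theorem trivializationAt_snd {x₀ x : M} (hx : x ∈ (chartAt E x₀).source)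
    (v : TangentSpace 𝓘(ℝ, E) x) :
    (trivializationAt E (TangentSpace 𝓘(ℝ, E)) x₀ ⟨x, v⟩).2 = coframe x₀ x v := by
  have h := TangentBundle.continuousLinearMapAt_trivializationAt (I := 𝓘(ℝ, E)) hx
  have hb : x ∈ (trivializationAt E (TangentSpace 𝓘(ℝ, E)) x₀).baseSet := hx
  have h1 := congrArg (fun A => A v) h
  simp only [Trivialization.continuousLinearMapAt_apply] at h1
  rw [Trivialization.linearMapAt_apply, if_pos hb] at h1
  exact h1

/-- The trivialization of the tangent bundle at x₀ is the derivative of the chart, so smoothness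
into the total space is smoothness of the chart components. -/
theorem contMDiffOn_vectorField_iff (x₀ : M)
    (X : ∀ y : E, TangentSpace 𝓘(ℝ, E) ((extChartAt 𝓘(ℝ, E) x₀).symm y)) :
    ContMDiffOn 𝓘(ℝ, E) (𝓘(ℝ, E).prod 𝓘(ℝ, E)) ∞
      (fun y => TotalSpace.mk' E (E := fun x : M => TangentSpace 𝓘(ℝ, E) x)
        ((extChartAt 𝓘(ℝ, E) x₀).symm y) (X y)) (extChartAt 𝓘(ℝ, E) x₀).target ↔
    ContDiffOn ℝ ∞ (fun y => coframe x₀ ((extChartAt 𝓘(ℝ, E) x₀).symm y) (X y))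
      (extChartAt 𝓘(ℝ, E) x₀).target := by
  have hsrc : ∀ y ∈ (extChartAt 𝓘(ℝ, E) x₀).target,
      (extChartAt 𝓘(ℝ, E) x₀).symm y ∈ (chartAt E x₀).source := fun y hy => by
    have := (extChartAt 𝓘(ℝ, E) x₀).map_target hy
    rwa [extChartAt_source] at this
  rw [(trivializationAt E (fun x : M => TangentSpace 𝓘(ℝ, E) x) x₀).contMDiffOn_iff
    (fun y hy => by
      rw [Trivialization.mem_source]
      exact hsrc y hy), ← contMDiffOn_iff_contDiffOn]
  have h1 : ContMDiffOn 𝓘(ℝ, E) 𝓘(ℝ, E) ∞ (extChartAt 𝓘(ℝ, E) x₀).symm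
    (extChartAt 𝓘(ℝ, E) x₀).target := contMDiffOn_extChartAt_symm x₀
  refine ⟨fun h => h.2.congr fun y hy => (trivializationAt_snd (hsrc y hy) _).symm, fun h =>
    ⟨h1, h.congr fun y hy => trivializationAt_snd (hsrc y hy) _⟩⟩

theorem contMDiffOn_frame (x₀ : M) (v : E) : ContMDiffOn 𝓘(ℝ, E) (𝓘(ℝ, E).prod 𝓘(ℝ, E)) ∞
      (fun y => TotalSpace.mk' E (E := fun x : M => TangentSpace 𝓘(ℝ, E) x)
        ((extChartAt 𝓘(ℝ, E) x₀).symm y) (frame x₀ y v)) (extChartAt 𝓘(ℝ, E) x₀).target := by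
  rw [contMDiffOn_vectorField_iff]
  exact contDiffOn_const.congr fun y hy => coframe_comp_frame hy v

namespace AlmostHermitianStructure

variable (S : AlmostHermitianStructure E M)

theorem contMDiffOn_J_frame (x₀ : M) (v : E) :
    ContMDiffOn 𝓘(ℝ, E) (𝓘(ℝ, E).prod 𝓘(ℝ, E)) ∞
      (fun y => TotalSpace.mk' E (E := fun x : M => TangentSpace 𝓘(ℝ, E) x)
        ((extChartAt 𝓘(ℝ, E) x₀).symm y) (S.J _ (frame x₀ y v)))
      (extChartAt 𝓘(ℝ, E) x₀).target := by
  refine ContMDiffOn.clm_bundle_apply (F₁ := E) (F₂ := E) ?_ (contMDiffOn_frame x₀ v)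
  exact S.J_smooth.comp_contMDiffOn (contMDiffOn_extChartAt_symm x₀)

theorem contDiffOn_inner (x₀ : M)
    {X Y : ∀ y : E, TangentSpace 𝓘(ℝ, E) ((extChartAt 𝓘(ℝ, E) x₀).symm y)}
    (hX : ContMDiffOn 𝓘(ℝ, E) (𝓘(ℝ, E).prod 𝓘(ℝ, E)) ∞
      (fun y => TotalSpace.mk' E (E := fun x : M => TangentSpace 𝓘(ℝ, E) x)
        ((extChartAt 𝓘(ℝ, E) x₀).symm y) (X y)) (extChartAt 𝓘(ℝ, E) x₀).target)
    (hY : ContMDiffOn 𝓘(ℝ, E) (𝓘(ℝ, E).prod 𝓘(ℝ, E)) ∞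
      (fun y => TotalSpace.mk' E (E := fun x : M => TangentSpace 𝓘(ℝ, E) x)
        ((extChartAt 𝓘(ℝ, E) x₀).symm y) (Y y)) (extChartAt 𝓘(ℝ, E) x₀).target) :
    ContDiffOn ℝ ∞ (fun y => S.metric.inner ((extChartAt 𝓘(ℝ, E) x₀).symm y) (X y) (Y y))
      (extChartAt 𝓘(ℝ, E) x₀).target := by
  have hg := S.metric.contMDiff.comp_contMDiffOn (contMDiffOn_extChartAt_symm (n := ∞) x₀)
  have h : ContMDiffOn 𝓘(ℝ, E) (𝓘(ℝ, E).prod 𝓘(ℝ)) ∞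
      (fun y => TotalSpace.mk' ℝ (E := Bundle.Trivial M ℝ) ((extChartAt 𝓘(ℝ, E) x₀).symm y)
        (S.metric.inner ((extChartAt 𝓘(ℝ, E) x₀).symm y) (X y) (Y y)))
      (extChartAt 𝓘(ℝ, E) x₀).target :=
    ContMDiffOn.clm_bundle_apply₂ (F₁ := E) (F₂ := E) hg hX hY
  rw [← contMDiffOn_iff_contDiffOn]
  intro y hy
  have := h y hy
  simp only [contMDiffWithinAt_totalSpace] at this
  exact this.2

theorem omega_mem : S.omega ∈ SmoothForms E M := mem_smoothForms_iff.2 fun x₀ => by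
  refine contDiffOn_iff.2 fun k v => ?_
  by_cases hk : k = 2
  · subst hk
    have h : ∀ y, locForm S.omega x₀ y 2 v =
        S.metric.inner _ (S.J _ (frame x₀ y (v 0))) (frame x₀ y (v 1)) := by
      intro y
      have h1 : S.omega ((extChartAt 𝓘(ℝ, E) x₀).symm y) 2 = (S.herm _).fundamentalForm := by
        rw [AlmostHermitianStructure.omega, HermitianSpace.omega, Pi.single_eq_same]
      exact congrArg (fun a => a fun i => frame x₀ y (v i)) h1
    simp only [h]
    exact S.contDiffOn_inner x₀ (S.contMDiffOn_J_frame x₀ _) (contMDiffOn_frame x₀ _)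
  · have h : ∀ y, locForm S.omega x₀ y k v = 0 := by
      intro y
      change (Pi.single 2 (S.herm _).fundamentalForm : ExtForm _) k _ = _
      rw [Pi.single_eq_of_ne hk]
      rfl
    simp only [h]
    exact contDiffOn_const

/-- The expression of `J` in the chart around `x₀`. -/
def locJ (x₀ : M) (y : E) : E →ₗ[ℝ] E :=
  (coframe x₀ ((extChartAt 𝓘(ℝ, E) x₀).symm y) ∘L (S.J _) ∘L frame x₀ y).toLinearMap

theorem contDiffOn_locJ (x₀ : M) (v : E) :
    ContDiffOn ℝ ∞ (fun y => S.locJ x₀ y v) (extChartAt 𝓘(ℝ, E) x₀).target :=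
  (contMDiffOn_vectorField_iff x₀ _).1 (S.contMDiffOn_J_frame x₀ v)

theorem frame_locJ {x₀ : M} {y : E} (hy : y ∈ (extChartAt 𝓘(ℝ, E) x₀).target) (v : E) :
    frame x₀ y (S.locJ x₀ y v) = S.J _ (frame x₀ y v) := frame_comp_coframe hy _

theorem Jform_mem {α : RoughForm E M} (hα : α ∈ SmoothForms E M) :
    (fun x => (S.herm x).Jform (α x)) ∈ SmoothForms E M := mem_smoothForms_iff.2 fun x₀ => by
  have h := contDiffOn_pullback (A := S.locJ x₀) (mem_smoothForms_iff.1 hα x₀)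
    fun v ℓ => (LinearMap.toContinuousLinearMap ℓ).contDiff.comp_contDiffOn
      (S.contDiffOn_locJ x₀ v)
  refine h.congr fun y hy => ?_
  funext k
  ext v
  change α _ k (fun i => S.J _ (frame x₀ y (v i))) =
    α _ k (fun i => frame x₀ y (S.locJ x₀ y (v i)))
  simp only [S.frame_locJ hy]

theorem parity_mem {α : RoughForm E M} (hα : α ∈ SmoothForms E M) :
    (fun x => parity (α x)) ∈ SmoothForms E M := diag_mem _ hα

/-- On forms J² is the parity, so J⁻¹ is J composed with parity, both of which preserve smoothness.
-/
theorem JformInv_mem {α : RoughForm E M} (hα : α ∈ SmoothForms E M) :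
    (fun x => (S.herm x).JformInv (α x)) ∈ SmoothForms E M := by
  have h : (fun x => (S.herm x).JformInv (α x)) = fun x => (S.herm x).Jform (parity (α x)) := by
    funext x
    have h1 := LinearMap.congr_fun (S.herm x).JformInv_mul_Jform ((S.herm x).Jform (parity (α x)))
    have h2 : (S.herm x).Jform ((S.herm x).Jform (parity (α x))) = α x := by
      have h3 := LinearMap.congr_fun (S.herm x).Jform_mul_Jform (parity (α x))
      have h4 := LinearMap.congr_fun (parity_mul_parity (V := TangentSpace 𝓘(ℝ, E) x)) (α x)
      exact h3.trans h4
    change (S.herm x).JformInv ((S.herm x).Jform ((S.herm x).Jform (parity (α x)))) = _ at h1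
    rw [h2] at h1
    exact h1
  rw [h]
  exact S.Jform_mem (parity_mem hα)

end AlmostHermitianStructure

theorem contDiffOn_matrix_det {F ι : Type*} [NormedAddCommGroup F] [NormedSpace ℝ F] [Fintype ι]
    [DecidableEq ι] {A : F → Matrix ι ι ℝ} {s : Set F}
    (hA : ∀ i j, ContDiffOn ℝ ∞ (fun y => A y i j) s) :
    ContDiffOn ℝ ∞ (fun y => (A y).det) s := by
  simp only [Matrix.det_apply]
  exact ContDiffOn.sum fun σ _ => (contDiffOn_prod fun i _ => hA _ _).const_smul _

/-- Cramer's rule: the entries are quotients of determinants. -/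
theorem contDiffOn_matrix_inv {F ι : Type*} [NormedAddCommGroup F] [NormedSpace ℝ F] [Fintype ι]
    [DecidableEq ι] {A : F → Matrix ι ι ℝ} {s : Set F}
    (hA : ∀ i j, ContDiffOn ℝ ∞ (fun y => A y i j) s) (h0 : ∀ y ∈ s, (A y).det ≠ 0) (i j : ι) :
    ContDiffOn ℝ ∞ (fun y => (A y)⁻¹ i j) s := by
  simp only [Matrix.inv_def, Ring.inverse_eq_inv', Matrix.smul_apply, smul_eq_mul,
    Matrix.adjugate_apply]
  refine ((contDiffOn_matrix_det hA).inv h0).mul (contDiffOn_matrix_det fun k l => ?_)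
  by_cases hk : k = j
  · subst hk
    simp only [Matrix.updateRow_self]
    exact contDiffOn_const
  · simp only [Matrix.updateRow_ne hk]
    exact hA k l

namespace AlmostHermitianStructure

variable (S : AlmostHermitianStructure E M)

/-- The orthonormal bases used to define Λ are chosen pointwise, with no smooth dependence on the
point. In the coordinate frame, however, Λ is contraction with the inverse matrix of ω
(`Lam_eq_of_basis`), whose entries are smooth. -/
theorem Lam_mem {α : RoughForm E M} (hα : α ∈ SmoothForms E M) :
    S.Lam α ∈ SmoothForms E M := mem_smoothForms_iff.2 fun x₀ => by
  let b := Module.finBasis ℝ E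
  let W : E → Matrix (Fin (Module.finrank ℝ E)) (Fin (Module.finrank ℝ E)) ℝ := fun y =>
    Matrix.of fun i j => locForm S.omega x₀ y 2 ![b i, b j]
  have hbasis : ∀ y ∈ (extChartAt 𝓘(ℝ, E) x₀).target,
      ∃ b' : Module.Basis (Fin (Module.finrank ℝ E)) ℝ
        (TangentSpace 𝓘(ℝ, E) ((extChartAt 𝓘(ℝ, E) x₀).symm y)), ∀ i, b' i = frame x₀ y (b i) := by
    intro y hy
    let e : E ≃ₗ[ℝ] TangentSpace 𝓘(ℝ, E) ((extChartAt 𝓘(ℝ, E) x₀).symm y) :=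
      LinearEquiv.ofLinearMap (frame x₀ y).toLinearMap (coframe x₀ _).toLinearMap
        (LinearMap.ext fun v => frame_comp_coframe hy v)
        (LinearMap.ext fun v => coframe_comp_frame hy v)
    exact ⟨b.map e, fun i => rfl⟩
  have hW : ∀ y (b' : Module.Basis (Fin (Module.finrank ℝ E)) ℝ
        (TangentSpace 𝓘(ℝ, E) ((extChartAt 𝓘(ℝ, E) x₀).symm y))),
      (∀ i, b' i = frame x₀ y (b i)) →
      (Matrix.of fun i j => (S.herm _).fundamentalForm ![b' i, b' j]) = W y := by
    intro y b' hb'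
    ext i j
    change (S.herm _).fundamentalForm ![b' i, b' j] =
      (Pi.single 2 (S.herm _).fundamentalForm : ExtForm _) 2 (fun l => frame x₀ y (![b i, b j] l))
    rw [Pi.single_eq_same, hb', hb']
    congr 1
    funext l
    fin_cases l <;> rfl
  have hdet : ∀ y ∈ (extChartAt 𝓘(ℝ, E) x₀).target, (W y).det ≠ 0 := by
    intro y hy
    obtain ⟨b', hb'⟩ := hbasis y hy
    rw [← hW y b' hb']
    exact (S.herm _).det_fundamentalForm_ne_zero b'
  have hWs : ∀ i j, ContDiffOn ℝ ∞ (fun y => W y i j) (extChartAt 𝓘(ℝ, E) x₀).target :=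
    fun i j => contDiffOn_iff.1 (mem_smoothForms_iff.1 S.omega_mem x₀) 2 _
  have hα' := mem_smoothForms_iff.1 hα x₀
  have hmain : ContDiffOn ℝ ∞ (fun y => (1 / 2 : ℝ) • ∑ i, ∑ j, ((W y)⁻¹ j i) •
      (ins (b j) (ins (b i) (locForm α x₀ y)))) (extChartAt 𝓘(ℝ, E) x₀).target :=
    (ContDiffOn.sum fun i _ => ContDiffOn.sum fun j _ =>
      (contDiffOn_matrix_inv hWs hdet j i).smul
        (contDiffOn_linear _ (contDiffOn_linear _ hα'))).const_smul _
  refine hmain.congr fun y hy => ?_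
  obtain ⟨b', hb'⟩ := hbasis y hy
  have hLam := (S.herm ((extChartAt 𝓘(ℝ, E) x₀).symm y)).Lam_eq_of_basis b'
  rw [hW y b' hb'] at hLam
  have hLα : S.Lam α ((extChartAt 𝓘(ℝ, E) x₀).symm y) = (1 / 2 : ℝ) • ∑ i, ∑ j, ((W y)⁻¹ j i) •
      (ins (frame x₀ y (b j)) (ins (frame x₀ y (b i)) (α ((extChartAt 𝓘(ℝ, E) x₀).symm y)))) := by
    change (S.herm _).Lam _ = _
    rw [hLam]
    simp only [LinearMap.smul_apply, LinearMap.sum_apply, Module.End.mul_apply, hb']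
  change pullback (frame x₀ y).toLinearMap (S.Lam α _) = _
  rw [hLα, map_smul, map_sum]
  congr 1
  refine Finset.sum_congr rfl fun i _ => ?_
  rw [map_sum]
  refine Finset.sum_congr rfl fun j _ => ?_
  rw [map_smul]
  have h1 := pullback_ins (frame x₀ y).toLinearMap (b j)
    (ins (frame x₀ y (b i)) (α ((extChartAt 𝓘(ℝ, E) x₀).symm y)))
  have h2 := pullback_ins (frame x₀ y).toLinearMap (b i) (α ((extChartAt 𝓘(ℝ, E) x₀).symm y))
  congr 1
  refine h1.trans (congrArg _ h2)

end AlmostHermitianStructure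

end HermitianLocal

/-! ### The de Rham algebra -/

section DeRham

open ExtForm

set_option linter.unusedSectionVars false

variable {E : Type*} [NormedAddCommGroup E] [NormedSpace ℝ E] [FiniteDimensional ℝ E]
variable {M : Type*} [TopologicalSpace M] [ChartedSpace E M]

theorem DeRham.ext {a b : DeRham E M} (h : ∀ x, a.form x = b.form x) : a = b :=
  Subtype.ext (funext h)

theorem DeRham.form_add (a b : DeRham E M) (x : M) : (a + b).form x = a.form x + b.form x := rfl

theorem DeRham.form_sub (a b : DeRham E M) (x : M) : (a - b).form x = a.form x - b.form x := rfl

theorem DeRham.form_neg (a : DeRham E M) (x : M) : (-a).form x = -a.form x := rfl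

theorem DeRham.form_smul (c : ℝ) (a : DeRham E M) (x : M) : (c • a).form x = c • a.form x := rfl

theorem DeRham.form_units_smul (u : ℤˣ) (a : DeRham E M) (x : M) :
    (u • a).form x = u • a.form x := by
  rcases Int.units_eq_one_or u with h | h <;> subst h
  · simp
  · rw [Units.neg_smul, Units.neg_smul, one_smul, one_smul, DeRham.form_neg]

theorem mem_formGrading_iff {k : ℤ} {a : DeRham E M} :
    a ∈ formGrading E M k ↔ ∀ x, a.form x ∈ homog (TangentSpace 𝓘(ℝ, E) x) k := Iff.rfl

/-- The operator `F` on smooth forms acts fibrewise by `Φ`. -/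
def Acts (Φ : ∀ x : M, Module.End ℝ (ExtForm (TangentSpace 𝓘(ℝ, E) x)))
    (F : Module.End ℝ (DeRham E M)) : Prop :=
  ∀ a x, (F a).form x = Φ x (a.form x)

namespace Acts

variable {Φ Ψ : ∀ x : M, Module.End ℝ (ExtForm (TangentSpace 𝓘(ℝ, E) x))}
variable {F G : Module.End ℝ (DeRham E M)}

theorem eq (hF : Acts Φ F) (hG : Acts Ψ G) (h : ∀ x, Φ x = Ψ x) : F = G :=
  LinearMap.ext fun a => DeRham.ext fun x => by rw [hF, hG, h]

theorem congr (hF : Acts Φ F) (h : ∀ x, Φ x = Ψ x) : Acts Ψ F := fun a x => by rw [hF, h]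

theorem mul (hF : Acts Φ F) (hG : Acts Ψ G) : Acts (fun x => Φ x * Ψ x) (F * G) := fun a x => by
  rw [Module.End.mul_apply, hF, hG]
  rfl

theorem one : Acts (1 : ∀ x : M, Module.End ℝ (ExtForm (TangentSpace 𝓘(ℝ, E) x))) 1 :=
  fun _ _ => rfl

theorem zero : Acts (0 : ∀ x : M, Module.End ℝ (ExtForm (TangentSpace 𝓘(ℝ, E) x))) 0 :=
  fun _ _ => rfl

theorem add (hF : Acts Φ F) (hG : Acts Ψ G) : Acts (fun x => Φ x + Ψ x) (F + G) := fun a x => by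
  rw [LinearMap.add_apply, DeRham.form_add, hF, hG]
  rfl

theorem sub (hF : Acts Φ F) (hG : Acts Ψ G) : Acts (fun x => Φ x - Ψ x) (F - G) := fun a x => by
  rw [LinearMap.sub_apply, DeRham.form_sub, hF, hG]
  rfl

theorem neg (hF : Acts Φ F) : Acts (fun x => -Φ x) (-F) := fun a x => by
  rw [LinearMap.neg_apply, DeRham.form_neg, hF]
  rfl

theorem smul (c : ℝ) (hF : Acts Φ F) : Acts (fun x => c • Φ x) (c • F) := fun a x => by
  rw [LinearMap.smul_apply, DeRham.form_smul, hF]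
  rfl

theorem units_smul (u : ℤˣ) (hF : Acts Φ F) : Acts (fun x => u • Φ x) (u • F) := fun a x => by
  rw [LinearMap.smul_apply, DeRham.form_units_smul, hF]
  rfl

theorem lie (hF : Acts Φ F) (hG : Acts Ψ G) : Acts (fun x => ⁅Φ x, Ψ x⁆) ⁅F, G⁆ :=
  (hF.mul hG).sub (hG.mul hF)

theorem pow (hF : Acts Φ F) (n : ℕ) : Acts (fun x => Φ x ^ n) (F ^ n) := by
  induction n with
  | zero => exact one
  | succ n ih =>
    simp only [pow_succ]
    exact ih.mul hF

theorem sum {ι : Type*} (s : Finset ι)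
    {Θ : ι → ∀ x : M, Module.End ℝ (ExtForm (TangentSpace 𝓘(ℝ, E) x))}
    {H : ι → Module.End ℝ (DeRham E M)} (h : ∀ i ∈ s, Acts (Θ i) (H i)) :
    Acts (fun x => ∑ i ∈ s, Θ i x) (∑ i ∈ s, H i) := by
  classical
  induction s using Finset.induction_on with
  | empty => exact zero
  | insert i s hi ih =>
    simp only [Finset.sum_insert hi]
    exact (h i (Finset.mem_insert_self i s)).add
      (ih fun j hj => h j (Finset.mem_insert_of_mem hj))

theorem nilExp (N : ℕ) (hF : Acts Φ F) : Acts (fun x => nilExp N (Φ x)) (nilExp N F) :=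
  sum _ fun n _ => (hF.pow n).smul _

theorem weyl (N : ℕ) (hF : Acts Φ F) (hG : Acts Ψ G) :
    Acts (fun x => weyl N (Φ x) (Ψ x)) (weyl N F G) :=
  ((hG.neg.nilExp N).mul (hF.nilExp N)).mul (hG.neg.nilExp N)

end Acts

/-- The operator on smooth forms defined by a smooth family of operators on the fibres. -/
def fiberOp (Φ : ∀ x : M, Module.End ℝ (ExtForm (TangentSpace 𝓘(ℝ, E) x)))
    (hΦ : ∀ α ∈ SmoothForms E M, (fun x => Φ x (α x)) ∈ SmoothForms E M) :
    Module.End ℝ (DeRham E M) where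
  toFun a := ⟨fun x => Φ x (a.form x), hΦ _ a.2⟩
  map_add' a b := DeRham.ext fun x => map_add (Φ x) (a.form x) (b.form x)
  map_smul' c a := DeRham.ext fun x => map_smul (Φ x) c (a.form x)

theorem acts_fiberOp {Φ : ∀ x : M, Module.End ℝ (ExtForm (TangentSpace 𝓘(ℝ, E) x))}
    (hΦ : ∀ α ∈ SmoothForms E M, (fun x => Φ x (α x)) ∈ SmoothForms E M) :
    Acts Φ (fiberOp Φ hΦ) := fun _ _ => rfl

variable [IsManifold 𝓘(ℝ, E) ∞ M]

/-- The wedge product of smooth forms. -/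
def DeRham.mulₗ : DeRham E M →ₗ[ℝ] DeRham E M →ₗ[ℝ] DeRham E M :=
  LinearMap.mk₂ ℝ (fun a b => (⟨fun x => wedge (a.form x) (b.form x), wedge_mem a.2 b.2⟩ :
      SmoothForms E M))
    (fun a a' b => DeRham.ext fun x => by
      change wedge (a.form x + a'.form x) (b.form x) = _
      rw [map_add]
      rfl)
    (fun c a b => DeRham.ext fun x => by
      change wedge (c • a.form x) (b.form x) = _
      rw [map_smul]
      rfl)
    (fun a b b' => DeRham.ext fun x => map_add (wedge (a.form x)) (b.form x) (b'.form x))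
    (fun c a b => DeRham.ext fun x => map_smul (wedge (a.form x)) c (b.form x))

theorem DeRham.form_mul (a b : DeRham E M) (x : M) :
    (DeRham.mulₗ a b).form x = wedge (a.form x) (b.form x) := rfl

theorem acts_mul (a : DeRham E M) : Acts (fun x => wedge (a.form x)) (DeRham.mulₗ a) :=
  fun _ _ => rfl

/-- The constant function `1`. -/
def DeRham.unit : DeRham E M := ⟨fun _ => one, one_mem⟩

/-- The exterior derivative of smooth forms. -/
def DeRham.d : Module.End ℝ (DeRham E M) where
  toFun a := ⟨extd a.form, extd_mem a.2⟩
  map_add' a b := Subtype.ext (extd_add a.2 b.2)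
  map_smul' c a := Subtype.ext (extd_smul c a.2)

/-- Multiplication of the forms of degree `k` with the scalar `c k`. -/
def DeRham.diagOp (c : ℕ → ℝ) : Module.End ℝ (DeRham E M) :=
  fiberOp (fun _ => diag c) fun _ hα => diag_mem c hα

theorem acts_diagOp (c : ℕ → ℝ) : Acts (fun _ : M => diag c) (DeRham.diagOp (E := E) c) :=
  acts_fiberOp _

/-- Encodes that d raises degrees by one; its degree, its weight and its exchange with σ are special
choices of c. -/
theorem DeRham.d_mul_diagOp (c : ℕ → ℝ) :
    (DeRham.d * DeRham.diagOp (fun k => c (k + 1)) : Module.End ℝ (DeRham E M)) =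
      DeRham.diagOp c * DeRham.d :=
  LinearMap.ext fun a => Subtype.ext (extd_diag c a.2)

/-- The projection to the forms of degree `k`. -/
def DeRham.proj (k : ℤ) : Module.End ℝ (DeRham E M) :=
  DeRham.diagOp fun j => if (j : ℤ) = k then 1 else 0

theorem DeRham.form_proj (k : ℤ) (a : DeRham E M) (x : M) (j : ℕ) :
    (DeRham.proj k a).form x j = (if (j : ℤ) = k then (1 : ℝ) else 0) • a.form x j := rfl

theorem DeRham.proj_mem (k : ℤ) (a : DeRham E M) : DeRham.proj k a ∈ formGrading E M k := by
  intro x j hj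
  rw [DeRham.form_proj, if_neg hj, zero_smul]

theorem DeRham.proj_of_mem {k : ℤ} {a : DeRham E M} (ha : a ∈ formGrading E M k) :
    DeRham.proj k a = a := by
  refine DeRham.ext fun x => funext fun j => ?_
  rw [DeRham.form_proj]
  split_ifs with hj
  · rw [one_smul]
  · rw [ha x j hj, smul_zero]

theorem DeRham.proj_of_mem_ne {k l : ℤ} (hkl : l ≠ k) {a : DeRham E M}
    (ha : a ∈ formGrading E M l) : DeRham.proj k a = 0 := by
  refine DeRham.ext fun x => funext fun j => ?_
  rw [DeRham.form_proj]
  split_ifs with hj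
  · rw [ha x j (by omega), smul_zero]
    rfl
  · rw [zero_smul]
    rfl

theorem DeRham.sum_proj (a : DeRham E M) :
    ∑ k ∈ Finset.range (Module.finrank ℝ E + 1), DeRham.proj (k : ℤ) a = a := by
  have h := Acts.sum (Finset.range (Module.finrank ℝ E + 1)) fun (k : ℕ) _ =>
    acts_diagOp (E := E) (M := M) fun j => if (j : ℤ) = k then 1 else 0
  refine DeRham.ext fun x => ?_
  have h1 := h a x
  rw [LinearMap.sum_apply, LinearMap.sum_apply] at h1
  refine h1.trans (Eq.trans ?_ (ExtForm.sum_single (a.form x)))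
  refine Finset.sum_congr rfl fun k _ => funext fun j => ?_
  rw [diag_apply]
  by_cases hj : j = k
  · subst hj
    simp
  · rw [if_neg (by exact_mod_cast hj), zero_smul, Pi.single_eq_of_ne hj]

/-- The degree projections recover the components of a direct sum element, and finitely many of them
add up to the identity since degrees are bounded by dim E. -/
theorem isInternal_formGrading : DirectSum.IsInternal (formGrading E M) := by
  classical
  have key : ∀ (k : ℤ) (z : DirectSum ℤ fun i => formGrading E M i),
      DeRham.proj k (DirectSum.coeAddMonoidHom (formGrading E M) z) = (z k : DeRham E M) := by
    intro k z
    induction z using DirectSum.induction_on with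
    | zero => simp
    | of i a =>
      rw [DirectSum.coeAddMonoidHom_of]
      by_cases hik : i = k
      · subst hik
        rw [DeRham.proj_of_mem a.2, DirectSum.of_eq_same]
      · rw [DeRham.proj_of_mem_ne hik a.2, DirectSum.of_eq_of_ne _ _ _ (Ne.symm hik)]
        rfl
    | add z w hz hw => rw [map_add, map_add, hz, hw]; rfl
  refine ⟨(injective_iff_map_eq_zero _).2 fun z hz => ?_, fun a => ?_⟩
  · refine DFinsupp.ext fun k => Subtype.ext ?_
    have := key k z
    rw [hz, map_zero] at this
    exact this.symm
  · refine ⟨∑ k ∈ Finset.range (Module.finrank ℝ E + 1),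
      DirectSum.of (fun i => formGrading E M i) (k : ℤ) ⟨_, DeRham.proj_mem (k : ℤ) a⟩, ?_⟩
    rw [map_sum]
    simp only [DirectSum.coeAddMonoidHom_of]
    exact DeRham.sum_proj a

theorem DeRham.d_degree : BV.HasDegree (formGrading E M) 1 DeRham.d := by
  intro j a ha
  have h := LinearMap.congr_fun (DeRham.d_mul_diagOp (E := E) (M := M)
    fun i => if (i : ℤ) = j + 1 then 1 else 0) a
  have h1 : (DeRham.diagOp fun i : ℕ => if ((i + 1 : ℕ) : ℤ) = j + 1 then (1 : ℝ) else 0) a =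
      DeRham.proj j a := by
    rw [DeRham.proj]
    congr 2
    funext i
    simp
  rw [Module.End.mul_apply, h1, DeRham.proj_of_mem ha] at h
  rw [h]
  exact DeRham.proj_mem (j + 1) (DeRham.d a)

theorem isGradedCommAlgebra_deRham :
    BV.IsGradedCommAlgebra (formGrading E M) DeRham.mulₗ DeRham.unit where
  isInternal := isInternal_formGrading
  one_mem := fun _ => one_mem_homog
  mul_mem := fun _ _ _ ha _ hb x => wedge_mem_homog (ha x) (hb x)
  one_mul := fun _ => DeRham.ext fun _ => one_wedge _
  mul_one := fun _ => DeRham.ext fun _ => wedge_one _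
  mul_assoc := fun _ _ _ => DeRham.ext fun _ => wedge_assoc _ _ _
  mul_comm := fun i j a ha b hb => DeRham.ext fun x => by
    rw [DeRham.form_units_smul]
    exact wedge_comm_of_mem_homog (ha x) (hb x)

theorem DeRham.d_mul (a b : DeRham E M) (x : M) : (DeRham.d (DeRham.mulₗ a b)).form x =
    wedge ((DeRham.d a).form x) (b.form x) + wedge (parity (a.form x)) ((DeRham.d b).form x) :=
  congrFun (extd_wedge a.2 b.2) x

theorem isCDGA_deRham : BV.IsCDGA (formGrading E M) DeRham.mulₗ DeRham.unit DeRham.d where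
  toIsGradedCommAlgebra := isGradedCommAlgebra_deRham
  d_degree := DeRham.d_degree
  d_sq := LinearMap.ext fun a => Subtype.ext (extd_extd a.2)
  leibniz := fun i a ha b => DeRham.ext fun x => by
    rw [DeRham.d_mul, parity_of_mem_homog (ha x), DeRham.form_add, DeRham.form_units_smul,
      DeRham.form_mul, DeRham.form_mul]
    rcases Int.units_eq_one_or (Int.negOnePow i) with h | h <;> rw [h] <;> simp

/-- The order of operators acting fibrewise is computed in the fibres. -/
theorem Acts.hasOrderLE {Φ : ∀ x : M, Module.End ℝ (ExtForm (TangentSpace 𝓘(ℝ, E) x))}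
    {F : Module.End ℝ (DeRham E M)} (hF : Acts Φ F) {r : ℕ} {k : ℤ}
    (h : ∀ x, BV.HasOrderLE (homog (TangentSpace 𝓘(ℝ, E) x)) wedge r k (Φ x)) :
    BV.HasOrderLE (formGrading E M) DeRham.mulₗ r k F := by
  have hdeg : BV.HasDegree (formGrading E M) k F := fun j a ha =>
    mem_formGrading_iff.2 fun x => by
      rw [hF]
      exact (h x).degree j _ (ha x)
  have hcomm : ∀ (j : ℤ) (a : DeRham E M),
      Acts (fun x => BV.gradedComm j k (wedge (a.form x)) (Φ x))
        (BV.gradedComm j k (DeRham.mulₗ a) F) := fun j a =>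
    ((acts_mul a).mul hF).sub ((hF.mul (acts_mul a)).units_smul _)
  induction r generalizing k Φ F with
  | zero => exact ⟨hdeg, fun j a ha => (hcomm j a).eq Acts.zero fun x => (h x).2 j _ (ha x)⟩
  | succ r ih =>
    refine ⟨hdeg, fun j a ha => ?_⟩
    have h' := fun x => (h x).2 j _ (ha x)
    refine ih (hcomm j a) h' (fun i b hb => mem_formGrading_iff.2 fun x => ?_) fun i b => ?_
    · rw [hcomm j a]
      exact (h' x).degree i _ (hb x)
    · exact ((acts_mul b).mul (hcomm j a)).sub (((hcomm j a).mul (acts_mul b)).units_smul _)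

end DeRham

/-! ### The operators of an almost Hermitian structure on the de Rham algebra -/

section Operators

open ExtForm

set_option linter.unusedSectionVars false

variable {E : Type*} [NormedAddCommGroup E] [NormedSpace ℝ E] [FiniteDimensional ℝ E]
variable {M : Type*} [TopologicalSpace M] [ChartedSpace E M] [IsManifold 𝓘(ℝ, E) ∞ M]

/-- Exterior derivatives of forms and the sign operator. -/
theorem DeRham.diagOp_sign_mul_d :
    (DeRham.diagOp (fun k => (-1) ^ (k * (k + 1) / 2)) * DeRham.d : Module.End ℝ (DeRham E M)) =
      -(DeRham.d * DeRham.diagOp (fun k => (-1) ^ (k * (k + 1) / 2)) *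
        DeRham.diagOp fun k => (-1) ^ k) := by
  have h1 : (DeRham.diagOp (fun k => (-1) ^ (k * (k + 1) / 2)) *
      DeRham.diagOp (fun k => (-1) ^ k) : Module.End ℝ (DeRham E M)) =
      -DeRham.diagOp fun k => (-1) ^ ((k + 1) * (k + 1 + 1) / 2) := by
    refine ((acts_diagOp _).mul (acts_diagOp _)).eq (acts_diagOp _).neg fun x => ?_
    rw [diag_mul_diag, neg_diag]
    congr 1
    funext k
    rw [HermitianSpace.neg_one_pow_triangle_succ, pow_succ]
    ring
  rw [mul_assoc, h1, mul_neg, neg_neg, DeRham.d_mul_diagOp fun k => (-1) ^ (k * (k + 1) / 2)]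

namespace AlmostHermitianStructure

variable (S : AlmostHermitianStructure E M)

/-- The fundamental form as a smooth form. -/
def omegaForm : DeRham E M := ⟨S.omega, S.omega_mem⟩

/-- `Λ` on smooth forms. -/
def lam : Module.End ℝ (DeRham E M) :=
  fiberOp (fun x => (S.herm x).Lam) fun _ hα => S.Lam_mem hα

/-- `J` on smooth forms. -/
def jOp : Module.End ℝ (DeRham E M) :=
  fiberOp (fun x => (S.herm x).Jform) fun _ hα => S.Jform_mem hα

/-- `J⁻¹` on smooth forms. -/
def jInvOp : Module.End ℝ (DeRham E M) :=
  fiberOp (fun x => (S.herm x).JformInv) fun _ hα => S.JformInv_mem hα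

/-- `L = ω ∧ -` on smooth forms. -/
def lef : Module.End ℝ (DeRham E M) := DeRham.mulₗ S.omegaForm

/-- `dω ∧ -` on smooth forms. -/
def dOmegaOp : Module.End ℝ (DeRham E M) := DeRham.mulₗ (DeRham.d S.omegaForm)

theorem acts_lam : Acts (fun x => (S.herm x).Lam) S.lam := acts_fiberOp _

theorem acts_jOp : Acts (fun x => (S.herm x).Jform) S.jOp := acts_fiberOp _

theorem acts_jInvOp : Acts (fun x => (S.herm x).JformInv) S.jInvOp := acts_fiberOp _

theorem acts_lef : Acts (fun x => (S.herm x).L) S.lef := fun _ _ => rfl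

theorem acts_dOmegaOp : Acts S.domega S.dOmegaOp := fun _ _ => rfl

theorem extd_omega_eq (x : M) : extd S.omega x = Pi.single 3 (extd S.omega x 3) := by
  have h : S.omegaForm ∈ formGrading E M 2 := fun x => single_mem_homog 2 _
  exact eq_single_of_mem_homog (DeRham.d_degree 2 _ h x)

theorem domega_eq (x : M) : S.domega x = wedge (Pi.single 3 (extd S.omega x 3)) := by
  rw [domega]
  exact congrArg _ (S.extd_omega_eq x)

/-- The Leibniz rule for ω ∧ a; no sign appears since ω has even degree. -/
theorem lef_lie_d : ⁅S.lef, DeRham.d⁆ = -S.dOmegaOp := by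
  refine LinearMap.ext fun a => DeRham.ext fun x => ?_
  have h := DeRham.d_mul S.omegaForm a x
  have hP : parity (S.omegaForm.form x) = S.omegaForm.form x := (S.herm x).parity_omega
  rw [hP] at h
  change wedge (S.omegaForm.form x) ((DeRham.d a).form x) -
    (DeRham.d (DeRham.mulₗ S.omegaForm a)).form x =
      -wedge ((DeRham.d S.omegaForm).form x) (a.form x)
  rw [h]
  abel

/-- The weight operator on smooth forms. -/
def weightOp (E M : Type*) [NormedAddCommGroup E] [NormedSpace ℝ E] [FiniteDimensional ℝ E]
    [TopologicalSpace M] [ChartedSpace E M] [IsManifold 𝓘(ℝ, E) ∞ M] :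
    Module.End ℝ (DeRham E M) :=
  DeRham.diagOp fun k => (k : ℝ) - (Module.finrank ℝ E : ℝ) / 2

theorem acts_weightOp :
    Acts (fun x : M => HermitianSpace.weight (TangentSpace 𝓘(ℝ, E) x)) (weightOp E M) :=
  acts_diagOp _

theorem weightOp_lie_d : ⁅weightOp E M, (DeRham.d : Module.End ℝ (DeRham E M))⁆ = DeRham.d := by
  have h := DeRham.d_mul_diagOp (E := E) (M := M)
    fun k => (k : ℝ) - 1 - (Module.finrank ℝ E : ℝ) / 2
  have h1 : (fun k : ℕ => ((k + 1 : ℕ) : ℝ) - 1 - (Module.finrank ℝ E : ℝ) / 2) =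
      fun k : ℕ => (k : ℝ) - (Module.finrank ℝ E : ℝ) / 2 := by
    funext k
    push_cast
    ring
  rw [h1] at h
  have h2 : weightOp E M - DeRham.diagOp (fun k => (k : ℝ) - 1 - (Module.finrank ℝ E : ℝ) / 2) =
      1 := by
    refine ((acts_diagOp _).sub (acts_diagOp _)).eq Acts.one fun x => ?_
    rw [← diag_sub, Pi.one_apply, ← diag_one]
    congr 1
    funext k
    ring
  rw [Ring.lie_def, weightOp, h, ← sub_mul, ← weightOp, h2, one_mul]

/-- The first operator of the BV structure. -/
def deltaOne : Module.End ℝ (DeRham E M) := ⁅S.lam, DeRham.d⁆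

/-- The second operator of the BV structure. -/
def deltaTwo : Module.End ℝ (DeRham E M) := (1 / 2 : ℝ) • ⁅S.lam, S.deltaOne⁆

/-- The Weyl element of the Lefschetz `sl₂`-triple on smooth forms. -/
def weylElt : Module.End ℝ (DeRham E M) := weyl (Module.finrank ℝ E + 1) S.lef S.lam

theorem acts_weylElt : Acts (fun x => (S.herm x).weylOp) S.weylElt :=
  S.acts_lef.weyl _ S.acts_lam

/-- The relations between `d` and the Lefschetz operators. -/
theorem lam_lie_relations :
    S.deltaTwo = -((1 / 6 : ℝ) • ⁅S.lam, ⁅S.lam, ⁅S.lam, S.dOmegaOp⁆⁆⁆) ∧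
      ⁅S.lam, S.deltaTwo⁆ = 0 ∧
      S.weylElt * DeRham.d =
        (-S.deltaOne - (1 / 2 : ℝ) • ⁅S.lam, ⁅S.lam, S.dOmegaOp⁆⁆) * S.weylElt := by
  -- The relations among L, Λ, H and η are checked in each tangent space; only the two brackets with
  -- d are not pointwise.
  obtain ⟨h1, h2, h3⟩ := lie_differential (N := Module.finrank ℝ E + 1) (e := S.lef) (f := S.lam)
    (h := weightOp E M) (d := DeRham.d) (η := S.dOmegaOp)
    ((S.acts_lef.pow _).eq Acts.zero fun x => (S.herm x).L_pow_eq_zero)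
    ((S.acts_lam.pow _).eq Acts.zero fun x => (S.herm x).Lam_pow_eq_zero)
    ((S.acts_lef.lie S.acts_lam).eq acts_weightOp fun x => (S.herm x).L_lie_Lam)
    ((acts_weightOp.lie S.acts_lam).eq (S.acts_lam.smul 2).neg fun x => (S.herm x).weight_lie_Lam)
    S.lef_lie_d weightOp_lie_d
    ((S.acts_lef.lie S.acts_dOmegaOp).eq Acts.zero fun x => (S.herm x).L_lie_wedge _)
    ((acts_weightOp.lie S.acts_dOmegaOp).eq (S.acts_dOmegaOp.smul 3) fun x => by
      rw [domega_eq, HermitianSpace.weight_lie_wedge_single]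
      norm_num)
  refine ⟨h1, ?_, h3.eq⟩
  rw [deltaTwo, deltaOne, lie_smul, h2, smul_zero]

/-- The Hodge star on smooth forms. -/
def starElt : Module.End ℝ (DeRham E M) :=
  S.jOp * S.weylElt * DeRham.diagOp fun k => (-1) ^ (k * (k + 1) / 2)

theorem acts_starElt : Acts (fun x => (S.herm x).star) S.starElt :=
  ((S.acts_jOp.mul S.acts_weylElt).mul (acts_diagOp _)).congr fun x => (S.herm x).star_eq.symm

theorem induces_dcStar :
    Induces S.dcStar (-(S.starElt * (S.jInvOp * DeRham.d * S.jOp) * S.starElt)) := by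
  intro a
  have h : (S.starElt a).form = S.star a.form := funext fun x => S.acts_starElt a x
  funext x
  rw [LinearMap.neg_apply, DeRham.form_neg, Module.End.mul_apply, Module.End.mul_apply,
    S.acts_starElt]
  rw [dcStar, ← h]
  rfl

/-- With ⋆ = J w σ, the factors J collapse to the parity and the claim becomes a conjugation of d by
w, known from `lam_lie_relations`. All remaining signs cancel. -/
theorem conj_d_eq : -(S.starElt * (S.jInvOp * DeRham.d * S.jOp) * S.starElt) =
    -S.deltaOne - (1 / 2 : ℝ) • ⁅S.lam, ⁅S.lam, S.dOmegaOp⁆⁆ := by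
  obtain ⟨-, -, hw⟩ := S.lam_lie_relations
  set D := -S.deltaOne - (1 / 2 : ℝ) • ⁅S.lam, ⁅S.lam, S.dOmegaOp⁆⁆ with hD
  set c : ℝ := (-1) ^ (Module.finrank ℝ E / 2) with hc
  set σ : Module.End ℝ (DeRham E M) := DeRham.diagOp fun k => (-1) ^ (k * (k + 1) / 2) with hσ
  set P : Module.End ℝ (DeRham E M) := DeRham.diagOp fun k => (-1) ^ k with hP
  set w := S.weylElt with hw'
  have aσ : Acts (fun x : M => HermitianSpace.signOp (TangentSpace 𝓘(ℝ, E) x)) σ := acts_diagOp _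
  have aP : Acts (fun x : M => (parity : Module.End ℝ (ExtForm (TangentSpace 𝓘(ℝ, E) x)))) P :=
    acts_diagOp _
  have hσd : σ * DeRham.d = -(DeRham.d * σ * P) := DeRham.diagOp_sign_mul_d
  have hJw : S.jOp * w = w * S.jOp := (S.acts_jOp.mul S.acts_weylElt).eq
    (S.acts_weylElt.mul S.acts_jOp) fun x => (S.herm x).Jform_commute_weylOp.eq
  have hJσ : S.jOp * σ = σ * S.jOp := (S.acts_jOp.mul aσ).eq (aσ.mul S.acts_jOp) fun x =>
    (S.herm x).Jform_mul_diag _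
  have hJJi : S.jOp * S.jInvOp = 1 := (S.acts_jOp.mul S.acts_jInvOp).eq Acts.one fun x =>
    (S.herm x).Jform_mul_JformInv
  have hJJ : S.jOp * S.jOp = P := (S.acts_jOp.mul S.acts_jOp).eq aP fun x =>
    (S.herm x).Jform_mul_Jform
  have hPP : P * P = 1 := (aP.mul aP).eq Acts.one fun x => parity_mul_parity
  have hσσ : σ * σ = 1 := (aσ.mul aσ).eq Acts.one fun x =>
    HermitianSpace.signOp_mul_signOp
  have hσP : σ * P = P * σ := (aσ.mul aP).eq (aP.mul aσ) fun x =>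
    HermitianSpace.signOp_commute_parity.eq
  have hσw : σ * w = c • (w * σ * P) := (aσ.mul S.acts_weylElt).eq
    (((S.acts_weylElt.mul aσ).mul aP).smul c) fun x => (S.herm x).signOp_mul_weylOp
  have hww : w * w = c • P := (S.acts_weylElt.mul S.acts_weylElt).eq (aP.smul c) fun x =>
    (S.herm x).weylOp_mul_weylOp
  have hcc : c * c = 1 := HermitianSpace.neg_one_pow_mul_self _
  have hJwσ : S.jOp * w * σ = w * σ * S.jOp := by
    rw [hJw, mul_assoc, hJσ, ← mul_assoc]
  calc -(S.starElt * (S.jInvOp * DeRham.d * S.jOp) * S.starElt)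
      = -(S.jOp * w * σ * (S.jInvOp * DeRham.d * S.jOp) * (S.jOp * w * σ)) := rfl
    _ = -(w * σ * S.jOp * (S.jInvOp * DeRham.d * S.jOp) * (S.jOp * w * σ)) := by rw [← hJwσ]
    -- On the left of d, J meets J⁻¹ and disappears; on its right, two factors J combine to the
    -- parity P.
    _ = -(w * (σ * DeRham.d) * P * w * σ) := by
        rw [← hJJ]
        simp only [mul_assoc]
        rw [← mul_assoc S.jOp S.jInvOp, hJJi, one_mul]
    _ = w * DeRham.d * (σ * (P * P) * w * σ) := by
        rw [hσd, mul_neg, neg_mul, neg_mul, neg_mul, neg_neg]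
        simp only [mul_assoc]
    -- Once w has been moved past d, what is left is c w² σ P σ = c w² P = c² = 1.
    _ = D * w * (c • (w * (σ * P * σ))) := by
        rw [hPP, mul_one, hσw, hw, smul_mul_assoc]
        simp only [mul_assoc]
    _ = D * (c • (w * w) * P) := by
        rw [hσP, mul_assoc P, hσσ, mul_one]
        simp only [mul_assoc, mul_smul_comm, smul_mul_assoc]
    _ = D := by
        rw [hww, smul_smul, hcc, one_smul, hPP, mul_one]

theorem induces_TcStar :
    Induces S.TcStar ((1 / 2 : ℝ) • ⁅S.lam, ⁅S.lam, S.dOmegaOp⁆⁆) := by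
  intro a
  funext x
  rw [((S.acts_lam.lie (S.acts_lam.lie S.acts_dOmegaOp)).smul (1 / 2)) a x, TcStar, Tc, T,
    ← Ring.lie_def, domega_eq, HermitianSpace.adjoint_conj_lie_wedge_three,
    ← domega_eq]

theorem induces_domegacStar : Induces S.domegacStar S.deltaTwo := by
  intro a
  funext x
  rw [S.lam_lie_relations.1,
    (((S.acts_lam.lie (S.acts_lam.lie (S.acts_lam.lie S.acts_dOmegaOp))).smul (1 / 6)).neg) a x,
    domegacStar, domegac, domega_eq, HermitianSpace.adjoint_conj_wedge_three,
    ← domega_eq]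

theorem induces_deltaOne : Induces (fun α => -(S.dcStar α + S.TcStar α)) S.deltaOne := by
  intro a
  have h1 := S.induces_dcStar a
  rw [conj_d_eq] at h1
  change _ = -(S.dcStar a.form + S.TcStar a.form)
  rw [← h1, ← S.induces_TcStar a]
  funext x
  rw [Pi.neg_apply, Pi.add_apply, ← DeRham.form_add, ← DeRham.form_neg]
  congr 1
  rw [← LinearMap.add_apply, sub_add_cancel, LinearMap.neg_apply, neg_neg]

theorem lam_hasOrderLE : BV.HasOrderLE (formGrading E M) DeRham.mulₗ 2 (-2) S.lam :=
  S.acts_lam.hasOrderLE fun x => (S.herm x).Lam_hasOrderLE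

/-- Λ has even degree, so the plain commutator with it is the graded one, and orders 2 and 1 combine
to 2. -/
theorem deltaOne_hasOrderLE : BV.HasOrderLE (formGrading E M) DeRham.mulₗ 2 (-1) S.deltaOne := by
  have h := S.lam_hasOrderLE.gradedComm isGradedCommAlgebra_deRham isCDGA_deRham.order_d
    (n := 2) rfl
  have h1 : BV.gradedComm (-2) 1 S.lam DeRham.d = S.deltaOne := by
    rw [BV.gradedComm, Int.negOnePow_even _ (by decide), one_smul]
    rfl
  rw [h1] at h
  exact h

theorem deltaTwo_hasOrderLE : BV.HasOrderLE (formGrading E M) DeRham.mulₗ 3 (-3) S.deltaTwo := by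
  have h := S.lam_hasOrderLE.gradedComm isGradedCommAlgebra_deRham S.deltaOne_hasOrderLE
    (n := 3) rfl
  have h1 : BV.gradedComm (-2) (-1) S.lam S.deltaOne = ⁅S.lam, S.deltaOne⁆ := by
    rw [BV.gradedComm, Int.negOnePow_even _ (by decide), one_smul]
    rfl
  rw [h1] at h
  exact h.smul _

/-- The operators are the normalized brackets ad_Λⁱ(d)/i!, and the sequence stops because Λ commutes
with Δ₂. -/
theorem mk_operators : PowerSeries.mk (BV.operators DeRham.d S.deltaOne S.deltaTwo) =
    BV.expSeries S.lam * PowerSeries.C DeRham.d * BV.expSeries (-S.lam) := by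
  have hz : ∀ i : ℕ, ⁅S.lam, BV.operators DeRham.d S.deltaOne S.deltaTwo i⁆ =
      ((i : ℝ) + 1) • BV.operators DeRham.d S.deltaOne S.deltaTwo (i + 1) := by
    intro i
    match i with
    | 0 => simp [BV.operators, deltaOne]
    | 1 =>
      simp only [BV.operators, deltaTwo, smul_smul]
      norm_num
    | 2 =>
      simp only [BV.operators]
      rw [S.lam_lie_relations.2.1, smul_zero]
    | i + 3 => simp [BV.operators]
  have h := expSeries_mul_C hz
  change BV.expSeries S.lam * PowerSeries.C DeRham.d = _ at h
  rw [h, mul_assoc, expSeries_mul_expSeries_neg, mul_one]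

/-- The sum is a coefficient of the square of e^{Λξ} d e^{-Λξ}, a conjugate of d² = 0. -/
theorem operators_relation (n : ℕ) : ∑ p ∈ Finset.HasAntidiagonal.antidiagonal n,
    BV.operators DeRham.d S.deltaOne S.deltaTwo p.1 *
      BV.operators DeRham.d S.deltaOne S.deltaTwo p.2 = 0 := by
  have h1 : BV.expSeries (-S.lam) * BV.expSeries S.lam = 1 := by
    have := expSeries_mul_expSeries_neg (-S.lam)
    rwa [neg_neg] at this
  have hd : (PowerSeries.C DeRham.d * PowerSeries.C DeRham.d :
      PowerSeries (Module.End ℝ (DeRham E M))) = 0 := by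
    rw [← map_mul, isCDGA_deRham.d_sq, map_zero]
  have h : PowerSeries.mk (BV.operators DeRham.d S.deltaOne S.deltaTwo) *
      PowerSeries.mk (BV.operators DeRham.d S.deltaOne S.deltaTwo) = 0 := by
    calc _ = BV.expSeries S.lam * (PowerSeries.C DeRham.d *
          (BV.expSeries (-S.lam) * BV.expSeries S.lam) * PowerSeries.C DeRham.d) *
            BV.expSeries (-S.lam) := by
          rw [mk_operators]
          simp only [mul_assoc]
      _ = 0 := by rw [h1, mul_one, hd, mul_zero, zero_mul]
  have h2 := congrArg (PowerSeries.coeff n) h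
  rw [PowerSeries.coeff_mul, map_zero] at h2
  simpa only [PowerSeries.coeff_mk] using h2

theorem isCommBVInfinity : BV.IsCommBVInfinity (formGrading E M) DeRham.mulₗ DeRham.unit
    (BV.operators DeRham.d S.deltaOne S.deltaTwo) := by
  have horder : ∀ n : ℕ, BV.HasOrderLE (formGrading E M) DeRham.mulₗ (n + 1) (1 - 2 * (n : ℤ))
      (BV.operators DeRham.d S.deltaOne S.deltaTwo n) := by
    intro n
    match n with
    | 0 => exact isCDGA_deRham.order_d
    | 1 => exact S.deltaOne_hasOrderLE
    | 2 => exact S.deltaTwo_hasOrderLE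
    | n + 3 => exact BV.HasOrderLE.zero _ _
  exact ⟨isCDGA_deRham, ⟨isInternal_formGrading, fun n => (horder n).degree,
    S.operators_relation⟩, horder⟩

theorem totalDifferential_eq : PowerSeries.C DeRham.d + PowerSeries.C S.deltaOne * PowerSeries.X +
    PowerSeries.C S.deltaTwo * PowerSeries.X ^ 2 =
      BV.expSeries S.lam * PowerSeries.C DeRham.d * BV.expSeries (-S.lam) := by
  rw [← mk_operators]
  ext1 n
  rw [PowerSeries.coeff_mk, map_add, map_add, ← pow_one (PowerSeries.X), ← pow_mul,
    PowerSeries.coeff_C_mul_X_pow, PowerSeries.coeff_C_mul_X_pow, PowerSeries.coeff_C]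
  match n with
  | 0 => simp [BV.operators]
  | 1 => simp [BV.operators]
  | 2 => simp [BV.operators]
  | n + 3 => simp [BV.operators]

theorem dOmegaOp_eq_zero (h : extd S.omega = 0) : S.dOmegaOp = 0 :=
  S.acts_dOmegaOp.eq Acts.zero fun x => by
    rw [domega, h]
    exact map_zero _

theorem induces_neg_dcStar (h : extd S.omega = 0) :
    Induces (fun α => -S.dcStar α) S.deltaOne := by
  intro a
  have h1 := S.induces_dcStar a
  rw [S.conj_d_eq, S.dOmegaOp_eq_zero h, lie_zero, lie_zero, smul_zero, sub_zero] at h1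
  change _ = -S.dcStar a.form
  rw [← h1]
  exact (congrArg DeRham.form (neg_neg (S.deltaOne a))).symm

theorem deltaTwo_eq_zero (h : extd S.omega = 0) : S.deltaTwo = 0 := by
  rw [S.lam_lie_relations.1, S.dOmegaOp_eq_zero h, lie_zero, lie_zero, lie_zero, smul_zero,
    neg_zero]

/-- Λ and i_π are the same operator at every point, so [i_π, d] = [Λ, d]; closedness of ω plays no
role here. -/
theorem induces_koszul : Induces S.koszul S.deltaOne := by
  have hπ : ∀ α, S.iPi α = S.Lam α := fun α => funext fun x =>
    ((S.herm x).Lam_eq_poissonContraction (α x)).symm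
  intro a
  rw [koszul, hπ, hπ]
  rfl

end AlmostHermitianStructure

end Operators

end

theorem mainTheorem2 {E : Type*} [NormedAddCommGroup E] [NormedSpace ℝ E] [FiniteDimensional ℝ E]
    {M : Type*} [TopologicalSpace M] [T2Space M] [SecondCountableTopology M]
    [ChartedSpace E M] [IsManifold 𝓘(ℝ, E) ∞ M] (S : AlmostHermitianStructure E M) :
    (∀ x : M, (S.herm x).IsHodgeStar (S.herm x).star) ∧
    ∃ (mul : DeRham E M →ₗ[ℝ] DeRham E M →ₗ[ℝ] DeRham E M) (one : DeRham E M)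
      (d Λ Δ₁ Δ₂ : Module.End ℝ (DeRham E M)),
      (∀ a b, (mul a b).form = fun x => ExtForm.wedge (a.form x) (b.form x)) ∧
      (one.form = fun _ => ExtForm.one) ∧
      Induces extd d ∧
      Induces S.Lam Λ ∧
      Induces (fun α => -(S.dcStar α + S.TcStar α)) Δ₁ ∧
      Induces S.domegacStar Δ₂ ∧
      BV.IsCommBVInfinity (formGrading E M) mul one (BV.operators d Δ₁ Δ₂) ∧
      PowerSeries.C d + PowerSeries.C Δ₁ * PowerSeries.X + PowerSeries.C Δ₂ * PowerSeries.X ^ 2 =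
        BV.expSeries Λ * PowerSeries.C d * BV.expSeries (-Λ) ∧
      (extd S.omega = 0 →
        Induces (fun α => -S.dcStar α) Δ₁ ∧ Induces S.koszul Δ₁ ∧ Δ₂ = 0) := by
  refine ⟨fun x => (S.herm x).star_isHodgeStar, DeRham.mulₗ, DeRham.unit, DeRham.d, S.lam,
    S.deltaOne, S.deltaTwo, fun _ _ => rfl, rfl, fun _ => rfl, fun _ => rfl, S.induces_deltaOne,
    S.induces_domegacStar, S.isCommBVInfinity, S.totalDifferential_eq, fun h =>
      ⟨S.induces_neg_dcStar h, S.induces_koszul, S.deltaTwo_eq_zero h⟩⟩
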